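/- A \emph{square complex} is a cubical complex of dimension at most $2$, not necessarily locally finite: its closed cells are embedded points, unit intervals $[0,1]$ and unit squares $[0,1]^2$, every face of a cell is a cell, and two cells that meet do so in a common face, along which they are glued isometrically. When it is connected, it carries the length metric $d$ induced by the Euclidean metrics of its cells; it is \emph{CAT(0)} if $(X,d)$ is a CAT(0) geodesic metric space, and \emph{hyperbolic} if there is $\delta\ge 0$ such that in every geodesic triangle of $(X,d)$ each side lies in the $\delta$-neighbourhood of the union of the other two. \textbf{Theorem A.} Let $G$ be a group acting by automorphisms of the complex (that is, every element of $G$ sends each cell isometrically onto a cell) on a hyperbolic CAT(0) square complex $X$. Suppose that the action is weakly acylindrical: there exist constants $L, N\ge 0$ such that for all $x,y\in X$ with $d(x,y)\ge L$, at most $N$ elements $g\in G$ satisfy $gx=x$ and $gy=y$. Then the action is acylindrical: for every $r\ge 0$ there exist constants $L(r), N(r)\ge 0$ such that for all $x,y\in X$ with $d(x,y)\ge L(r)$, at most $N(r)$ elements $g\in G$ satisfy $d(x,gx)\le r$ and $d(y,gy)\le r$. -/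

import Mathlib

open Set

universe u v w

/-! ### Metric geometry -/

/-- `γ`, restricted to `[0, 1]`, is a geodesic from `x` to `y`, parametrised proportionally to
arc length. -/
def IsGeodesicFrom {X : Type u} [MetricSpace X] (γ : ℝ → X) (x y : X) : Prop :=
  γ 0 = x ∧ γ 1 = y ∧
    ∀ s ∈ Icc (0 : ℝ) 1, ∀ t ∈ Icc (0 : ℝ) 1, dist (γ s) (γ t) = |s - t| * dist x y

/-- Any two points are joined by a geodesic. -/
def IsGeodesicSpace (X : Type u) [MetricSpace X] : Prop :=
  ∀ x y : X, ∃ γ : ℝ → X, IsGeodesicFrom γ x y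

/-- A CAT(0) space: a geodesic metric space in which the distance between two points of a
geodesic triangle is at most the distance between the corresponding points of a comparison
triangle in the Euclidean plane. (The two points may be taken on two sides with a common
vertex `p`; the points `s` and `t` along these sides correspond to the points dividing the sides
of the comparison triangle in the same ratios.) -/
def IsCAT0 (X : Type u) [MetricSpace X] : Prop :=
  IsGeodesicSpace X ∧
    ∀ (p q r : X) (α β : ℝ → X), IsGeodesicFrom α p q → IsGeodesicFrom β p r →
      ∀ p' q' r' : EuclideanSpace ℝ (Fin 2),
        dist p' q' = dist p q → dist q' r' = dist q r → dist p' r' = dist p r →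
          ∀ s ∈ Icc (0 : ℝ) 1, ∀ t ∈ Icc (0 : ℝ) 1,
            dist (α s) (β t) ≤ dist (AffineMap.lineMap p' q' s) (AffineMap.lineMap p' r' t)

/-- A hyperbolic geodesic space: there is `δ` such that every side of every
geodesic triangle lies in the `δ`-neighbourhood of the union of the two other sides. -/
def IsHyperbolicSpace (X : Type u) [MetricSpace X] : Prop :=
  IsGeodesicSpace X ∧
    ∃ δ : ℝ, 0 ≤ δ ∧ ∀ (x y z : X) (α β γ : ℝ → X),
      IsGeodesicFrom α x y → IsGeodesicFrom β y z → IsGeodesicFrom γ x z →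
        ∀ s ∈ Icc (0 : ℝ) 1, ∃ t ∈ Icc (0 : ℝ) 1,
          dist (α s) (β t) ≤ δ ∨ dist (α s) (γ t) ≤ δ

/-! ### Square complexes -/

/-- The unit cube `[0, 1]ⁿ`, with the Euclidean metric. -/
def unitCube (n : ℕ) : Set (EuclideanSpace ℝ (Fin n)) :=
  {x | ∀ i, x i ∈ Icc (0 : ℝ) 1}

/-- `F` is a face of the unit cube (of any dimension, the cube itself included): some of the
coordinates are fixed to be `0` or `1`. -/
def IsCubeFace {n : ℕ} (F : Set (unitCube n)) : Prop :=
  ∃ (S : Set (Fin n)) (a : Fin n → ℝ), (∀ i, a i = 0 ∨ a i = 1) ∧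
    F = {x | ∀ i ∈ S, x.1 i = a i}

/-- A square complex with underlying set `X`: a cubical complex of dimension at most `2`. Its
closed cells are embedded copies of a point, the unit interval or the unit square; they cover `X`,
every face of a cell is a cell, and two cells that meet do so in a common face, along which they
are glued by an isometry. No local finiteness is required. -/
structure SquareComplex (X : Type u) where
  /-- the type of (closed) cells -/
  Cell : Type v
  /-- the dimension of a cell -/
  dim : Cell → ℕ
  dim_le_two : ∀ c, dim c ≤ 2
  /-- the characteristic map of a cell -/
  chart : ∀ c, unitCube (dim c) → X
  chart_injective : ∀ c, Function.Injective (chart c)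
  exists_cell : ∀ x : X, ∃ c, x ∈ range (chart c)
  eq_of_range_eq : ∀ c d, range (chart c) = range (chart d) → c = d
  exists_face : ∀ c (F : Set (unitCube (dim c))), IsCubeFace F →
    ∃ d, range (chart d) = chart c '' F
  inter_cells : ∀ c d, (range (chart c) ∩ range (chart d)).Nonempty →
    ∃ (F : Set (unitCube (dim c))) (F' : Set (unitCube (dim d))) (h : F ≃ᵢ F'),
      IsCubeFace F ∧ IsCubeFace F' ∧
        ∀ p q, chart c p = chart d q ↔ ∃ hp : p ∈ F, (h ⟨p, hp⟩ : unitCube (dim d)) = q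

namespace SquareComplex

variable {X : Type u}

/-- `K.HasString x y l`: there is a piecewise linear path of length `l` from `x` to `y`, that is, a
finite chain of points from `x` to `y`, consecutive ones lying in a common cell, such that the sum
of the distances between consecutive points, measured in the Euclidean metrics of the cells,
is `l`. -/
inductive HasString (K : SquareComplex.{u, v} X) : X → X → ℝ → Prop
  | nil (x : X) : HasString K x x 0
  | cons (c : K.Cell) (p q : unitCube (K.dim c)) (y : X) (l : ℝ) :
      HasString K (K.chart c q) y l → HasString K (K.chart c p) y (dist p q + l)

/-- The metric of `X` is the intrinsic (length) metric of the complex `K`, for the Euclidean metrics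
on the cells: the distance between two points is the infimum of the lengths of the piecewise
linear paths between them. (In particular `K` is connected: the empty set of reals has no greatest
lower bound.) -/
def IsIntrinsicMetric [MetricSpace X] (K : SquareComplex.{u, v} X) : Prop :=
  ∀ x y : X, IsGLB {l : ℝ | K.HasString x y l} (dist x y)

/-- The group `G` acts on `X` by automorphisms of the square complex `K`: every element of `G` sends
each cell isometrically onto a cell. -/
def IsCellularAction (K : SquareComplex.{u, v} X) (G : Type w) [Group G] [MulAction G X] : Prop :=
  ∀ (g : G) (c : K.Cell), ∃ (d : K.Cell) (φ : unitCube (K.dim c) ≃ᵢ unitCube (K.dim d)),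
    ∀ p, g • K.chart c p = K.chart d (φ p)

end SquareComplex

/-! ### Acylindricity -/

/-- Weak acylindricity: two points that are far apart are both fixed by at most `N` elements. -/
def IsWeaklyAcylindrical (G : Type w) (X : Type u) [Group G] [MetricSpace X] [MulAction G X] :
    Prop :=
  ∃ (L : ℝ) (N : ℕ), 0 ≤ L ∧ ∀ x y : X, L ≤ dist x y →
    {g : G | g • x = x ∧ g • y = y}.encard ≤ N

/-- Acylindricity: for every `r`, two points that are far apart are both moved by at most `r` by at
most `N` elements. -/
def IsAcylindrical (G : Type w) (X : Type u) [Group G] [MetricSpace X] [MulAction G X] :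
    Prop :=
  ∀ r : ℝ, 0 ≤ r → ∃ (L : ℝ) (N : ℕ), 0 ≤ L ∧ ∀ x y : X, L ≤ dist x y →
    {g : G | dist x (g • x) ≤ r ∧ dist y (g • y) ≤ r}.encard ≤ N

/-!
The proof replaces the action on points by the action on walls. A wall is encoded as the
nearest-point projection `coord E : X → [0, 1]` to an oriented edge `E`. The projections to the
parallel transversals of a square agree (`IsSquare.coord_eq`), so that two edges have the same wall
if they are dual to the same hyperplane, and the points where a wall is strictly between `0` and
`1` lie on edges and squares parallel to `E` (`IsEdge.exists_parallel`). Both facts come from one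
observation: a geodesic perpendicular to an edge runs straight through squares, since local
geodesics of a CAT(0) space are geodesics. It follows that level sets and halfspaces of walls are
convex, that the number of walls separating two vertices is comparable to their distance
(`IsVertex.dist_le_ncard`, `Between.card_le`), and that among three walls separating two vertices
two are nested, as three pairwise crossing hyperplanes would form a triangle with three right
angles (`not_cross_cross_cross`).

Let `x` and `y` be vertices at a large distance, and let `S` be the set of the elements of `G` that
move both of them by a bounded amount. The walls from `x` to `y` form a poset of width at most two.
A wall that has many walls on either side is sent by the elements of `S` to walls from `x` to `y`,
and its rank in the poset changes by a bounded amount (`gact_mem_rankNhd`); hence it has only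
boundedly many images under `S`. There are two such walls `f` and `h` with a long chain of walls
between them (`Between.exists_deep_pair`), so their hyperplanes are far apart. By the pigeonhole
principle, it remains to bound the common stabiliser of `f` and `h`. By hyperbolicity, the points
of one hyperplane that are almost closest to the other one form a bounded set
(`dist_le_of_hyperbolic`), which the stabiliser preserves. An approximate circumcentre of this set
is almost fixed, and as the complex has only finitely many shapes of cells there is a fixed point
nearby (`IsCellularAction.exists_fixed_of_almost_fixed`). This gives one fixed point near each of
the two hyperplanes, and weak acylindricity bounds the stabiliser
(`IsCellularAction.encard_stabilizer_le`).
-/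

/-! ### Geometry of CAT(0) spaces -/

section CAT0

variable {X : Type u} [MetricSpace X]

/-- `z` lies on a geodesic from `x` to `y`. -/
def MetricBtw (x z y : X) : Prop := dist x z + dist z y = dist x y

theorem MetricBtw.symm {x z y : X} (h : MetricBtw x z y) : MetricBtw y z x := by
  unfold MetricBtw at *
  rw [dist_comm y z, dist_comm z x, dist_comm y x]
  linarith

theorem exists_comparison_triangle {A B C : ℝ} (hA : 0 ≤ A) (hB : 0 ≤ B) (hC : 0 ≤ C)
    (h1 : A ≤ B + C) (h2 : B ≤ A + C) (h3 : C ≤ A + B) :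
    ∃ p q r : EuclideanSpace ℝ (Fin 2), dist p q = A ∧ dist q r = C ∧ dist p r = B := by
  obtain ⟨x, hx, hxB⟩ : ∃ x : ℝ, 2 * A * x = A ^ 2 + B ^ 2 - C ^ 2 ∧ x ^ 2 ≤ B ^ 2 := by
    rcases hA.eq_or_lt with rfl | hA
    · have : B = C := by linarith
      exact ⟨B, by subst this; ring, le_rfl⟩
    · refine ⟨(A ^ 2 + B ^ 2 - C ^ 2) / (2 * A), by field_simp, ?_⟩
      rw [div_pow, div_le_iff₀ (by positivity)]
      have h4 : 0 ≤ ((A + B) ^ 2 - C ^ 2) * (C ^ 2 - (A - B) ^ 2) := by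
        apply mul_nonneg <;> nlinarith
      nlinarith
  have hs : Real.sqrt (B ^ 2 - x ^ 2) ^ 2 = B ^ 2 - x ^ 2 := Real.sq_sqrt (by linarith)
  refine ⟨!₂[0, 0], !₂[A, 0], !₂[x, Real.sqrt (B ^ 2 - x ^ 2)], ?_, ?_, ?_⟩
  · rw [EuclideanSpace.dist_eq]
    simp [Real.dist_eq, Real.sqrt_sq hA]
  · rw [EuclideanSpace.dist_eq]
    simp only [Fin.sum_univ_two, Real.dist_eq, sq_abs]
    rw [Real.sqrt_eq_iff_mul_self_eq (by positivity) hC]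
    simp
    nlinarith
  · rw [EuclideanSpace.dist_eq]
    simp only [Fin.sum_univ_two, Real.dist_eq, sq_abs]
    rw [Real.sqrt_eq_iff_mul_self_eq (by positivity) hB]
    simp
    nlinarith

theorem dist_lineMap_lineMap_sq (p q r : EuclideanSpace ℝ (Fin 2)) (s t : ℝ) :
    dist (AffineMap.lineMap p q s) (AffineMap.lineMap p r t) ^ 2 =
      s ^ 2 * dist p q ^ 2 + t ^ 2 * dist p r ^ 2
        - s * t * (dist p q ^ 2 + dist p r ^ 2 - dist q r ^ 2) := by
  have e1 : AffineMap.lineMap p q s - AffineMap.lineMap p r t = s • (q - p) - t • (r - p) := by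
    simp only [AffineMap.lineMap_apply, vsub_eq_sub, vadd_eq_add]
    abel
  have e2 : dist q r = ‖(q - p) - (r - p)‖ := by rw [dist_eq_norm]; congr 1; abel
  rw [dist_eq_norm, e1, e2, dist_comm p q, dist_comm p r, dist_eq_norm q p, dist_eq_norm r p,
    norm_sub_sq_real (s • (q - p)), norm_sub_sq_real (q - p), norm_smul, norm_smul, mul_pow,
    mul_pow, real_inner_smul_left, real_inner_smul_right]
  simp only [Real.norm_eq_abs, sq_abs]
  ring

theorem IsCAT0.dist_sq_le_of_geodesic (hX : IsCAT0 X) {p q r : X} {α β : ℝ → X}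
    (hα : IsGeodesicFrom α p q) (hβ : IsGeodesicFrom β p r) {s t : ℝ}
    (hs : s ∈ Icc (0 : ℝ) 1) (ht : t ∈ Icc (0 : ℝ) 1) :
    dist (α s) (β t) ^ 2 ≤ s ^ 2 * dist p q ^ 2 + t ^ 2 * dist p r ^ 2
        - s * t * (dist p q ^ 2 + dist p r ^ 2 - dist q r ^ 2) := by
  obtain ⟨p', q', r', h1, h2, h3⟩ := exists_comparison_triangle (A := dist p q) (B := dist p r)
    (C := dist q r) dist_nonneg dist_nonneg dist_nonneg
    (by linarith [dist_triangle p r q, dist_comm q r]) (dist_triangle _ _ _)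
    (by linarith [dist_triangle q p r, dist_comm q p])
  have := hX.2 p q r α β hα hβ p' q' r' h1 h2 h3 s hs t ht
  rw [← h1, ← h2, ← h3, ← dist_lineMap_lineMap_sq]
  gcongr

theorem IsGeodesicFrom.dist_left {γ : ℝ → X} {x y : X} (h : IsGeodesicFrom γ x y) {t : ℝ}
    (ht : t ∈ Icc (0 : ℝ) 1) : dist x (γ t) = t * dist x y := by
  conv_lhs => rw [← h.1]
  rw [h.2.2 0 (by simp) t ht, zero_sub, abs_neg, abs_of_nonneg ht.1]

theorem IsGeodesicFrom.dist_right {γ : ℝ → X} {x y : X} (h : IsGeodesicFrom γ x y) {t : ℝ}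
    (ht : t ∈ Icc (0 : ℝ) 1) : dist (γ t) y = (1 - t) * dist x y := by
  conv_lhs => rw [← h.2.1]
  rw [h.2.2 t ht 1 (by simp), abs_sub_comm, abs_of_nonneg (by linarith [ht.2])]

/-- Geodesics are unique. -/
theorem IsCAT0.eq_of_dist_eq (hX : IsCAT0 X) {p q z : X} {α : ℝ → X}
    (hα : IsGeodesicFrom α p q) {s : ℝ} (hs : s ∈ Icc (0 : ℝ) 1)
    (h1 : dist p z = s * dist p q) (h2 : dist z q = (1 - s) * dist p q) : α s = z := by
  obtain ⟨β, hβ⟩ := hX.1 p z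
  have h := hX.dist_sq_le_of_geodesic hα hβ hs (t := 1) (by simp)
  rw [hβ.2.1, dist_comm q z, h1, h2] at h
  have h3 : dist (α s) z ^ 2 ≤ 0 := by nlinarith
  exact dist_eq_zero.1 (by nlinarith [dist_nonneg (x := α s) (y := z)])

theorem IsCAT0.exists_point (hX : IsCAT0 X) (x y : X) {t : ℝ} (ht : t ∈ Icc (0 : ℝ) 1) :
    ∃ z, dist x z = t * dist x y ∧ dist z y = (1 - t) * dist x y := by
  obtain ⟨γ, hγ⟩ := hX.1 x y
  exact ⟨γ t, hγ.dist_left ht, hγ.dist_right ht⟩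

/-- The CAT(0) inequality in terms of betweenness. -/
theorem IsCAT0.dist_sq_le (hX : IsCAT0 X) {p q r z w : X} {s t : ℝ}
    (hs : s ∈ Icc (0 : ℝ) 1) (ht : t ∈ Icc (0 : ℝ) 1)
    (hz : dist p z = s * dist p q) (hz' : dist z q = (1 - s) * dist p q)
    (hw : dist p w = t * dist p r) (hw' : dist w r = (1 - t) * dist p r) :
    dist z w ^ 2 ≤ s ^ 2 * dist p q ^ 2 + t ^ 2 * dist p r ^ 2
        - s * t * (dist p q ^ 2 + dist p r ^ 2 - dist q r ^ 2) := by
  obtain ⟨α, hα⟩ := hX.1 p q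
  obtain ⟨β, hβ⟩ := hX.1 p r
  have := hX.dist_sq_le_of_geodesic hα hβ hs ht
  rwa [hX.eq_of_dist_eq hα hs hz hz', hX.eq_of_dist_eq hβ ht hw hw'] at this

/-- The inequality of Bruhat and Tits, for an arbitrary point `z` of the geodesic `[q, r]`. -/
theorem IsCAT0.cn (hX : IsCAT0 X) (p : X) {q r z : X} {t : ℝ} (ht : t ∈ Icc (0 : ℝ) 1)
    (hz : dist q z = t * dist q r) (hz' : dist z r = (1 - t) * dist q r) :
    dist p z ^ 2 ≤ (1 - t) * dist p q ^ 2 + t * dist p r ^ 2 - t * (1 - t) * dist q r ^ 2 := by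
  have := hX.dist_sq_le (p := q) (q := p) (r := r) (z := p) (w := z) (s := 1) (t := t)
    (by simp) ht (by simp) (by simp) hz hz'
  rw [dist_comm q p] at this
  nlinarith

theorem MetricBtw.exists_param {p z x : X} (h : MetricBtw p z x) (hz : z ≠ p) :
    ∃ s : ℝ, 0 < s ∧ s ≤ 1 ∧ dist p z = s * dist p x ∧ dist z x = (1 - s) * dist p x := by
  have h1 : 0 < dist p z := dist_pos.2 hz.symm
  have h2 : 0 < dist p x := by
    have := dist_nonneg (x := z) (y := x)
    unfold MetricBtw at h; linarith
  have h4 := dist_nonneg (x := z) (y := x)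
  unfold MetricBtw at h
  refine ⟨dist p z / dist p x, by positivity, (div_le_one h2).2 (by linarith), by field_simp, ?_⟩
  field_simp
  linarith

/-- An angle that is at least `π / 2` when measured close to its vertex `p` is at least `π / 2` as
a comparison angle. -/
theorem IsCAT0.pythagoras (hX : IsCAT0 X) {p x y z w : X} (hz : MetricBtw p z x)
    (hw : MetricBtw p w y)
    (hzp : z ≠ p) (hwp : w ≠ p) (h : dist p z ^ 2 + dist p w ^ 2 ≤ dist z w ^ 2) :
    dist p x ^ 2 + dist p y ^ 2 ≤ dist x y ^ 2 := by
  obtain ⟨s, hs0, hs1, e1, e2⟩ := hz.exists_param hzp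
  obtain ⟨t, ht0, ht1, e3, e4⟩ := hw.exists_param hwp
  have := hX.dist_sq_le ⟨hs0.le, hs1⟩ ⟨ht0.le, ht1⟩ e1 e2 e3 e4
  rw [e1, e3] at h
  have h5 : s * t * (dist p x ^ 2 + dist p y ^ 2 - dist x y ^ 2) ≤ 0 := by nlinarith
  have : 0 < s * t := by positivity
  nlinarith

/-- Two geodesics issuing from `p` whose concatenation is geodesic close to `p` form a geodesic:
local geodesics are geodesics. -/
theorem IsCAT0.btw_of_local (hX : IsCAT0 X) {p x y z w : X} (hz : MetricBtw p z x)
    (hw : MetricBtw p w y)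
    (hzp : z ≠ p) (hwp : w ≠ p) (h : dist p z + dist p w ≤ dist z w) : MetricBtw x p y := by
  obtain ⟨s, hs0, hs1, e1, e2⟩ := hz.exists_param hzp
  obtain ⟨t, ht0, ht1, e3, e4⟩ := hw.exists_param hwp
  have h1 := hX.dist_sq_le ⟨hs0.le, hs1⟩ ⟨ht0.le, ht1⟩ e1 e2 e3 e4
  have h2 : (s * dist p x + t * dist p y) ^ 2 ≤ dist z w ^ 2 := by
    rw [e1, e3] at h
    gcongr
  have h5 : s * t * ((dist p x + dist p y) ^ 2 - dist x y ^ 2) ≤ 0 := by nlinarith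
  have h6 : 0 < s * t := by positivity
  have h7 : (dist p x + dist p y) ^ 2 ≤ dist x y ^ 2 := by nlinarith
  have h8 := abs_le_of_sq_le_sq h7 dist_nonneg
  have h9 := dist_triangle x p y
  unfold MetricBtw
  rw [dist_comm x p] at *
  linarith [le_of_abs_le h8]

/-- The sum of the squares of the diagonals of a quadrilateral is at most the sum of the squares
of its sides. -/
theorem IsCAT0.quadrilateral (hX : IsCAT0 X) (a b c d : X) :
    dist a c ^ 2 + dist b d ^ 2 ≤
      dist a b ^ 2 + dist b c ^ 2 + dist c d ^ 2 + dist d a ^ 2 := by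
  obtain ⟨m, h1, h2⟩ := hX.exists_point a c (t := 1 / 2) (by norm_num)
  have h3 := hX.cn b (by norm_num) h1 h2
  have h4 := hX.cn d (by norm_num) h1 h2
  have h5 := dist_triangle b m d
  rw [dist_comm m d] at h5
  have h6 : dist b d ^ 2 ≤ (dist b m + dist d m) ^ 2 := by gcongr
  rw [dist_comm a b, dist_comm c d]
  nlinarith [sq_nonneg (dist b m - dist d m)]

theorem IsCAT0.exists_btw_dist_eq (hX : IsCAT0 X) (p x : X) {η : ℝ} (h0 : 0 ≤ η)
    (h1 : η ≤ dist p x) : ∃ z, MetricBtw p z x ∧ dist p z = η := by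
  rcases eq_or_ne p x with rfl | hne
  · exact ⟨p, by simp [MetricBtw], by simp at h1 ⊢; linarith⟩
  have h2 : 0 < dist p x := dist_pos.2 hne
  obtain ⟨z, hz, hz'⟩ := hX.exists_point p x (t := η / dist p x)
    ⟨by positivity, (div_le_one h2).2 h1⟩
  exact ⟨z, by unfold MetricBtw; rw [hz, hz']; ring, by rw [hz]; field_simp⟩

/-- A curve that is geodesic at the scale `1 / N` is a geodesic. -/
theorem IsCAT0.dist_of_locally_geodesic (hX : IsCAT0 X) {c : ℝ → X} {l : ℝ} (hl : 0 < l) {N : ℕ}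
    (hN : 0 < N)
    (h : ∀ s ∈ Icc (0 : ℝ) 1, ∀ t ∈ Icc (0 : ℝ) 1, |s - t| ≤ 2 / N →
      dist (c s) (c t) = l * |s - t|) : dist (c 0) (c 1) = l := by
  have hN' : (0 : ℝ) < N := by exact_mod_cast hN
  have key : ∀ n : ℕ, n + 1 ≤ N → dist (c 0) (c (n / N)) = l * (n / N) ∧
      dist (c 0) (c ((n + 1 : ℕ) / N)) = l * ((n + 1 : ℕ) / N) := by
    intro n
    induction n with
    | zero =>
      intro h1
      refine ⟨by simp, ?_⟩
      have h2 : (1 : ℝ) / N ≤ 1 := by rw [div_le_one hN']; exact_mod_cast h1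
      have := h 0 (by simp) (1 / N) ⟨by positivity, h2⟩ (by
        rw [zero_sub, abs_neg, abs_of_nonneg (by positivity)]; gcongr; norm_num)
      rw [zero_sub, abs_neg, abs_of_nonneg (by positivity)] at this
      simpa using this
    | succ n ih =>
      intro h1
      obtain ⟨i1, i2⟩ := ih (by omega)
      refine ⟨i2, ?_⟩
      have h1' : ((n + 1 + 1 : ℕ) : ℝ) ≤ N := by exact_mod_cast h1
      push_cast at *
      have m0 : (n : ℝ) / N ∈ Icc (0 : ℝ) 1 :=
        ⟨by positivity, by rw [div_le_one hN']; linarith⟩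
      have m1 : ((n : ℝ) + 1) / N ∈ Icc (0 : ℝ) 1 :=
        ⟨by positivity, by rw [div_le_one hN']; linarith⟩
      have m2 : ((n : ℝ) + 1 + 1) / N ∈ Icc (0 : ℝ) 1 :=
        ⟨by positivity, by rw [div_le_one hN']; linarith⟩
      have d10 : |((n : ℝ) + 1) / N - n / N| = 1 / N := by
        rw [← sub_div, abs_of_nonneg (by rw [add_sub_cancel_left]; positivity)]; ring
      have d12 : |((n : ℝ) + 1) / N - (n + 1 + 1) / N| = 1 / N := by
        rw [abs_sub_comm, ← sub_div, abs_of_nonneg (by rw [add_sub_cancel_left]; positivity)]; ring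
      have d02 : |(n : ℝ) / N - (n + 1 + 1) / N| = 2 / N := by
        rw [abs_sub_comm, ← sub_div, abs_of_nonneg (by ring_nf; positivity)]; ring
      have le12 : (1 : ℝ) / N ≤ 2 / N := by gcongr; norm_num
      have e10 := h _ m1 _ m0 (by rw [d10]; exact le12)
      have e12 := h _ m1 _ m2 (by rw [d12]; exact le12)
      have e02 := h _ m0 _ m2 (by rw [d02])
      rw [d10] at e10
      rw [d12] at e12
      rw [d02] at e02
      have pos : 0 < l * (1 / N) := by positivity
      have := hX.btw_of_local (p := c ((n + 1) / N)) (x := c 0) (y := c ((n + 1 + 1) / N))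
        (z := c (n / N)) (w := c ((n + 1 + 1) / N))
        (by unfold MetricBtw; rw [e10, dist_comm, i1, dist_comm, i2]; ring)
        (by simp [MetricBtw])
        (by intro h; rw [h, dist_self] at e10; linarith)
        (by intro h; rw [h, dist_self] at e12; linarith)
        (by rw [e10, e12, e02]; apply le_of_eq; ring)
      unfold MetricBtw at this
      rw [i2, e12] at this
      rw [← this]; ring
  obtain ⟨n, rfl⟩ : ∃ n, N = n + 1 := ⟨N - 1, by omega⟩
  have := (key n le_rfl).2
  rwa [div_self hN'.ne', mul_one] at this

/-! ### Projection to a segment -/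

/-- `γ`, restricted to `[0, 1]`, is an isometric embedding. -/
def IsSeg (γ : ℝ → X) : Prop :=
  ∀ s ∈ Icc (0 : ℝ) 1, ∀ t ∈ Icc (0 : ℝ) 1, dist (γ s) (γ t) = |s - t|

/-- `γ s` is a point of the segment `γ` that is nearest to `x`. -/
def IsFoot (γ : ℝ → X) (x : X) (s : ℝ) : Prop :=
  s ∈ Icc (0 : ℝ) 1 ∧ ∀ t ∈ Icc (0 : ℝ) 1, dist x (γ s) ≤ dist x (γ t)

theorem IsSeg.continuousOn {γ : ℝ → X} (hγ : IsSeg γ) : ContinuousOn γ (Icc 0 1) := by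
  have : LipschitzOnWith 1 γ (Icc 0 1) := LipschitzOnWith.of_dist_le_mul fun s hs t ht => by
    rw [hγ s hs t ht, Real.dist_eq]; simp
  exact this.continuousOn

theorem IsSeg.exists_isFoot {γ : ℝ → X} (hγ : IsSeg γ) (x : X) : ∃ s, IsFoot γ x s := by
  obtain ⟨s, hs, h⟩ := isCompact_Icc.exists_isMinOn (s := Icc (0 : ℝ) 1) ⟨0, by simp⟩
    (f := fun s => dist x (γ s))
    ((continuous_const.dist continuous_id).comp_continuousOn hγ.continuousOn)
  exact ⟨s, hs, fun t ht => h ht⟩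

/-- The geodesic from `x` to the nearest point of a segment is perpendicular to the segment. -/
theorem IsFoot.dist_sq_le (hX : IsCAT0 X) {γ : ℝ → X} (hγ : IsSeg γ) {x : X} {s : ℝ}
    (h : IsFoot γ x s) {t : ℝ} (ht : t ∈ Icc (0 : ℝ) 1) :
    dist x (γ s) ^ 2 + |s - t| ^ 2 ≤ dist x (γ t) ^ 2 := by
  have key : ∀ θ ∈ Ioo (0 : ℝ) 1,
      dist x (γ s) ^ 2 + (1 - θ) * |s - t| ^ 2 ≤ dist x (γ t) ^ 2 := by
    intro θ hθ
    have hs := h.1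
    have hm : s + θ * (t - s) ∈ Icc (0 : ℝ) 1 := by
      constructor <;> nlinarith [hs.1, hs.2, ht.1, ht.2, hθ.1, hθ.2]
    have e1 : dist (γ s) (γ (s + θ * (t - s))) = θ * dist (γ s) (γ t) := by
      rw [hγ s hs _ hm, hγ s hs t ht, show s - (s + θ * (t - s)) = θ * (s - t) by ring, abs_mul,
        abs_of_pos hθ.1]
    have e2 : dist (γ (s + θ * (t - s))) (γ t) = (1 - θ) * dist (γ s) (γ t) := by
      rw [hγ _ hm t ht, hγ s hs t ht,
        show s + θ * (t - s) - t = (1 - θ) * (s - t) by ring, abs_mul,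
        abs_of_pos (by linarith [hθ.2])]
    have h1 := hX.cn x ⟨hθ.1.le, hθ.2.le⟩ e1 e2
    have h2 := h.2 _ hm
    have h3 : dist x (γ s) ^ 2 ≤ dist x (γ (s + θ * (t - s))) ^ 2 := by gcongr
    rw [hγ s hs t ht] at h1
    have := hθ.1
    nlinarith
  have lim : Filter.Tendsto (fun θ : ℝ => dist x (γ s) ^ 2 + (1 - θ) * |s - t| ^ 2)
      (nhdsWithin 0 (Ioo 0 1)) (nhds (dist x (γ s) ^ 2 + (1 - 0) * |s - t| ^ 2)) := by
    apply Filter.Tendsto.mono_left _ nhdsWithin_le_nhds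
    exact Continuous.tendsto (by fun_prop) 0
  have : (nhdsWithin (0 : ℝ) (Ioo 0 1)).NeBot := left_nhdsWithin_Ioo_neBot (by norm_num)
  have := le_of_tendsto lim (Filter.eventually_of_mem self_mem_nhdsWithin key)
  simpa using this

theorem IsFoot.unique (hX : IsCAT0 X) {γ : ℝ → X} (hγ : IsSeg γ) {x : X} {s t : ℝ}
    (h : IsFoot γ x s) (h' : IsFoot γ x t) : s = t := by
  have h1 := h.dist_sq_le hX hγ h'.1
  have h2 := h'.2 s h.1
  have h3 : dist x (γ t) ^ 2 ≤ dist x (γ s) ^ 2 := by gcongr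
  have h4 : |s - t| ^ 2 = 0 := le_antisymm (by linarith) (by positivity)
  rw [sq_abs] at h4
  nlinarith

theorem IsFoot.abs_sub_le (hX : IsCAT0 X) {γ : ℝ → X} (hγ : IsSeg γ) {x y : X} {s t : ℝ}
    (h : IsFoot γ x s) (h' : IsFoot γ y t) : |s - t| ≤ dist x y := by
  have h1 := h.dist_sq_le hX hγ h'.1
  have h2 := h'.dist_sq_le hX hγ h.1
  have h3 := hX.quadrilateral x y (γ t) (γ s)
  rw [dist_comm (γ t), hγ s h.1 t h'.1, dist_comm (γ s)] at h3
  rw [abs_sub_comm t s] at h2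
  exact abs_le_of_sq_le_sq' (by linarith) dist_nonneg |>.2

theorem IsFoot.of_btw {γ : ℝ → X} {x z : X} {s : ℝ} (h : IsFoot γ x s)
    (hz : MetricBtw (γ s) z x) : IsFoot γ z s := by
  refine ⟨h.1, fun t ht => ?_⟩
  have h1 := h.2 t ht
  have h2 := dist_triangle x z (γ t)
  unfold MetricBtw at hz
  rw [dist_comm x (γ s)] at h1
  rw [dist_comm z (γ s)]
  rw [dist_comm x z] at h2
  linarith

open Classical in
/-- The parameter of the projection of `x` to the segment `γ`; it is `0` if `γ` has no point nearest
to `x`, which does not happen for geodesic segments. -/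
noncomputable def coord (γ : ℝ → X) (x : X) : ℝ :=
  if h : ∃ s, IsFoot γ x s then h.choose else 0

theorem IsSeg.isFoot_coord {γ : ℝ → X} (hγ : IsSeg γ) (x : X) : IsFoot γ x (coord γ x) := by
  have h := hγ.exists_isFoot x
  rw [coord, dif_pos h]
  exact h.choose_spec

theorem IsFoot.coord_eq (hX : IsCAT0 X) {γ : ℝ → X} (hγ : IsSeg γ) {x : X} {s : ℝ}
    (h : IsFoot γ x s) : coord γ x = s :=
  (hγ.isFoot_coord x).unique hX hγ h

theorem IsSeg.coord_mem {γ : ℝ → X} (hγ : IsSeg γ) (x : X) : coord γ x ∈ Icc (0 : ℝ) 1 :=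
  (hγ.isFoot_coord x).1

theorem IsSeg.abs_coord_sub_le (hX : IsCAT0 X) {γ : ℝ → X} (hγ : IsSeg γ) (x y : X) :
    |coord γ x - coord γ y| ≤ dist x y :=
  (hγ.isFoot_coord x).abs_sub_le hX hγ (hγ.isFoot_coord y)

theorem IsSeg.continuous_coord (hX : IsCAT0 X) {γ : ℝ → X} (hγ : IsSeg γ) :
    Continuous (coord γ) := by
  have : LipschitzWith 1 (coord γ) := LipschitzWith.of_dist_le_mul fun x y => by
    simpa [Real.dist_eq] using hγ.abs_coord_sub_le hX x y
  exact this.continuous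

theorem IsSeg.coord_self (hX : IsCAT0 X) {γ : ℝ → X} (hγ : IsSeg γ) {s : ℝ}
    (hs : s ∈ Icc (0 : ℝ) 1) : coord γ (γ s) = s :=
  IsFoot.coord_eq hX hγ ⟨hs, fun t _ => by simp⟩

theorem IsSeg.flip {γ : ℝ → X} (hγ : IsSeg γ) : IsSeg fun s => γ (1 - s) := by
  intro s hs t ht
  rw [hγ _ (by constructor <;> linarith [hs.1, hs.2]) _ (by constructor <;> linarith [ht.1, ht.2]),
    show 1 - s - (1 - t) = t - s by ring, abs_sub_comm]

theorem IsSeg.coord_flip (hX : IsCAT0 X) {γ : ℝ → X} (hγ : IsSeg γ) (x : X) :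
    coord (fun s => γ (1 - s)) x = 1 - coord γ x := by
  have h := hγ.isFoot_coord x
  refine IsFoot.coord_eq hX hγ.flip ⟨by constructor <;> linarith [h.1.1, h.1.2], fun t ht => ?_⟩
  simp only [sub_sub_cancel]
  exact h.2 _ (by constructor <;> linarith [ht.1, ht.2])

end CAT0

/-! ### Faces of the unit cube -/

/-- The nearest point of `[0, 1]`. -/
noncomputable def clamp (x : ℝ) : ℝ := max 0 (min 1 x)

theorem clamp_mem (x : ℝ) : clamp x ∈ Icc (0 : ℝ) 1 :=
  ⟨le_max_left _ _, max_le zero_le_one (min_le_left _ _)⟩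

theorem clamp_of_mem {x : ℝ} (hx : x ∈ Icc (0 : ℝ) 1) : clamp x = x := by
  rw [clamp, min_eq_right hx.2, max_eq_right hx.1]

theorem clamp_one_sub (x : ℝ) : clamp (1 - x) = 1 - clamp x := by
  unfold clamp
  rcases le_total x 0 with h | h
  · rw [min_eq_left (by linarith), min_eq_right (by linarith), max_eq_right (by norm_num),
      max_eq_left h]; ring
  rcases le_total x 1 with h' | h'
  · rw [min_eq_right (by linarith), min_eq_right (by linarith), max_eq_right (by linarith),
      max_eq_right h]
  · rw [min_eq_right (by linarith), min_eq_left (by linarith), max_eq_left (by linarith),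
      max_eq_right (by norm_num)]; ring

theorem one_sub_mem {x : ℝ} (hx : x ∈ Icc (0 : ℝ) 1) : 1 - x ∈ Icc (0 : ℝ) 1 :=
  ⟨by linarith [hx.2], by linarith [hx.1]⟩

/-- The point of the unit cube with coordinates `f`, which are moved into `[0, 1]`. -/
noncomputable def cubeMk {n : ℕ} (f : Fin n → ℝ) : unitCube n :=
  ⟨WithLp.toLp 2 fun i => clamp (f i), fun i => clamp_mem (f i)⟩

theorem cubeMk_apply {n : ℕ} (f : Fin n → ℝ) (i : Fin n) : (cubeMk f).1 i = clamp (f i) := rfl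

theorem cube_ext {n : ℕ} {p q : unitCube n} (h : ∀ i, p.1 i = q.1 i) : p = q := by
  apply Subtype.ext
  ext i
  exact h i

theorem cube_dist_sq {n : ℕ} (p q : unitCube n) :
    dist p q ^ 2 = ∑ i, (p.1 i - q.1 i) ^ 2 := by
  rw [Subtype.dist_eq, EuclideanSpace.dist_eq, Real.sq_sqrt (by positivity)]
  simp [Real.dist_eq, sq_abs]

theorem abs_coord_le_cube_dist {n : ℕ} (p q : unitCube n) (i : Fin n) :
    |p.1 i - q.1 i| ≤ dist p q := by
  apply abs_le_of_sq_le_sq _ dist_nonneg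
  rw [cube_dist_sq]
  exact Finset.single_le_sum (f := fun i => (p.1 i - q.1 i) ^ 2)
    (fun i _ => sq_nonneg _) (Finset.mem_univ i)

/-- The face of the cube on which the coordinates in `S` have the values prescribed by `a`. -/
def cubeFace {n : ℕ} (S : Set (Fin n)) (a : Fin n → ℝ) : Set (unitCube n) :=
  {x | ∀ i ∈ S, x.1 i = a i}

theorem cubeFace_empty {n : ℕ} (a : Fin n → ℝ) : cubeFace ∅ a = univ := by
  ext; simp [cubeFace]

theorem isCubeFace_cubeFace {n : ℕ} (S : Set (Fin n)) {a : Fin n → ℝ}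
    (ha : ∀ i, a i = 0 ∨ a i = 1) : IsCubeFace (cubeFace S a) := ⟨S, a, ha, rfl⟩

theorem cubeFace_eq_univ_of_interior {n : ℕ} {S : Set (Fin n)} {a : Fin n → ℝ}
    (ha : ∀ i, a i = 0 ∨ a i = 1) {p : unitCube n} (hp : p ∈ cubeFace S a)
    (h : ∀ i, p.1 i ∈ Ioo (0 : ℝ) 1) : S = ∅ := by
  rw [Set.eq_empty_iff_forall_notMem]
  intro i hi
  have h1 := hp i hi
  have h2 := h i
  rcases ha i with h0 | h0 <;> rw [h1, h0] at h2 <;> simp at h2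

open Classical in
/-- The dimension of a face is an isometry invariant: the circumradius of the face with `k` free
coordinates is `√k / 2`. -/
theorem card_free_le_of_isometryEquiv {m n : ℕ} {S : Set (Fin m)} {a : Fin m → ℝ}
    {T : Set (Fin n)} {b : Fin n → ℝ} (ha : ∀ i, a i = 0 ∨ a i = 1) (hb : ∀ i, b i = 0 ∨ b i = 1)
    (h : cubeFace S a ≃ᵢ cubeFace T b) :
    (Finset.univ.filter fun i => i ∉ S).card ≤ (Finset.univ.filter fun i => i ∉ T).card := by
  have cl : ∀ {k : ℕ} {a : Fin k → ℝ}, (∀ i, a i = 0 ∨ a i = 1) → ∀ i, clamp (a i) = a i := by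
    intro k a ha i
    apply clamp_of_mem
    rcases ha i with h | h <;> simp [h]
  -- the centre of the second face, and two opposite vertices of the first one
  let c : unitCube n := cubeMk fun i => if i ∈ T then b i else 1 / 2
  have hc : c ∈ cubeFace T b := fun i hi => by simp [c, cubeMk_apply, hi, cl hb]
  have hdist : ∀ x ∈ cubeFace T b,
      dist c x ^ 2 ≤ ((Finset.univ.filter fun i => i ∉ T).card : ℝ) / 4 := by
    intro x hx
    rw [cube_dist_sq, Finset.card_filter]
    push_cast
    rw [Finset.sum_div]
    refine Finset.sum_le_sum fun i _ => ?_
    by_cases hi : i ∈ T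
    · simp [c, cubeMk_apply, hi, cl hb, hx i hi]
    · have h1 : clamp (2⁻¹ : ℝ) = 2⁻¹ := clamp_of_mem (by norm_num)
      simp only [c, cubeMk_apply, hi, if_false, not_false_eq_true, if_true, one_div, h1]
      have := (x.2 i).1
      have := (x.2 i).2
      nlinarith
  obtain ⟨p, hp⟩ : ∃ p, h p = ⟨c, hc⟩ := h.surjective _
  let u : ℝ → unitCube m := fun t => cubeMk fun i => if i ∈ S then a i else t
  have hu : ∀ t, u t ∈ cubeFace S a := fun t i hi => by simp [u, cubeMk_apply, hi, cl ha]
  have hd : ∀ t, dist p.1 (u t) ^ 2 ≤ ((Finset.univ.filter fun i => i ∉ T).card : ℝ) / 4 := by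
    intro t
    have : dist p.1 (u t) = dist c (h ⟨u t, hu t⟩ : unitCube n) := by
      have := h.dist_eq p ⟨u t, hu t⟩
      rw [hp] at this
      exact this.symm
    rw [this]
    exact hdist _ (h ⟨u t, hu t⟩).2
  have h0 := hd 0
  have h1 := hd 1
  rw [cube_dist_sq] at h0 h1
  have h2 : ((Finset.univ.filter fun i => i ∉ S).card : ℝ) / 2 ≤
      ∑ i, (p.1.1 i - (u 0).1 i) ^ 2 + ∑ i, (p.1.1 i - (u 1).1 i) ^ 2 := by
    rw [← Finset.sum_add_distrib, Finset.card_filter]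
    push_cast
    rw [Finset.sum_div]
    refine Finset.sum_le_sum fun i _ => ?_
    by_cases hi : i ∈ S
    · simp only [hi, not_true_eq_false, if_false, zero_div]
      positivity
    · have e0 : clamp (0 : ℝ) = 0 := clamp_of_mem (by norm_num)
      have e1 : clamp (1 : ℝ) = 1 := clamp_of_mem (by norm_num)
      simp only [u, cubeMk_apply, hi, if_false, not_false_eq_true, if_true, e0, e1]
      nlinarith [sq_nonneg (2 * p.1.1 i - 1)]
  have : ((Finset.univ.filter fun i => i ∉ S).card : ℝ) ≤
      (Finset.univ.filter fun i => i ∉ T).card := by linarith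
  exact_mod_cast this

open Classical in
theorem card_free_eq_of_isometryEquiv {m n : ℕ} {S : Set (Fin m)} {a : Fin m → ℝ}
    {T : Set (Fin n)} {b : Fin n → ℝ} (ha : ∀ i, a i = 0 ∨ a i = 1) (hb : ∀ i, b i = 0 ∨ b i = 1)
    (h : cubeFace S a ≃ᵢ cubeFace T b) :
    (Finset.univ.filter fun i => i ∉ S).card = (Finset.univ.filter fun i => i ∉ T).card :=
  (card_free_le_of_isometryEquiv ha hb h).antisymm (card_free_le_of_isometryEquiv hb ha h.symm)

/-- The isometry between the whole cube, regarded as a face, and the cube. -/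
def cubeFaceEmptyEquiv {n : ℕ} (a : Fin n → ℝ) : cubeFace (∅ : Set (Fin n)) a ≃ᵢ unitCube n where
  toFun p := p.1
  invFun p := ⟨p, fun _ h => h.elim⟩
  left_inv _ := rfl
  right_inv _ := rfl
  isometry_toFun _ _ := rfl

open Classical in
theorem card_free_eq_of_isometryEquiv_cube {m n : ℕ} {S : Set (Fin m)} {a : Fin m → ℝ}
    (ha : ∀ i, a i = 0 ∨ a i = 1) (h : cubeFace S a ≃ᵢ unitCube n) :
    (Finset.univ.filter fun i => i ∉ S).card = n := by
  have := card_free_eq_of_isometryEquiv ha (b := fun _ : Fin n => 0) (fun _ => Or.inl rfl)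
    (h.trans (cubeFaceEmptyEquiv _).symm)
  simpa using this

theorem dim_eq_of_isometryEquiv {m n : ℕ} (h : unitCube m ≃ᵢ unitCube n) : m = n := by
  classical
  have := card_free_eq_of_isometryEquiv_cube (a := fun _ : Fin m => 0) (fun _ => Or.inl rfl)
    ((cubeFaceEmptyEquiv _).trans h)
  simpa using this

/-- The whole cube, as a set, is isometric to the cube. -/
def isometryEquivUniv (Y : Type*) [PseudoEMetricSpace Y] : (univ : Set Y) ≃ᵢ Y where
  toEquiv := Equiv.Set.univ Y
  isometry_toFun _ _ := rfl

/-- The centre of the cube. -/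
noncomputable def cubeCenter (n : ℕ) : unitCube n := cubeMk fun _ => 1 / 2

theorem cubeCenter_apply (n : ℕ) (i : Fin n) : (cubeCenter n).1 i = 1 / 2 := by
  rw [cubeCenter, cubeMk_apply, clamp_of_mem (by norm_num)]

theorem isometryEquiv_cubeCenter {m n : ℕ} (h : unitCube m ≃ᵢ unitCube n) :
    h (cubeCenter m) = cubeCenter n := by
  obtain rfl := dim_eq_of_isometryEquiv h
  have hd : ∀ x, dist (h (cubeCenter m)) x ^ 2 ≤ ∑ _i : Fin m, (1 / 4 : ℝ) := by
    intro x
    rw [← h.apply_symm_apply x, h.dist_eq, cube_dist_sq]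
    refine Finset.sum_le_sum fun i _ => ?_
    rw [cubeCenter_apply]
    have := ((h.symm x).2 i).1
    have := ((h.symm x).2 i).2
    nlinarith
  have h0 := hd (cubeMk fun _ => 0)
  have h1 := hd (cubeMk fun _ => 1)
  rw [cube_dist_sq] at h0 h1
  set p := h (cubeCenter m)
  have h2 : ∑ i : Fin m, (2 * (p.1 i - 1 / 2) ^ 2) ≤ 0 := by
    have e0 : clamp (0 : ℝ) = 0 := clamp_of_mem (by norm_num)
    have e1 : clamp (1 : ℝ) = 1 := clamp_of_mem (by norm_num)
    have : ∑ i : Fin m, (2 * (p.1 i - 1 / 2) ^ 2) =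
        ∑ i, (p.1 i - (cubeMk fun _ : Fin m => 0).1 i) ^ 2
        + ∑ i, (p.1 i - (cubeMk fun _ : Fin m => 1).1 i) ^ 2
        - ∑ _i : Fin m, (1 / 4 : ℝ) - ∑ _i : Fin m, (1 / 4 : ℝ) := by
      rw [← Finset.sum_add_distrib, ← Finset.sum_sub_distrib, ← Finset.sum_sub_distrib]
      refine Finset.sum_congr rfl fun i _ => ?_
      rw [cubeMk_apply, cubeMk_apply, e0, e1]
      ring
    linarith
  have h3 := (Finset.sum_eq_zero_iff_of_nonneg (fun i _ => by positivity)).1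
    (le_antisymm h2 (Finset.sum_nonneg fun i _ => by positivity))
  refine cube_ext fun i => ?_
  have := h3 i (Finset.mem_univ i)
  rw [cubeCenter_apply]
  have h4 : (p.1 i - 1 / 2) ^ 2 = 0 := by linarith
  have := pow_eq_zero_iff (two_ne_zero) |>.1 h4
  linarith

/-! ### The metric of a square complex -/

namespace SquareComplex

variable {X : Type u} {K : SquareComplex.{u, v} X}

/-- All proper faces, of all cells containing `q`, that do not contain `q` have distance at least
`ρ` from `q` in their cells. -/
def HasMargin (K : SquareComplex.{u, v} X) (q : X) (ρ : ℝ) : Prop :=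
  ∀ c p, K.chart c p = q → ∀ F, IsCubeFace F → p ∉ F → ∀ p' ∈ F, ρ ≤ dist p p'

/-- Distances of two points that lie in two common cells agree. -/
theorem dist_eq_of_mem (K : SquareComplex.{u, v} X) {c d : K.Cell} {p p' : unitCube (K.dim c)}
    {q q' : unitCube (K.dim d)} (h : K.chart c p = K.chart d q)
    (h' : K.chart c p' = K.chart d q') : dist p p' = dist q q' := by
  obtain ⟨F, F', e, -, -, he⟩ := K.inter_cells c d ⟨_, ⟨p, rfl⟩, ⟨q, h.symm⟩⟩
  obtain ⟨hp, rfl⟩ := (he p q).1 h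
  obtain ⟨hp', rfl⟩ := (he p' q').1 h'
  exact (e.dist_eq ⟨p, hp⟩ ⟨p', hp'⟩).symm

open Classical in
/-- The function `max 0 (ρ - d(q, ·))`, where the distance is measured in the cells that contain
`q`, extended by `0`. -/
noncomputable def bump (K : SquareComplex.{u, v} X) (q : X) (ρ : ℝ) (z : X) : ℝ :=
  if h : ∃ r : ℝ, ∃ c p p', K.chart c p = q ∧ K.chart c p' = z ∧ dist p p' = r then
    max 0 (ρ - h.choose) else 0

theorem bump_eq (K : SquareComplex.{u, v} X) (ρ : ℝ) (c : K.Cell) (p p' : unitCube (K.dim c)) :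
    K.bump (K.chart c p) ρ (K.chart c p') = max 0 (ρ - dist p p') := by
  have h : ∃ r : ℝ, ∃ d q q', K.chart d q = K.chart c p ∧ K.chart d q' = K.chart c p' ∧
      dist q q' = r := ⟨_, c, p, p', rfl, rfl, rfl⟩
  rw [bump, dif_pos h]
  obtain ⟨d, q, q', h1, h2, h3⟩ := h.choose_spec
  rw [← h3, K.dist_eq_of_mem h1 h2]

/-- The function is continuous across the boundary of the star of `q`: it vanishes on the cells that
do not contain `q`, since they meet those that do in faces at distance at least `ρ` from `q`. -/
theorem HasMargin.bump_lipschitz {q : X} {ρ : ℝ} (h : K.HasMargin q ρ) (c : K.Cell)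
    (p p' : unitCube (K.dim c)) :
    K.bump q ρ (K.chart c p) - K.bump q ρ (K.chart c p') ≤ dist p p' := by
  by_cases hq : ∃ p0, K.chart c p0 = q
  · obtain ⟨p0, rfl⟩ := hq
    rw [bump_eq, bump_eq]
    have h1 := dist_triangle p0 p p'
    have h2 := le_max_left 0 (ρ - dist p0 p')
    have h3 := le_max_right 0 (ρ - dist p0 p')
    have : max 0 (ρ - dist p0 p) ≤ max 0 (ρ - dist p0 p') + dist p p' :=
      max_le (by linarith [dist_nonneg (x := p) (y := p')]) (by linarith)
    linarith
  · have key : ∀ p, K.bump q ρ (K.chart c p) = 0 := by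
      intro p
      by_cases hz : ∃ d p1 p2, K.chart d p1 = q ∧ K.chart d p2 = K.chart c p
      · obtain ⟨d, p1, p2, rfl, h2⟩ := hz
        obtain ⟨F, F', e, hF, -, he⟩ := K.inter_cells d c ⟨_, ⟨p2, rfl⟩, ⟨p, h2.symm⟩⟩
        have h1 : p1 ∉ F := fun h1 => hq ⟨e ⟨p1, h1⟩, ((he p1 _).2 ⟨h1, rfl⟩).symm⟩
        obtain ⟨h3, -⟩ := (he p2 p).1 h2
        rw [← h2, bump_eq]
        exact max_eq_left (by linarith [h d p1 rfl F hF h1 p2 h3])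
      · rw [bump, dif_neg]
        rintro ⟨r, d, p1, p2, h1, h2, -⟩
        exact hz ⟨d, p1, p2, h1, h2⟩
    rw [key, key]
    simp

/-- A face of a cell is a cell, and its metrics as a face and as a cell agree. -/
theorem exists_face_equiv (K : SquareComplex.{u, v} X) (c : K.Cell) {F : Set (unitCube (K.dim c))}
    (hF : IsCubeFace F) :
    ∃ d, ∃ e : F ≃ᵢ unitCube (K.dim d), ∀ p (hp : p ∈ F), K.chart d (e ⟨p, hp⟩) = K.chart c p := by
  obtain ⟨d, hd⟩ := K.exists_face c F hF
  obtain ⟨p0⟩ : Nonempty (unitCube (K.dim d)) := ⟨cubeCenter _⟩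
  have h0 : K.chart d p0 ∈ K.chart c '' F := hd ▸ mem_range_self p0
  obtain ⟨p1, -, h1⟩ := h0
  obtain ⟨F1, F2, e, -, -, he⟩ := K.inter_cells c d ⟨_, ⟨p1, rfl⟩, ⟨p0, h1.symm⟩⟩
  have hF1 : F1 = F := by
    ext p
    constructor
    · intro hp
      have := (he p _).2 ⟨hp, rfl⟩
      have h2 : K.chart c p ∈ K.chart c '' F := by rw [← hd, this]; exact mem_range_self _
      obtain ⟨p', hp', h3⟩ := h2
      rwa [← K.chart_injective c h3]
    · intro hp
      have : K.chart c p ∈ range (K.chart d) := by rw [hd]; exact mem_image_of_mem _ hp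
      obtain ⟨q, hq⟩ := this
      exact ((he p q).1 hq.symm).1
  subst hF1
  have hF2 : F2 = univ := by
    ext q
    simp only [mem_univ, iff_true]
    have : K.chart d q ∈ K.chart c '' F1 := hd ▸ mem_range_self q
    obtain ⟨p, -, h2⟩ := this
    obtain ⟨h3, h4⟩ := (he p q).1 h2
    rw [← h4]
    exact (e ⟨p, h3⟩).2
  subst hF2
  exact ⟨d, e.trans (isometryEquivUniv _), fun p hp => ((he p _).2 ⟨hp, rfl⟩).symm⟩

/-- The smallest cell that contains a given interior point is contained, as a face, in all other
cells that contain the point. -/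
theorem exists_face_of_interior (K : SquareComplex.{u, v} X) {c d : K.Cell}
    {p : unitCube (K.dim c)} (hp : ∀ i, p.1 i ∈ Ioo (0 : ℝ) 1) {q : unitCube (K.dim d)}
    (h : K.chart d q = K.chart c p) :
    ∃ (S : Set (Fin (K.dim d))) (a : Fin (K.dim d) → ℝ) (e : unitCube (K.dim c) ≃ᵢ cubeFace S a),
      (∀ i, a i = 0 ∨ a i = 1) ∧ (∀ x, K.chart d (e x) = K.chart c x) ∧ (e p : unitCube _) = q := by
  obtain ⟨F, F', e, ⟨S, a, ha, rfl⟩, ⟨S', a', ha', rfl⟩, he⟩ :=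
    K.inter_cells c d ⟨_, ⟨p, rfl⟩, ⟨q, h⟩⟩
  obtain ⟨h1, h2⟩ := (he p q).1 h.symm
  obtain rfl := cubeFace_eq_univ_of_interior ha h1 hp
  exact ⟨S', a', (cubeFaceEmptyEquiv a).symm.trans e, ha',
    fun x => ((he x _).2 ⟨_, rfl⟩).symm, h2⟩

/-- Two cells of the same dimension are equal if one of them contains an interior point of the
other. -/
theorem eq_of_interior (K : SquareComplex.{u, v} X) {c d : K.Cell}
    {p : unitCube (K.dim c)} (hp : ∀ i, p.1 i ∈ Ioo (0 : ℝ) 1) {q : unitCube (K.dim d)}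
    (h : K.chart d q = K.chart c p) (hdim : K.dim d ≤ K.dim c) : d = c := by
  classical
  obtain ⟨S, a, e, ha, he, -⟩ := K.exists_face_of_interior hp h
  have h1 := card_free_eq_of_isometryEquiv_cube ha e.symm
  have h2 : (Finset.univ.filter fun i => i ∉ S).card = Fintype.card (Fin (K.dim d)) := by
    apply le_antisymm (Finset.card_le_univ _)
    rw [h1, Fintype.card_fin]
    exact hdim
  have h3 := (Finset.card_eq_iff_eq_univ _).1 h2
  have h4 : S = ∅ := by
    rw [Set.eq_empty_iff_forall_notMem]
    intro i
    have : i ∈ (Finset.univ.filter fun i => i ∉ S) := by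
      rw [h3]; exact Finset.mem_univ i
    simpa using this
  subst h4
  apply K.eq_of_range_eq
  ext z
  constructor
  · rintro ⟨x, rfl⟩
    refine ⟨e.symm ⟨x, fun _ h => h.elim⟩, ?_⟩
    rw [← he, e.apply_symm_apply]
  · rintro ⟨x, rfl⟩
    exact ⟨_, he x⟩

variable [MetricSpace X]

/-- A pseudo-distance that is bounded on the cells by a multiple of their metrics is bounded by the
same multiple of the metric. -/
theorem IsIntrinsicMetric.le_mul_dist (hK : K.IsIntrinsicMetric) {Φ : X → X → ℝ} {C : ℝ}
    (hC : 0 < C) (h0 : ∀ x, Φ x x ≤ 0) (h1 : ∀ x y z, Φ x z ≤ Φ x y + Φ y z)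
    (h2 : ∀ c p q, Φ (K.chart c p) (K.chart c q) ≤ C * dist p q) (x y : X) :
    Φ x y ≤ C * dist x y := by
  have key : ∀ x y l, K.HasString x y l → Φ x y ≤ C * l := by
    intro x y l h
    induction h with
    | nil x => simpa using h0 x
    | cons c p q y l _ ih => linarith [h1 (K.chart c p) (K.chart c q) y, h2 c p q]
  have : Φ x y / C ≤ dist x y := by
    refine (hK x y).2 fun l hl => ?_
    rw [div_le_iff₀ hC]
    linarith [key x y l hl]
  rw [div_le_iff₀ hC] at this
  linarith

theorem IsIntrinsicMetric.abs_sub_le_dist (hK : K.IsIntrinsicMetric) {φ : X → ℝ}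
    (h : ∀ c p q, φ (K.chart c p) - φ (K.chart c q) ≤ dist p q) (x y : X) :
    |φ x - φ y| ≤ dist x y := by
  have h3 := fun x y => hK.le_mul_dist (Φ := fun x y => φ x - φ y) one_pos (by simp)
    (by intros; linarith) (fun c p q => by simpa using h c p q) x y
  simp only [one_mul] at h3
  rw [abs_le]
  constructor
  · linarith [h3 y x, dist_comm x y]
  · exact h3 x y

theorem IsIntrinsicMetric.dist_chart_le (hK : K.IsIntrinsicMetric) (c : K.Cell)
    (p q : unitCube (K.dim c)) : dist (K.chart c p) (K.chart c q) ≤ dist p q := by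
  refine (hK _ _).1 ?_
  have := HasString.cons c p q (K.chart c q) 0 (HasString.nil _)
  rwa [add_zero] at this

/-- The star of `q` contains the ball about `q` of radius `ρ`, and in this ball the distances from
`q` are those measured in the cells. -/
theorem HasMargin.exists_cell (hK : K.IsIntrinsicMetric) {q : X} {ρ : ℝ} (h : K.HasMargin q ρ)
    {z : X} (hz : dist q z < ρ) :
    ∃ c p p', K.chart c p = q ∧ K.chart c p' = z ∧ dist p p' = dist q z := by
  obtain ⟨c0, p0, hp0⟩ := K.exists_cell q
  have h1 := hK.abs_sub_le_dist h.bump_lipschitz q z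
  have h2 : K.bump q ρ q = ρ := by
    rw [← hp0, bump_eq, dist_self, sub_zero]
    exact max_eq_right (dist_nonneg.trans hz.le)
  rw [h2] at h1
  have h3 := (abs_le.1 h1).2
  by_cases hz' : ∃ c p p', K.chart c p = q ∧ K.chart c p' = z
  · obtain ⟨c, p, p', rfl, rfl⟩ := hz'
    refine ⟨c, p, p', rfl, rfl, ?_⟩
    apply le_antisymm _ (hK.dist_chart_le c p p')
    rw [bump_eq] at h3
    rcases max_cases 0 (ρ - dist p p') with h4 | h4 <;> linarith [h4.1]
  · rw [bump, dif_neg] at h3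
    · linarith
    · rintro ⟨r, d, p1, p2, h1, h2, -⟩
      exact hz' ⟨d, p1, p2, h1, h2⟩

theorem HasMargin.min_le_dist (hK : K.IsIntrinsicMetric) {c : K.Cell} {p : unitCube (K.dim c)}
    {ρ : ℝ} (hρ : 0 ≤ ρ) (h : K.HasMargin (K.chart c p) ρ) (p' : unitCube (K.dim c)) :
    min ρ (dist p p') ≤ dist (K.chart c p) (K.chart c p') := by
  have h1 := (abs_le.1 (hK.abs_sub_le_dist h.bump_lipschitz (K.chart c p) (K.chart c p'))).2
  rw [bump_eq, bump_eq, dist_self, sub_zero, max_eq_right hρ] at h1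
  rcases max_cases 0 (ρ - dist p p') with h4 | h4
  · exact (min_le_left _ _).trans (by linarith [h4.1])
  · exact (min_le_right _ _).trans (by linarith [h4.1])

end SquareComplex

/-! ### Parametrisations of edges and squares -/

theorem clamp_clamp (x : ℝ) : clamp (clamp x) = clamp x := clamp_of_mem (clamp_mem x)

theorem one_le_abs_sub {x y : ℝ} (hx : x = 0 ∨ x = 1) (hy : y = 0 ∨ y = 1) (h : x ≠ y) :
    1 ≤ |x - y| := by
  rcases hx with rfl | rfl <;> rcases hy with rfl | rfl <;> norm_num at *

/-- `P` is one of the two isometric parametrisations of the unit interval `unitCube 1`. -/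
structure EdgeParam {n : ℕ} (P : ℝ → unitCube n) : Prop where
  dist_eq : ∀ s ∈ Icc (0 : ℝ) 1, ∀ t ∈ Icc (0 : ℝ) 1, dist (P s) (P t) = |s - t|
  surj : ∀ p, ∃ s ∈ Icc (0 : ℝ) 1, P s = p
  clamp : ∀ s, P (clamp s) = P s
  vals : ∃ i : Fin n, (∀ k, k = i) ∧
    ((∀ s, (P s).1 i = _root_.clamp s) ∨ ∀ s, (P s).1 i = 1 - _root_.clamp s)

theorem EdgeParam.std {n : ℕ} (hn : n = 1) :
    EdgeParam (fun s => (cubeMk fun _ => s : unitCube n)) := by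
  subst hn
  constructor
  · intro s hs t ht
    rw [← abs_of_nonneg (dist_nonneg (x := (cubeMk fun _ => s : unitCube 1))),
      ← sq_eq_sq_iff_abs_eq_abs,
      cube_dist_sq]
    simp [cubeMk_apply, clamp_of_mem hs, clamp_of_mem ht]
  · intro p
    refine ⟨p.1 0, p.2 0, cube_ext fun i => ?_⟩
    rw [Subsingleton.elim i 0, cubeMk_apply, clamp_of_mem (p.2 0)]
  · intro s
    exact cube_ext fun i => by simp only [cubeMk_apply, clamp_clamp]
  · exact ⟨0, fun k => Subsingleton.elim _ _, Or.inl fun s => rfl⟩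

theorem EdgeParam.flip {n : ℕ} {P : ℝ → unitCube n} (h : EdgeParam P) :
    EdgeParam fun s => P (1 - s) := by
  constructor
  · intro s hs t ht
    rw [h.dist_eq _ (one_sub_mem hs) _ (one_sub_mem ht), abs_sub_comm]
    congr 1; ring
  · intro p
    obtain ⟨s, hs, rfl⟩ := h.surj p
    exact ⟨1 - s, one_sub_mem hs, by simp⟩
  · intro s
    rw [← clamp_one_sub, h.clamp]
  · obtain ⟨i, hi, h1⟩ := h.vals
    refine ⟨i, hi, ?_⟩
    rcases h1 with h1 | h1
    · right; intro s; rw [h1, clamp_one_sub]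
    · left; intro s; rw [h1, clamp_one_sub]; ring

theorem EdgeParam.interior {n : ℕ} {P : ℝ → unitCube n} (h : EdgeParam P) {s : ℝ}
    (hs : s ∈ Ioo (0 : ℝ) 1) (i : Fin n) : (P s).1 i ∈ Ioo (0 : ℝ) 1 := by
  obtain ⟨j, hj, h1⟩ := h.vals
  rw [hj i]
  rcases h1 with h1 | h1 <;> rw [h1, clamp_of_mem ⟨hs.1.le, hs.2.le⟩]
  · exact hs
  · exact ⟨by linarith [hs.2], by linarith [hs.1]⟩

theorem EdgeParam.end_iff {n : ℕ} {P : ℝ → unitCube n} (h : EdgeParam P) {s : ℝ}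
    (hs : s ∈ Icc (0 : ℝ) 1) :
    (∀ i, (P s).1 i = 0 ∨ (P s).1 i = 1) ↔ s = 0 ∨ s = 1 := by
  obtain ⟨j, hj, h1⟩ := h.vals
  have : ∀ (p : Fin n → Prop), (∀ i, p i) ↔ p j := fun p =>
    ⟨fun h => h j, fun h i => hj i ▸ h⟩
  rw [this]
  rcases h1 with h1 | h1 <;> rw [h1, clamp_of_mem hs]
  constructor <;> (rintro (h | h)) <;> first | (left; linarith) | (right; linarith)

/-- An isometric parametrisation of a cube by the unit interval is one of the two standard ones. -/
theorem edge_of_isometric {n : ℕ} {γ : ℝ → unitCube n}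
    (h1 : ∀ s ∈ Icc (0 : ℝ) 1, ∀ t ∈ Icc (0 : ℝ) 1, dist (γ s) (γ t) = |s - t|)
    (h2 : ∀ p, ∃ s ∈ Icc (0 : ℝ) 1, γ s = p) :
    n = 1 ∧ ((∀ s ∈ Icc (0 : ℝ) 1, γ s = cubeMk fun _ => s) ∨
      ∀ s ∈ Icc (0 : ℝ) 1, γ s = cubeMk fun _ => 1 - s) := by
  have S : EdgeParam fun s => (cubeMk fun _ => s : unitCube 1) := EdgeParam.std rfl
  have hx : ∀ x : unitCube 1, (cubeMk fun _ => x.1 0) = x := fun x => cube_ext fun i => by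
    rw [Subsingleton.elim i 0, cubeMk_apply, clamp_of_mem (x.2 0)]
  have iso : Isometry fun x : unitCube 1 => γ (x.1 0) := by
    refine Isometry.of_dist_eq fun x y => ?_
    rw [h1 _ (x.2 0) _ (y.2 0), ← S.dist_eq _ (x.2 0) _ (y.2 0), hx, hx]
  have surj : Function.Surjective fun x : unitCube 1 => γ (x.1 0) := by
    intro p
    obtain ⟨s, hs, rfl⟩ := h2 p
    exact ⟨cubeMk fun _ => s, by simp only [cubeMk_apply, clamp_of_mem hs]⟩
  have hn : n = 1 := (dim_eq_of_isometryEquiv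
    ⟨Equiv.ofBijective _ ⟨iso.injective, surj⟩, iso⟩).symm
  refine ⟨hn, ?_⟩
  subst hn
  have hk : ∀ s ∈ Icc (0 : ℝ) 1, ∀ t ∈ Icc (0 : ℝ) 1, |(γ s).1 0 - (γ t).1 0| = |s - t| := by
    intro s hs t ht
    rw [← h1 s hs t ht, ← S.dist_eq _ ((γ s).2 0) _ ((γ t).2 0), hx, hx]
  have m0 : (0 : ℝ) ∈ Icc (0 : ℝ) 1 := by simp
  have m1 : (1 : ℝ) ∈ Icc (0 : ℝ) 1 := by simp
  have b0 := (γ 0).2 0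
  have b1 := (γ 1).2 0
  have h01 := hk 0 m0 1 m1
  have ext : ∀ s t, t ∈ Icc (0 : ℝ) 1 → (γ s).1 0 = t → γ s = cubeMk fun _ => t := by
    intro s t ht h
    refine cube_ext fun i => ?_
    rw [Subsingleton.elim i 0, cubeMk_apply, clamp_of_mem ht, h]
  rw [zero_sub, abs_neg, abs_one] at h01
  rcases abs_cases ((γ 0).1 0 - (γ 1).1 0) with h | h
  · right
    intro s hs
    refine ext s _ (one_sub_mem hs) ?_
    have h3 := hk s hs 1 m1
    have h4 := (γ s).2 0
    rw [abs_of_nonneg (by linarith [h4.1, b1.1, b0.2]), abs_sub_comm,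
      abs_of_nonneg (by linarith [hs.2])] at h3
    linarith [b0.2, b1.1]
  · left
    intro s hs
    refine ext s _ hs ?_
    have h3 := hk s hs 0 m0
    have h4 := (γ s).2 0
    rw [abs_of_nonneg (by linarith [h4.1, b0.1, b1.2]), sub_zero, abs_of_nonneg hs.1] at h3
    linarith [b1.2, b0.1]

/-- `P` is one of the eight isometric parametrisations of the unit square `unitCube 2`. -/
structure SquareParam {n : ℕ} (P : ℝ → ℝ → unitCube n) : Prop where
  dist_sq : ∀ a ∈ Icc (0 : ℝ) 1, ∀ b ∈ Icc (0 : ℝ) 1, ∀ a' ∈ Icc (0 : ℝ) 1,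
    ∀ b' ∈ Icc (0 : ℝ) 1, dist (P a b) (P a' b') ^ 2 = (a - a') ^ 2 + (b - b') ^ 2
  surj : ∀ p, ∃ a ∈ Icc (0 : ℝ) 1, ∃ b ∈ Icc (0 : ℝ) 1, P a b = p
  clamp : ∀ a b, P (clamp a) (clamp b) = P a b
  vals : ∃ i j : Fin n, (∀ k, k = i ∨ k = j) ∧
    ((∀ a b, (P a b).1 i = _root_.clamp a) ∨ ∀ a b, (P a b).1 i = 1 - _root_.clamp a) ∧
    ((∀ a b, (P a b).1 j = _root_.clamp b) ∨ ∀ a b, (P a b).1 j = 1 - _root_.clamp b)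
  side : IsCubeFace (P 0 '' Icc 0 1) ∧ IsCubeFace (P 1 '' Icc 0 1) ∧
    IsCubeFace ((fun a => P a 0) '' Icc 0 1) ∧ IsCubeFace ((fun a => P a 1) '' Icc 0 1)

theorem SquareParam.std {n : ℕ} (hn : n = 2) :
    SquareParam (fun a b => (cubeMk fun i => if i.1 = 0 then a else b : unitCube n)) := by
  subst hn
  have key : ∀ p : unitCube 2, (cubeMk fun i => if i.1 = 0 then p.1 0 else p.1 1) = p := by
    intro p
    refine cube_ext fun i => ?_
    fin_cases i <;> simp [cubeMk_apply, clamp_of_mem (p.2 _)]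
  have c0 : _root_.clamp 0 = 0 := clamp_of_mem (by simp)
  have c1 : _root_.clamp 1 = 1 := clamp_of_mem (by simp)
  constructor
  · intro a ha b hb a' ha' b' hb'
    rw [cube_dist_sq]
    simp [cubeMk_apply, clamp_of_mem, ha, hb, ha', hb']
  · intro p
    exact ⟨p.1 0, p.2 0, p.1 1, p.2 1, key p⟩
  · intro a b
    refine cube_ext fun i => ?_
    simp only [cubeMk_apply]
    split_ifs <;> rw [clamp_clamp]
  · exact ⟨0, 1, fun k => by fin_cases k <;> simp, Or.inl fun a b => by simp [cubeMk_apply],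
      Or.inl fun a b => by simp [cubeMk_apply]⟩
  · refine ⟨⟨{0}, fun _ => 0, fun _ => Or.inl rfl, ?_⟩, ⟨{0}, fun _ => 1, fun _ => Or.inr rfl, ?_⟩,
      ⟨{1}, fun _ => 0, fun _ => Or.inl rfl, ?_⟩, ⟨{1}, fun _ => 1, fun _ => Or.inr rfl, ?_⟩⟩
    all_goals
      ext p
      constructor
      · rintro ⟨b, hb, rfl⟩
        simp [cubeMk_apply, c0, c1]
      · intro hp
        simp only [mem_singleton_iff, forall_eq, mem_ofPred_eq] at hp
        first
        | exact ⟨p.1 1, p.2 1, by simp only; rw [← hp]; exact key p⟩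
        | exact ⟨p.1 0, p.2 0, by simp only; rw [← hp]; exact key p⟩

theorem SquareParam.swap {n : ℕ} {P : ℝ → ℝ → unitCube n} (h : SquareParam P) :
    SquareParam fun a b => P b a := by
  constructor
  · intro a ha b hb a' ha' b' hb'
    rw [h.dist_sq b hb a ha b' hb' a' ha']; ring
  · intro p
    obtain ⟨a, ha, b, hb, h1⟩ := h.surj p
    exact ⟨b, hb, a, ha, h1⟩
  · exact fun a b => h.clamp b a
  · obtain ⟨i, j, h1, h2, h3⟩ := h.vals
    refine ⟨j, i, fun k => (h1 k).symm, ?_, ?_⟩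
    · exact h3.imp (fun h a b => h b a) (fun h a b => h b a)
    · exact h2.imp (fun h a b => h b a) (fun h a b => h b a)
  · exact ⟨h.side.2.2.1, h.side.2.2.2, h.side.1, h.side.2.1⟩

theorem SquareParam.flip {n : ℕ} {P : ℝ → ℝ → unitCube n} (h : SquareParam P) :
    SquareParam fun a b => P (1 - a) b := by
  constructor
  · intro a ha b hb a' ha' b' hb'
    rw [h.dist_sq _ (one_sub_mem ha) b hb _ (one_sub_mem ha') b' hb']; ring
  · intro p
    obtain ⟨a, ha, b, hb, h1⟩ := h.surj p
    exact ⟨1 - a, one_sub_mem ha, b, hb, by simpa using h1⟩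
  · intro a b
    rw [← clamp_one_sub]
    exact h.clamp _ b
  · obtain ⟨i, j, h1, h2, h3⟩ := h.vals
    refine ⟨i, j, h1, ?_, h3.imp (fun h a b => h _ b) (fun h a b => h _ b)⟩
    rcases h2 with h2 | h2
    · right; intro a b; rw [h2, clamp_one_sub]
    · left; intro a b; rw [h2, clamp_one_sub]; ring
  · have key : ∀ b, (fun a => P (1 - a) b) '' Icc 0 1 = (fun a => P a b) '' Icc 0 1 := by
      intro b
      ext p
      constructor
      · rintro ⟨a, ha, rfl⟩
        exact ⟨1 - a, one_sub_mem ha, rfl⟩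
      · rintro ⟨a, ha, rfl⟩
        exact ⟨1 - a, one_sub_mem ha, by simp⟩
    obtain ⟨s1, s2, s3, s4⟩ := h.side
    refine ⟨?_, ?_, ?_, ?_⟩
    · simpa using s2
    · simpa using s1
    · rw [key]; exact s3
    · rw [key]; exact s4

theorem SquareParam.interior {n : ℕ} {P : ℝ → ℝ → unitCube n} (h : SquareParam P) {a b : ℝ}
    (ha : a ∈ Ioo (0 : ℝ) 1) (hb : b ∈ Ioo (0 : ℝ) 1) (i : Fin n) :
    (P a b).1 i ∈ Ioo (0 : ℝ) 1 := by
  obtain ⟨j, k, hjk, h1, h2⟩ := h.vals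
  have e1 := clamp_of_mem ⟨ha.1.le, ha.2.le⟩
  have e2 := clamp_of_mem ⟨hb.1.le, hb.2.le⟩
  rcases hjk i with rfl | rfl
  · rcases h1 with h1 | h1 <;> rw [h1, e1]
    · exact ha
    · exact ⟨by linarith [ha.2], by linarith [ha.1]⟩
  · rcases h2 with h2 | h2 <;> rw [h2, e2]
    · exact hb
    · exact ⟨by linarith [hb.2], by linarith [hb.1]⟩

theorem SquareParam.corner_iff {n : ℕ} {P : ℝ → ℝ → unitCube n} (h : SquareParam P) {a b : ℝ}
    (ha : a ∈ Icc (0 : ℝ) 1) (hb : b ∈ Icc (0 : ℝ) 1) :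
    (∀ i, (P a b).1 i = 0 ∨ (P a b).1 i = 1) ↔ (a = 0 ∨ a = 1) ∧ (b = 0 ∨ b = 1) := by
  obtain ⟨j, k, hjk, h1, h2⟩ := h.vals
  have key : ∀ (p : Fin n → Prop), (∀ i, p i) ↔ p j ∧ p k := fun p =>
    ⟨fun h => ⟨h j, h k⟩, fun h i => by rcases hjk i with rfl | rfl; exacts [h.1, h.2]⟩
  have aux : ∀ x : ℝ, (1 - x = 0 ∨ 1 - x = 1) ↔ (x = 0 ∨ x = 1) := by
    intro x
    constructor <;> (rintro (h | h)) <;> first | (left; linarith) | (right; linarith)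
  rw [key]
  have h1' : ((P a b).1 j = 0 ∨ (P a b).1 j = 1) ↔ a = 0 ∨ a = 1 := by
    rcases h1 with h1 | h1 <;> rw [h1, clamp_of_mem ha]
    exact aux a
  have h2' : ((P a b).1 k = 0 ∨ (P a b).1 k = 1) ↔ b = 0 ∨ b = 1 := by
    rcases h2 with h2 | h2 <;> rw [h2, clamp_of_mem hb]
    exact aux b
  rw [h1', h2']

/-- A point of a proper face of the square has a coordinate equal to `0` or `1`. -/
theorem SquareParam.of_mem_face {n : ℕ} {P : ℝ → ℝ → unitCube n} (h : SquareParam P) {a b : ℝ}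
    (ha : a ∈ Icc (0 : ℝ) 1) (hb : b ∈ Icc (0 : ℝ) 1) {F : Set (unitCube n)} (hF : IsCubeFace F)
    (hF' : F ≠ univ) (hp : P a b ∈ F) : a = 0 ∨ a = 1 ∨ b = 0 ∨ b = 1 := by
  by_contra hcon
  push Not at hcon
  obtain ⟨S, v, hv, rfl⟩ := hF
  have := cubeFace_eq_univ_of_interior (S := S) hv hp (h.interior
    ⟨lt_of_le_of_ne ha.1 (Ne.symm hcon.1), lt_of_le_of_ne ha.2 hcon.2.1⟩
    ⟨lt_of_le_of_ne hb.1 (Ne.symm hcon.2.2.1), lt_of_le_of_ne hb.2 hcon.2.2.2⟩)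
  subst this
  exact hF' (cubeFace_empty v)

/-- The distance of a point of the unit square to the boundary. -/
noncomputable def depth (a b : ℝ) : ℝ := min (min a (1 - a)) (min b (1 - b))

theorem depth_pos {a b : ℝ} (ha : a ∈ Ioo (0 : ℝ) 1) (hb : b ∈ Ioo (0 : ℝ) 1) : 0 < depth a b :=
  lt_min (lt_min ha.1 (by linarith [ha.2])) (lt_min hb.1 (by linarith [hb.2]))

theorem SquareParam.abs_fst_sub_le {n : ℕ} {P : ℝ → ℝ → unitCube n} (h : SquareParam P)
    {a b a' b' : ℝ} (ha : a ∈ Icc (0 : ℝ) 1) (hb : b ∈ Icc (0 : ℝ) 1) (ha' : a' ∈ Icc (0 : ℝ) 1)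
    (hb' : b' ∈ Icc (0 : ℝ) 1) : |a - a'| ≤ dist (P a b) (P a' b') := by
  apply abs_le_of_sq_le_sq _ dist_nonneg
  rw [h.dist_sq a ha b hb a' ha' b' hb']
  nlinarith [sq_nonneg (b - b')]

theorem SquareParam.abs_snd_sub_le {n : ℕ} {P : ℝ → ℝ → unitCube n} (h : SquareParam P)
    {a b a' b' : ℝ} (ha : a ∈ Icc (0 : ℝ) 1) (hb : b ∈ Icc (0 : ℝ) 1) (ha' : a' ∈ Icc (0 : ℝ) 1)
    (hb' : b' ∈ Icc (0 : ℝ) 1) : |b - b'| ≤ dist (P a b) (P a' b') :=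
  h.swap.abs_fst_sub_le hb ha hb' ha'

theorem SquareParam.depth_le {n : ℕ} {P : ℝ → ℝ → unitCube n} (h : SquareParam P)
    {a b a' b' : ℝ} (ha : a ∈ Icc (0 : ℝ) 1) (hb : b ∈ Icc (0 : ℝ) 1) (ha' : a' ∈ Icc (0 : ℝ) 1)
    (hb' : b' ∈ Icc (0 : ℝ) 1) : depth a b ≤ depth a' b' + dist (P a b) (P a' b') := by
  have h1 := abs_le.1 (h.abs_fst_sub_le ha hb ha' hb')
  have h2 := abs_le.1 (h.abs_snd_sub_le ha hb ha' hb')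
  have e1 : depth a b ≤ a := (min_le_left _ _).trans (min_le_left _ _)
  have e2 : depth a b ≤ 1 - a := (min_le_left _ _).trans (min_le_right _ _)
  have e3 : depth a b ≤ b := (min_le_right _ _).trans (min_le_left _ _)
  have e4 : depth a b ≤ 1 - b := (min_le_right _ _).trans (min_le_right _ _)
  rw [← sub_le_iff_le_add]
  refine le_min (le_min ?_ ?_) (le_min ?_ ?_) <;> linarith [h1.1, h1.2, h2.1, h2.2]

theorem depth_eq_zero {a b : ℝ} (ha : a ∈ Icc (0 : ℝ) 1) (hb : b ∈ Icc (0 : ℝ) 1)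
    (h : a = 0 ∨ a = 1 ∨ b = 0 ∨ b = 1) : depth a b = 0 := by
  have h0 : 0 ≤ depth a b := le_min (le_min ha.1 (by linarith [ha.2]))
    (le_min hb.1 (by linarith [hb.2]))
  refine le_antisymm ?_ h0
  have e1 : depth a b ≤ a := (min_le_left _ _).trans (min_le_left _ _)
  have e2 : depth a b ≤ 1 - a := (min_le_left _ _).trans (min_le_right _ _)
  have e3 : depth a b ≤ b := (min_le_right _ _).trans (min_le_left _ _)
  have e4 : depth a b ≤ 1 - b := (min_le_right _ _).trans (min_le_right _ _)
  rcases h with h | h | h | h <;> linarith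

/-! ### Vertices, edges and squares of a complex -/

namespace SquareComplex

section NoMetric

variable {X : Type u} {K : SquareComplex.{u, v} X}

/-- The points that are cells. -/
def IsVertex (K : SquareComplex.{u, v} X) (x : X) : Prop :=
  ∃ c, K.dim c = 0 ∧ x ∈ range (K.chart c)

/-- A parametrisation of the edge `c`, constant outside of `[0, 1]`. -/
noncomputable def edgeMap (K : SquareComplex.{u, v} X) (c : K.Cell) (s : ℝ) : X :=
  K.chart c (cubeMk fun _ => s)

/-- `E` is one of the two parametrisations of the edge `c`. -/
def IsEdgeOf (K : SquareComplex.{u, v} X) (c : K.Cell) (E : ℝ → X) : Prop :=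
  K.dim c = 1 ∧ (E = K.edgeMap c ∨ E = fun s => K.edgeMap c (1 - s))

/-- `E` is a parametrisation of an edge, that is, an oriented edge. -/
def IsEdge (K : SquareComplex.{u, v} X) (E : ℝ → X) : Prop := ∃ c, K.IsEdgeOf c E

/-- A parametrisation of the square `c`, constant outside of `[0, 1]` in each variable. -/
noncomputable def squareMap (K : SquareComplex.{u, v} X) (c : K.Cell) (a b : ℝ) : X :=
  K.chart c (cubeMk fun i => if i.1 = 0 then a else b)

/-- `Q` is one of the eight parametrisations of the square `c`. -/
inductive IsSquareOf (K : SquareComplex.{u, v} X) (c : K.Cell) : (ℝ → ℝ → X) → Prop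
  | std : K.dim c = 2 → IsSquareOf K c (K.squareMap c)
  | swap (Q : ℝ → ℝ → X) : IsSquareOf K c Q → IsSquareOf K c fun a b => Q b a
  | flip (Q : ℝ → ℝ → X) : IsSquareOf K c Q → IsSquareOf K c fun a b => Q (1 - a) b

/-- `Q` is a parametrisation of a square. -/
def IsSquare (K : SquareComplex.{u, v} X) (Q : ℝ → ℝ → X) : Prop := ∃ c, K.IsSquareOf c Q

theorem IsEdgeOf.exists_param {c : K.Cell} {E : ℝ → X} (h : K.IsEdgeOf c E) :
    ∃ P : ℝ → unitCube (K.dim c), EdgeParam P ∧ ∀ s, E s = K.chart c (P s) := by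
  obtain ⟨h1, rfl | rfl⟩ := h
  · exact ⟨_, EdgeParam.std h1, fun _ => rfl⟩
  · exact ⟨_, (EdgeParam.std h1).flip, fun _ => rfl⟩

theorem IsEdgeOf.flip {c : K.Cell} {E : ℝ → X} (h : K.IsEdgeOf c E) :
    K.IsEdgeOf c fun s => E (1 - s) := by
  obtain ⟨h1, rfl | rfl⟩ := h
  · exact ⟨h1, Or.inr rfl⟩
  · exact ⟨h1, Or.inl (by simp)⟩

theorem IsEdge.flip {E : ℝ → X} (h : K.IsEdge E) : K.IsEdge fun s => E (1 - s) :=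
  h.imp fun _ h => h.flip

theorem IsEdgeOf.eq_or_eq_flip {c : K.Cell} {E E' : ℝ → X} (h : K.IsEdgeOf c E)
    (h' : K.IsEdgeOf c E') : E' = E ∨ E' = fun s => E (1 - s) := by
  obtain ⟨-, rfl | rfl⟩ := h <;> obtain ⟨-, rfl | rfl⟩ := h' <;> simp

theorem IsSquareOf.dim_eq {c : K.Cell} {Q : ℝ → ℝ → X} (h : K.IsSquareOf c Q) : K.dim c = 2 := by
  induction h with
  | std h => exact h
  | swap _ _ ih => exact ih
  | flip _ _ ih => exact ih

theorem IsSquareOf.exists_param {c : K.Cell} {Q : ℝ → ℝ → X} (h : K.IsSquareOf c Q) :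
    ∃ P : ℝ → ℝ → unitCube (K.dim c), SquareParam P ∧ ∀ a b, Q a b = K.chart c (P a b) := by
  induction h with
  | std h => exact ⟨_, SquareParam.std h, fun _ _ => rfl⟩
  | swap _ _ ih =>
    obtain ⟨P, h1, h2⟩ := ih
    exact ⟨_, h1.swap, fun a b => h2 b a⟩
  | flip _ _ ih =>
    obtain ⟨P, h1, h2⟩ := ih
    exact ⟨_, h1.flip, fun a b => h2 _ b⟩

theorem IsSquareOf.flip_right {c : K.Cell} {Q : ℝ → ℝ → X} (h : K.IsSquareOf c Q) :
    K.IsSquareOf c fun a b => Q a (1 - b) := h.swap.flip.swap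

theorem IsSquare.swap {Q : ℝ → ℝ → X} (h : K.IsSquare Q) : K.IsSquare fun a b => Q b a :=
  h.imp fun _ h => h.swap

theorem IsSquare.flip {Q : ℝ → ℝ → X} (h : K.IsSquare Q) : K.IsSquare fun a b => Q (1 - a) b :=
  h.imp fun _ h => h.flip

theorem IsVertex.corner {x : X} (h : K.IsVertex x) {c : K.Cell} {p : unitCube (K.dim c)}
    (hp : K.chart c p = x) (i : Fin (K.dim c)) : p.1 i = 0 ∨ p.1 i = 1 := by
  classical
  obtain ⟨d, hd, q, rfl⟩ := h
  obtain ⟨S, a, e, ha, he, he'⟩ := K.exists_face_of_interior (p := q)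
    (fun i => (Fin.cast hd i).elim0) hp
  have h1 := card_free_eq_of_isometryEquiv_cube ha e.symm
  rw [hd, Finset.card_eq_zero] at h1
  have hi : i ∈ S := by
    by_contra hi
    have : i ∈ (Finset.univ.filter fun i => i ∉ S) := by simp [hi]
    rw [h1] at this
    simp at this
  rw [← he', (e q).2 i hi]
  exact ha i

theorem isVertex_of_corner {c : K.Cell} {p : unitCube (K.dim c)}
    (hp : ∀ i, p.1 i = 0 ∨ p.1 i = 1) : K.IsVertex (K.chart c p) := by
  classical
  obtain ⟨d, e, he⟩ := K.exists_face_equiv c (isCubeFace_cubeFace univ (a := fun i => p.1 i) hp)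
  have h1 := card_free_eq_of_isometryEquiv_cube hp e
  refine ⟨d, ?_, _, he p fun i _ => rfl⟩
  simpa using h1.symm

theorem isEdge_of_isometric {d : K.Cell} {E : ℝ → X} {γ : ℝ → unitCube (K.dim d)}
    (h1 : ∀ s ∈ Icc (0 : ℝ) 1, ∀ t ∈ Icc (0 : ℝ) 1, dist (γ s) (γ t) = |s - t|)
    (h2 : ∀ p, ∃ s ∈ Icc (0 : ℝ) 1, γ s = p) (h3 : ∀ s, E (clamp s) = E s)
    (h4 : ∀ s ∈ Icc (0 : ℝ) 1, E s = K.chart d (γ s)) : K.IsEdge E := by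
  obtain ⟨hd, h | h⟩ := edge_of_isometric h1 h2
  · refine ⟨d, hd, Or.inl (funext fun s => ?_)⟩
    rw [← h3, h4 _ (clamp_mem s), h _ (clamp_mem s), edgeMap]
    congr 1
    exact cube_ext fun i => by rw [cubeMk_apply, cubeMk_apply, clamp_clamp]
  · refine ⟨d, hd, Or.inr (funext fun s => ?_)⟩
    rw [← h3, h4 _ (clamp_mem s), h _ (clamp_mem s), edgeMap]
    congr 1
    exact cube_ext fun i => by rw [cubeMk_apply, cubeMk_apply, ← clamp_one_sub, clamp_clamp]

theorem IsSquare.isEdge {Q : ℝ → ℝ → X} (h : K.IsSquare Q) : K.IsEdge (Q 0) := by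
  obtain ⟨c, h⟩ := h
  obtain ⟨P, hP, hQ⟩ := h.exists_param
  obtain ⟨d, e, he⟩ := K.exists_face_equiv c hP.side.1
  have m : ∀ s ∈ Icc (0 : ℝ) 1, P 0 s ∈ P 0 '' Icc 0 1 := fun s hs => mem_image_of_mem _ hs
  refine isEdge_of_isometric (d := d) (γ := fun s => e ⟨P 0 (clamp s), m _ (clamp_mem s)⟩)
    ?_ ?_ ?_ ?_
  · intro s hs t ht
    rw [e.dist_eq, Subtype.dist_eq]
    change dist (P 0 (clamp s)) (P 0 (clamp t)) = |s - t|
    rw [clamp_of_mem hs, clamp_of_mem ht,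
      ← abs_of_nonneg (dist_nonneg (x := P 0 s)), ← sq_eq_sq_iff_abs_eq_abs,
      hP.dist_sq 0 (by simp) s hs 0 (by simp) t ht]
    ring
  · intro p
    obtain ⟨⟨_, s, hs, rfl⟩, rfl⟩ := e.surjective p
    exact ⟨s, hs, by congr 3; exact clamp_of_mem hs⟩
  · intro s
    rw [hQ, hQ, ← hP.clamp 0 s, ← hP.clamp 0 (clamp s), clamp_clamp]
  · intro s hs
    rw [he, hQ, clamp_of_mem hs]

theorem IsEdge.isVertex {E : ℝ → X} (h : K.IsEdge E) : K.IsVertex (E 0) := by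
  obtain ⟨c, h⟩ := h
  obtain ⟨P, hP, hE⟩ := h.exists_param
  rw [hE]
  exact isVertex_of_corner ((hP.end_iff (by simp)).2 (Or.inl rfl))

theorem IsEdgeOf.surj {c : K.Cell} {E : ℝ → X} (h : K.IsEdgeOf c E) (p : unitCube (K.dim c)) :
    ∃ s ∈ Icc (0 : ℝ) 1, E s = K.chart c p := by
  obtain ⟨P, hP, hE⟩ := h.exists_param
  obtain ⟨s, hs, rfl⟩ := hP.surj p
  exact ⟨s, hs, hE s⟩

theorem IsSquareOf.surj {c : K.Cell} {Q : ℝ → ℝ → X} (h : K.IsSquareOf c Q)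
    (p : unitCube (K.dim c)) :
    ∃ a ∈ Icc (0 : ℝ) 1, ∃ b ∈ Icc (0 : ℝ) 1, Q a b = K.chart c p := by
  obtain ⟨P, hP, hQ⟩ := h.exists_param
  obtain ⟨a, ha, b, hb, rfl⟩ := hP.surj p
  exact ⟨a, ha, b, hb, hQ a b⟩

/-- An interior point of an edge lies in no other cell of dimension at most `1`. -/
theorem IsEdgeOf.eq_of_mem {c d : K.Cell} {E : ℝ → X} (h : K.IsEdgeOf c E) {s : ℝ}
    (hs : s ∈ Ioo (0 : ℝ) 1) (hd : E s ∈ range (K.chart d)) (hdim : K.dim d ≤ 1) : d = c := by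
  obtain ⟨P, hP, hE⟩ := h.exists_param
  obtain ⟨q, hq⟩ := hd
  rw [hE] at hq
  exact K.eq_of_interior (hP.interior hs) hq (by rw [h.1]; exact hdim)

/-- An interior point of a square lies in no other cell. -/
theorem IsSquareOf.eq_of_mem {c d : K.Cell} {Q : ℝ → ℝ → X} (h : K.IsSquareOf c Q) {a b : ℝ}
    (ha : a ∈ Ioo (0 : ℝ) 1) (hb : b ∈ Ioo (0 : ℝ) 1) (hd : Q a b ∈ range (K.chart d)) :
    d = c := by
  obtain ⟨P, hP, hQ⟩ := h.exists_param
  obtain ⟨q, hq⟩ := hd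
  rw [hQ] at hq
  exact K.eq_of_interior (hP.interior ha hb) hq (by rw [h.dim_eq]; exact K.dim_le_two d)

/-- A square that contains an interior point of an edge has the edge as a side. -/
theorem IsEdge.exists_side {E : ℝ → X} (h : K.IsEdge E) {s : ℝ} (hs : s ∈ Ioo (0 : ℝ) 1)
    {c : K.Cell} (hc : K.dim c = 2) (hm : E s ∈ range (K.chart c)) :
    ∃ Q, K.IsSquareOf c Q ∧ Q 0 = E := by
  obtain ⟨d, h⟩ := h
  have main : ∀ Q, K.IsSquareOf c Q → ∀ b, Q 0 b = E s → ∃ Q, K.IsSquareOf c Q ∧ Q 0 = E := by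
    intro Q hQ b hb
    obtain ⟨d', hd'⟩ := IsSquare.isEdge ⟨c, hQ⟩
    have hE : E s ∈ range (K.chart d') := by
      obtain ⟨P, -, hP⟩ := hd'.exists_param
      rw [← hb, hP]
      exact mem_range_self _
    obtain rfl := h.eq_of_mem hs hE hd'.1.le
    rcases hd'.eq_or_eq_flip h with h1 | h1
    · exact ⟨Q, hQ, h1.symm⟩
    · exact ⟨_, hQ.flip_right, h1.symm⟩
  obtain ⟨p, hp⟩ := hm
  have hQ : K.IsSquareOf c (K.squareMap c) := .std hc
  obtain ⟨a, ha, b, hb, hab⟩ := hQ.surj p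
  rw [hp] at hab
  by_cases hint : a ∈ Ioo (0 : ℝ) 1 ∧ b ∈ Ioo (0 : ℝ) 1
  · exfalso
    have : d = c := by
      refine hQ.eq_of_mem hint.1 hint.2 ?_
      rw [hab]
      obtain ⟨P, -, hP⟩ := h.exists_param
      rw [hP]
      exact mem_range_self _
    subst this
    rw [h.1] at hc
    norm_num at hc
  · have : a = 0 ∨ a = 1 ∨ b = 0 ∨ b = 1 := by
      by_contra hcon
      push Not at hcon
      exact hint ⟨⟨lt_of_le_of_ne ha.1 (Ne.symm hcon.1), lt_of_le_of_ne ha.2 hcon.2.1⟩,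
        ⟨lt_of_le_of_ne hb.1 (Ne.symm hcon.2.2.1), lt_of_le_of_ne hb.2 hcon.2.2.2⟩⟩
    rcases this with rfl | rfl | rfl | rfl
    · exact main _ hQ b hab
    · exact main _ hQ.flip b (by simpa using hab)
    · exact main _ hQ.swap a hab
    · exact main _ hQ.swap.flip a (by simpa using hab)

theorem exists_vertex_or_edge_or_square (K : SquareComplex.{u, v} X) (x : X) :
    K.IsVertex x ∨ (∃ E, K.IsEdge E ∧ ∃ s ∈ Ioo (0 : ℝ) 1, E s = x) ∨
      ∃ Q, K.IsSquare Q ∧ ∃ a ∈ Ioo (0 : ℝ) 1, ∃ b ∈ Ioo (0 : ℝ) 1, Q a b = x := by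
  have edge : ∀ E, K.IsEdge E → ∀ s ∈ Icc (0 : ℝ) 1, E s = x → K.IsVertex x ∨
      (∃ E, K.IsEdge E ∧ ∃ s ∈ Ioo (0 : ℝ) 1, E s = x) := by
    rintro E ⟨c, hE⟩ s hs rfl
    by_cases h : s = 0 ∨ s = 1
    · left
      obtain ⟨P, hP, hE'⟩ := hE.exists_param
      rw [hE']
      exact isVertex_of_corner ((hP.end_iff hs).2 h)
    · right
      push Not at h
      exact ⟨E, ⟨c, hE⟩, s, ⟨lt_of_le_of_ne hs.1 (Ne.symm h.1), lt_of_le_of_ne hs.2 h.2⟩, rfl⟩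
  obtain ⟨c, p, hp⟩ := K.exists_cell x
  have h2 := K.dim_le_two c
  obtain h0 | h1 | h2 : K.dim c = 0 ∨ K.dim c = 1 ∨ K.dim c = 2 := by omega
  · exact Or.inl ⟨c, h0, p, hp⟩
  · obtain ⟨s, hs, h⟩ := IsEdgeOf.surj (K := K) (c := c) ⟨h1, Or.inl rfl⟩ p
    rcases edge _ ⟨c, h1, Or.inl rfl⟩ s hs (h.trans hp) with h | h
    exacts [Or.inl h, Or.inr (Or.inl h)]
  · have hQ : K.IsSquareOf c (K.squareMap c) := .std h2
    obtain ⟨a, ha, b, hb, hab⟩ := hQ.surj p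
    rw [hp] at hab
    rw [← or_assoc]
    by_cases hint : a ∈ Ioo (0 : ℝ) 1 ∧ b ∈ Ioo (0 : ℝ) 1
    · exact Or.inr ⟨_, ⟨c, hQ⟩, a, hint.1, b, hint.2, hab⟩
    · left
      have : a = 0 ∨ a = 1 ∨ b = 0 ∨ b = 1 := by
        by_contra hcon
        push Not at hcon
        exact hint ⟨⟨lt_of_le_of_ne ha.1 (Ne.symm hcon.1), lt_of_le_of_ne ha.2 hcon.2.1⟩,
          ⟨lt_of_le_of_ne hb.1 (Ne.symm hcon.2.2.1), lt_of_le_of_ne hb.2 hcon.2.2.2⟩⟩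
      rcases this with rfl | rfl | rfl | rfl
      · exact edge _ (IsSquare.isEdge ⟨c, hQ⟩) b hb hab
      · exact edge _ (IsSquare.isEdge ⟨c, hQ.flip⟩) b hb (by simpa using hab)
      · exact edge _ (IsSquare.isEdge ⟨c, hQ.swap⟩) a ha hab
      · exact edge _ (IsSquare.isEdge ⟨c, hQ.swap.flip⟩) a ha (by simpa using hab)

/-! ### Margins -/

theorem IsVertex.hasMargin {x : X} (h : K.IsVertex x) : K.HasMargin x 1 := by
  rintro c p hp F ⟨S, a, ha, rfl⟩ hpF p' hp'
  have : ∃ i ∈ S, p.1 i ≠ a i := by simpa using hpF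
  obtain ⟨i, hi, hne⟩ := this
  refine le_trans ?_ (abs_coord_le_cube_dist p p' i)
  rw [hp' i hi]
  exact one_le_abs_sub (h.corner hp i) (ha i) hne

theorem IsEdge.hasMargin {E : ℝ → X} (h : K.IsEdge E) {s : ℝ} (hs : s ∈ Ioo (0 : ℝ) 1) :
    K.HasMargin (E s) (min s (1 - s)) := by
  classical
  rintro c p hp F ⟨T, b, hb, rfl⟩ hpF p' hp'
  obtain ⟨d, h⟩ := h
  obtain ⟨P, hP, hE⟩ := h.exists_param
  rw [hE] at hp
  obtain ⟨S, a, e, ha, he, he'⟩ := K.exists_face_of_interior (hP.interior hs) hp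
  have : ∃ i ∈ T, p.1 i ≠ b i := by simpa using hpF
  obtain ⟨i, hi, hne⟩ := this
  refine le_trans ?_ (abs_coord_le_cube_dist p p' i)
  rw [hp' i hi]
  by_cases hiS : i ∈ S
  · have h1 : p.1 i = a i := by rw [← he']; exact (e (P s)).2 i hiS
    have h2 : (1 : ℝ) ≤ |p.1 i - b i| := one_le_abs_sub (h1 ▸ ha i) (hb i) hne
    exact (min_le_left _ _).trans (hs.2.le.trans h2)
  · have hpS : p ∈ cubeFace S a := by rw [← he']; exact (e (P s)).2
    let y : ℝ → unitCube (K.dim c) := fun t => cubeMk (Function.update (fun j => p.1 j) i t)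
    have hyi : ∀ t ∈ Icc (0 : ℝ) 1, (y t).1 i = t := fun t ht => by
      simp [y, cubeMk_apply, clamp_of_mem ht]
    have hyj : ∀ t, ∀ j ≠ i, (y t).1 j = p.1 j := fun t j hj => by
      simp [y, cubeMk_apply, hj, clamp_of_mem (p.2 j)]
    have hyS : ∀ t, y t ∈ cubeFace S a := fun t j hj => by
      rw [hyj t j (fun h => hiS (h ▸ hj))]; exact hpS j hj
    have hyd : ∀ t ∈ Icc (0 : ℝ) 1, ∀ t' ∈ Icc (0 : ℝ) 1, dist (y t) (y t') = |t - t'| := by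
      intro t ht t' ht'
      rw [← abs_of_nonneg (dist_nonneg (x := y t)), ← sq_eq_sq_iff_abs_eq_abs, cube_dist_sq,
        Finset.sum_eq_single i]
      · rw [hyi t ht, hyi t' ht']
      · intro j _ hj
        rw [hyj t j hj, hyj t' j hj]; ring
      · simp
    have hyp : y (p.1 i) = p := by
      refine cube_ext fun j => ?_
      by_cases hj : j = i
      · rw [hj, hyi _ (p.2 i)]
      · exact hyj _ j hj
    have hbm : b i ∈ Icc (0 : ℝ) 1 := by rcases hb i with h | h <;> rw [h] <;> simp
    obtain ⟨u, hu, hu'⟩ := hP.surj (e.symm ⟨y (b i), hyS _⟩)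
    obtain ⟨u', hu2, hu2'⟩ := hP.surj (e.symm ⟨y (1 - b i), hyS _⟩)
    have d1 : |u - u'| = 1 := by
      rw [← hP.dist_eq u hu u' hu2, hu', hu2', e.symm.dist_eq, Subtype.dist_eq,
        hyd _ hbm _ (one_sub_mem hbm)]
      rcases hb i with h | h <;> rw [h] <;> norm_num
    have d2 : |s - u| = |p.1 i - b i| := by
      rw [← hP.dist_eq s ⟨hs.1.le, hs.2.le⟩ u hu, hu', ← e.dist_eq, e.apply_symm_apply,
        Subtype.dist_eq, he', ← hyd _ (p.2 i) _ hbm, hyp]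
    have d3 : u = 0 ∨ u = 1 := by
      rcases abs_cases (u - u') with h | h
      · right; linarith [hu.2, hu2.1]
      · left; linarith [hu.1, hu2.2]
    rw [← d2]
    rcases d3 with rfl | rfl
    · rw [sub_zero, abs_of_pos hs.1]; exact min_le_left _ _
    · rw [abs_sub_comm, abs_of_pos (by linarith [hs.2])]; exact min_le_right _ _

theorem IsSquare.hasMargin {Q : ℝ → ℝ → X} (h : K.IsSquare Q) {a b : ℝ}
    (ha : a ∈ Ioo (0 : ℝ) 1) (hb : b ∈ Ioo (0 : ℝ) 1) : K.HasMargin (Q a b) (depth a b) := by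
  intro c p hp F hF hpF p' hp'
  obtain ⟨d, h⟩ := h
  obtain rfl := h.eq_of_mem ha hb ⟨p, hp⟩
  obtain ⟨P, hP, hQ⟩ := h.exists_param
  rw [hQ] at hp
  obtain rfl := K.chart_injective _ hp
  obtain ⟨a', ha', b', hb', rfl⟩ := hP.surj p'
  have h1 := hP.of_mem_face ha' hb' hF (fun h => hpF (h ▸ mem_univ _)) hp'
  have h2 := hP.depth_le ⟨ha.1.le, ha.2.le⟩ ⟨hb.1.le, hb.2.le⟩ ha' hb'
  rw [depth_eq_zero ha' hb' h1] at h2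
  linarith

end NoMetric

end SquareComplex

namespace SquareComplex

/-! ### The metric on and near a cell -/

section CellMetric

variable {X : Type u} {K : SquareComplex.{u, v} X}

theorem IsSquareOf.eq_of_side_eq {c : K.Cell} {Q Q' : ℝ → ℝ → X} (h : K.IsSquareOf c Q)
    (h' : K.IsSquareOf c Q') (h0 : Q 0 = Q' 0) : Q = Q' := by
  obtain ⟨P, hP, hQ⟩ := h.exists_param
  obtain ⟨P', hP', hQ'⟩ := h'.exists_param
  have m0 : (0 : ℝ) ∈ Icc (0 : ℝ) 1 := by simp
  have m1 : (1 : ℝ) ∈ Icc (0 : ℝ) 1 := by simp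
  have h1 : ∀ b, P 0 b = P' 0 b := fun b => by
    apply K.chart_injective
    rw [← hQ, ← hQ', h0]
  have key : ∀ a ∈ Icc (0 : ℝ) 1, ∀ b ∈ Icc (0 : ℝ) 1, P a b = P' a b := by
    intro a ha b hb
    obtain ⟨a', ha', b', hb', hab⟩ := hP'.surj (P a b)
    have e0 := hP.dist_sq a ha b hb 0 m0 0 m0
    have e1 := hP.dist_sq a ha b hb 0 m0 1 m1
    rw [← hab, h1, hP'.dist_sq a' ha' b' hb' 0 m0 0 m0] at e0
    rw [← hab, h1, hP'.dist_sq a' ha' b' hb' 0 m0 1 m1] at e1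
    have e2 : b' = b := by nlinarith
    have e3 : a' ^ 2 = a ^ 2 := by rw [e2] at e0; linarith
    have e4 : a' = a := by
      rw [sq_eq_sq₀ ha'.1 ha.1] at e3
      exact e3
    rw [← hab, e2, e4]
  funext a b
  rw [hQ, hQ', ← hP.clamp, ← hP'.clamp, key _ (clamp_mem a) _ (clamp_mem b)]

open Classical in
/-- The distance to the boundary of the square `Q`, extended by `0` to the complex. -/
noncomputable def depthFn (Q : ℝ → ℝ → X) (z : X) : ℝ :=
  if h : ∃ r : ℝ, ∃ a ∈ Icc (0 : ℝ) 1, ∃ b ∈ Icc (0 : ℝ) 1, Q a b = z ∧ depth a b = r then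
    h.choose else 0

theorem IsSquareOf.depthFn_eq {c : K.Cell} {Q : ℝ → ℝ → X} (h : K.IsSquareOf c Q) {a b : ℝ}
    (ha : a ∈ Icc (0 : ℝ) 1) (hb : b ∈ Icc (0 : ℝ) 1) : depthFn Q (Q a b) = depth a b := by
  have h1 : ∃ r : ℝ, ∃ a' ∈ Icc (0 : ℝ) 1, ∃ b' ∈ Icc (0 : ℝ) 1,
      Q a' b' = Q a b ∧ depth a' b' = r := ⟨_, a, ha, b, hb, rfl, rfl⟩
  rw [depthFn, dif_pos h1]
  obtain ⟨a', ha', b', hb', e1, e2⟩ := h1.choose_spec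
  rw [← e2]
  obtain ⟨P, hP, hQ⟩ := h.exists_param
  rw [hQ, hQ] at e1
  have e3 := K.chart_injective _ e1
  have e4 := hP.abs_fst_sub_le ha' hb' ha hb
  have e5 := hP.abs_snd_sub_le ha' hb' ha hb
  rw [e3, dist_self] at e4 e5
  rw [sub_eq_zero.1 (abs_eq_zero.1 (le_antisymm e4 (abs_nonneg _))),
    sub_eq_zero.1 (abs_eq_zero.1 (le_antisymm e5 (abs_nonneg _)))]

theorem IsSquareOf.depthFn_eq_zero {c d : K.Cell} {Q : ℝ → ℝ → X} (h : K.IsSquareOf c Q)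
    (hcd : d ≠ c) (p : unitCube (K.dim d)) : depthFn Q (K.chart d p) = 0 := by
  by_cases hz : ∃ a ∈ Icc (0 : ℝ) 1, ∃ b ∈ Icc (0 : ℝ) 1, Q a b = K.chart d p
  · obtain ⟨a, ha, b, hb, hab⟩ := hz
    rw [← hab, h.depthFn_eq ha hb]
    apply depth_eq_zero ha hb
    by_contra hcon
    push Not at hcon
    refine hcd (h.eq_of_mem (a := a) (b := b)
      ⟨lt_of_le_of_ne ha.1 (Ne.symm hcon.1), lt_of_le_of_ne ha.2 hcon.2.1⟩
      ⟨lt_of_le_of_ne hb.1 (Ne.symm hcon.2.2.1), lt_of_le_of_ne hb.2 hcon.2.2.2⟩ ?_)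
    rw [hab]
    exact mem_range_self _
  · rw [depthFn, dif_neg]
    rintro ⟨r, a, ha, b, hb, h1, -⟩
    exact hz ⟨a, ha, b, hb, h1⟩

theorem IsSquareOf.depthFn_sub_le {c : K.Cell} {Q : ℝ → ℝ → X} (h : K.IsSquareOf c Q)
    (p q : unitCube (K.dim c)) :
    depthFn Q (K.chart c p) - depthFn Q (K.chart c q) ≤ dist p q := by
  obtain ⟨P, hP, hQ⟩ := h.exists_param
  obtain ⟨a, ha, b, hb, rfl⟩ := hP.surj p
  obtain ⟨a', ha', b', hb', rfl⟩ := hP.surj q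
  rw [← hQ, ← hQ, h.depthFn_eq ha hb, h.depthFn_eq ha' hb']
  linarith [hP.depth_le ha hb ha' hb']

variable [MetricSpace X]

theorem IsVertex.one_le_dist (hK : K.IsIntrinsicMetric) {x y : X} (hx : K.IsVertex x)
    (hy : K.IsVertex y) (hne : x ≠ y) : 1 ≤ dist x y := by
  by_contra hlt
  push Not at hlt
  obtain ⟨c, p, q, hp, hq, h⟩ := hx.hasMargin.exists_cell hK hlt
  apply hne
  rw [← hp, ← hq]
  congr 1
  refine cube_ext fun i => ?_
  by_contra hi
  have h1 := one_le_abs_sub (hx.corner hp i) (hy.corner hq i) hi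
  have h2 := abs_coord_le_cube_dist p q i
  linarith

/-- Edges are isometrically embedded, as distinct vertices have distance at least `1`. This does not
need the CAT(0) inequality. -/
theorem IsEdge.isSeg (hK : K.IsIntrinsicMetric) {E : ℝ → X} (h : K.IsEdge E) : IsSeg E := by
  have h01 : 1 ≤ dist (E 0) (E 1) := by
    have hv : K.IsVertex (E 1) := by simpa using h.flip.isVertex
    refine h.isVertex.one_le_dist hK hv fun h0 => ?_
    obtain ⟨c, h⟩ := h
    obtain ⟨P, hP, hE⟩ := h.exists_param
    rw [hE, hE] at h0
    have := hP.dist_eq 0 (by simp) 1 (by simp)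
    rw [K.chart_injective _ h0, dist_self] at this
    norm_num at this
  have hle : ∀ s ∈ Icc (0 : ℝ) 1, ∀ t ∈ Icc (0 : ℝ) 1, dist (E s) (E t) ≤ |s - t| := by
    obtain ⟨c, h⟩ := h
    obtain ⟨P, hP, hE⟩ := h.exists_param
    intro s hs t ht
    rw [hE, hE, ← hP.dist_eq s hs t ht]
    exact hK.dist_chart_le _ _ _
  have key : ∀ s ∈ Icc (0 : ℝ) 1, ∀ t ∈ Icc (0 : ℝ) 1, s ≤ t → dist (E s) (E t) = |s - t| := by
    intro s hs t ht hst
    apply le_antisymm (hle s hs t ht)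
    have e1 := hle 0 (by simp) s hs
    have e2 := hle t ht 1 (by simp)
    rw [zero_sub, abs_neg, abs_of_nonneg hs.1] at e1
    rw [abs_sub_comm, abs_of_nonneg (by linarith [ht.2])] at e2
    rw [abs_sub_comm, abs_of_nonneg (by linarith)]
    linarith [dist_triangle (E 0) (E s) (E 1), dist_triangle (E s) (E t) (E 1)]
  intro s hs t ht
  rcases le_total s t with hst | hst
  · exact key s hs t ht hst
  · rw [dist_comm, abs_sub_comm]; exact key t ht s hs hst

theorem IsSquareOf.dist_eq_of_lt_depth (hK : K.IsIntrinsicMetric) {c : K.Cell} {Q : ℝ → ℝ → X}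
    (h : K.IsSquareOf c Q) {a b a' b' : ℝ} (ha : a ∈ Ioo (0 : ℝ) 1) (hb : b ∈ Ioo (0 : ℝ) 1)
    (ha' : a' ∈ Icc (0 : ℝ) 1) (hb' : b' ∈ Icc (0 : ℝ) 1)
    (hlt : Real.sqrt ((a - a') ^ 2 + (b - b') ^ 2) < depth a b) :
    dist (Q a b) (Q a' b') = Real.sqrt ((a - a') ^ 2 + (b - b') ^ 2) := by
  have hm := IsSquare.hasMargin ⟨c, h⟩ ha hb
  obtain ⟨P, hP, hQ⟩ := h.exists_param
  rw [← hP.dist_sq a ⟨ha.1.le, ha.2.le⟩ b ⟨hb.1.le, hb.2.le⟩ a' ha' b' hb',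
    Real.sqrt_sq dist_nonneg] at *
  rw [hQ] at hm
  have h1 := hm.min_le_dist hK (depth_pos ha hb).le (P a' b')
  rw [min_eq_right hlt.le] at h1
  rw [hQ, hQ]
  exact le_antisymm (hK.dist_chart_le _ _ _) h1

theorem IsSquare.dist_le (hK : K.IsIntrinsicMetric) {Q : ℝ → ℝ → X} (h : K.IsSquare Q)
    {a b a' b' : ℝ} (ha : a ∈ Icc (0 : ℝ) 1) (hb : b ∈ Icc (0 : ℝ) 1) (ha' : a' ∈ Icc (0 : ℝ) 1)
    (hb' : b' ∈ Icc (0 : ℝ) 1) :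
    dist (Q a b) (Q a' b') ≤ Real.sqrt ((a - a') ^ 2 + (b - b') ^ 2) := by
  obtain ⟨c, h⟩ := h
  obtain ⟨P, hP, hQ⟩ := h.exists_param
  rw [← hP.dist_sq a ha b hb a' ha' b' hb', Real.sqrt_sq dist_nonneg, hQ, hQ]
  exact hK.dist_chart_le _ _ _

theorem le_depth_segment {a b a' b' t ρ : ℝ} (ht : t ∈ Icc (0 : ℝ) 1) (h : ρ ≤ depth a b)
    (h' : ρ ≤ depth a' b') : ρ ≤ depth (a + t * (a' - a)) (b + t * (b' - b)) := by
  simp only [depth, le_min_iff] at *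
  obtain ⟨⟨h1, h2⟩, h3, h4⟩ := h
  obtain ⟨⟨h1', h2'⟩, h3', h4'⟩ := h'
  have := ht.1
  have := ht.2
  refine ⟨⟨?_, ?_⟩, ?_, ?_⟩ <;> nlinarith

theorem mem_Ioo_of_depth_pos {a b : ℝ} (h : 0 < depth a b) :
    a ∈ Ioo (0 : ℝ) 1 ∧ b ∈ Ioo (0 : ℝ) 1 := by
  simp only [depth, lt_min_iff] at h
  obtain ⟨⟨h1, h2⟩, h3, h4⟩ := h
  exact ⟨⟨h1, by linarith⟩, ⟨h3, by linarith⟩⟩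

/-- The straight segment between two interior points of a square is a local geodesic, hence a
geodesic. -/
theorem IsSquare.dist_eq_of_interior (hK : K.IsIntrinsicMetric) (hX : IsCAT0 X) {Q : ℝ → ℝ → X}
    (h : K.IsSquare Q) {a b a' b' : ℝ} (ha : a ∈ Ioo (0 : ℝ) 1) (hb : b ∈ Ioo (0 : ℝ) 1)
    (ha' : a' ∈ Ioo (0 : ℝ) 1) (hb' : b' ∈ Ioo (0 : ℝ) 1) :
    dist (Q a b) (Q a' b') = Real.sqrt ((a - a') ^ 2 + (b - b') ^ 2) := by
  set l := Real.sqrt ((a - a') ^ 2 + (b - b') ^ 2) with hl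
  rcases (Real.sqrt_nonneg ((a - a') ^ 2 + (b - b') ^ 2)).eq_or_lt with h0 | hpos
  · rw [← hl] at h0
    have := h.dist_le hK ⟨ha.1.le, ha.2.le⟩ ⟨hb.1.le, hb.2.le⟩ ⟨ha'.1.le, ha'.2.le⟩
      ⟨hb'.1.le, hb'.2.le⟩
    rw [← hl, ← h0] at this
    rw [← h0]
    exact le_antisymm this dist_nonneg
  rw [← hl] at hpos
  set ρ := min (depth a b) (depth a' b')
  have hρ : 0 < ρ := lt_min (depth_pos ha hb) (depth_pos ha' hb')
  obtain ⟨N, hN⟩ := exists_nat_gt (2 * l / ρ)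
  have hN0 : (0 : ℝ) < N := lt_of_le_of_lt (by positivity) hN
  have hN1 : l * (2 / N) < ρ := by
    rw [div_lt_iff₀ hρ] at hN
    rw [← mul_div_assoc, div_lt_iff₀ hN0]
    linarith
  have key := hX.dist_of_locally_geodesic (c := fun t => Q (a + t * (a' - a)) (b + t * (b' - b)))
    hpos (N := N) (by exact_mod_cast hN0) (by
      intro s hs t ht hst
      have d1 := le_depth_segment hs (min_le_left _ _ : ρ ≤ _) (min_le_right _ _ : ρ ≤ _)
      have d2 := le_depth_segment ht (min_le_left _ _ : ρ ≤ _) (min_le_right _ _ : ρ ≤ _)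
      obtain ⟨m1, m2⟩ := mem_Ioo_of_depth_pos (hρ.trans_le d1)
      obtain ⟨m3, m4⟩ := mem_Ioo_of_depth_pos (hρ.trans_le d2)
      have e : Real.sqrt ((a + s * (a' - a) - (a + t * (a' - a))) ^ 2 +
          (b + s * (b' - b) - (b + t * (b' - b))) ^ 2) = l * |s - t| := by
        rw [hl, ← Real.sqrt_sq_eq_abs, ← Real.sqrt_mul (by positivity)]
        congr 1
        ring
      obtain ⟨c, h⟩ := h
      rw [← e]
      apply h.dist_eq_of_lt_depth hK m1 m2 ⟨m3.1.le, m3.2.le⟩ ⟨m4.1.le, m4.2.le⟩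
      rw [e]
      calc l * |s - t| ≤ l * (2 / N) := by gcongr
        _ < ρ := hN1
        _ ≤ _ := d1)
  simpa using key

theorem sqrt_sq_add_sq_le (x y : ℝ) : Real.sqrt (x ^ 2 + y ^ 2) ≤ |x| + |y| := by
  rw [Real.sqrt_le_left (by positivity)]
  nlinarith [sq_abs x, sq_abs y, abs_nonneg x, abs_nonneg y,
    mul_nonneg (abs_nonneg x) (abs_nonneg y)]

/-- The squares of a CAT(0) square complex are isometrically embedded. -/
theorem IsSquare.dist_sq (hK : K.IsIntrinsicMetric) (hX : IsCAT0 X) {Q : ℝ → ℝ → X}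
    (h : K.IsSquare Q) {a b a' b' : ℝ} (ha : a ∈ Icc (0 : ℝ) 1) (hb : b ∈ Icc (0 : ℝ) 1)
    (ha' : a' ∈ Icc (0 : ℝ) 1) (hb' : b' ∈ Icc (0 : ℝ) 1) :
    dist (Q a b) (Q a' b') ^ 2 = (a - a') ^ 2 + (b - b') ^ 2 := by
  set l := Real.sqrt ((a - a') ^ 2 + (b - b') ^ 2) with hl
  have hl0 : 0 ≤ l := Real.sqrt_nonneg _
  have key : l ≤ dist (Q a b) (Q a' b') := by
    -- move the two points towards the centre of the square by a factor `1 - ε`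
    have step : ∀ ε ∈ Ioo (0 : ℝ) 1, l ≤ dist (Q a b) (Q a' b') + ε * (l + 2) := by
      intro ε hε
      have sh : ∀ x ∈ Icc (0 : ℝ) 1, x + ε * (1 / 2 - x) ∈ Ioo (0 : ℝ) 1 := by
        intro x hx
        constructor <;> nlinarith [hx.1, hx.2, hε.1, hε.2]
      have near : ∀ x ∈ Icc (0 : ℝ) 1, ∀ y ∈ Icc (0 : ℝ) 1,
          dist (Q x y) (Q (x + ε * (1 / 2 - x)) (y + ε * (1 / 2 - y))) ≤ ε := by
        intro x hx y hy
        refine (h.dist_le hK hx hy ⟨(sh x hx).1.le, (sh x hx).2.le⟩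
          ⟨(sh y hy).1.le, (sh y hy).2.le⟩).trans ?_
        refine (sqrt_sq_add_sq_le _ _).trans ?_
        have : ∀ x ∈ Icc (0 : ℝ) 1, |x - (x + ε * (1 / 2 - x))| ≤ ε / 2 := by
          intro x hx
          rw [abs_le]
          constructor <;> nlinarith [hx.1, hx.2, hε.1, hε.2]
        linarith [this x hx, this y hy]
      have h1 := h.dist_eq_of_interior hK hX (sh a ha) (sh b hb) (sh a' ha') (sh b' hb')
      have e : Real.sqrt ((a + ε * (1 / 2 - a) - (a' + ε * (1 / 2 - a'))) ^ 2 +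
          (b + ε * (1 / 2 - b) - (b' + ε * (1 / 2 - b'))) ^ 2) = (1 - ε) * l := by
        rw [hl, show (a + ε * (1 / 2 - a) - (a' + ε * (1 / 2 - a'))) ^ 2 +
          (b + ε * (1 / 2 - b) - (b' + ε * (1 / 2 - b'))) ^ 2 =
          (1 - ε) ^ 2 * ((a - a') ^ 2 + (b - b') ^ 2) by ring,
          Real.sqrt_mul (by positivity), Real.sqrt_sq (by linarith [hε.2])]
      rw [e] at h1
      have h2 := near a ha b hb
      have h3 := near a' ha' b' hb'
      rw [dist_comm] at h2
      have h4 := dist_triangle4 (Q (a + ε * (1 / 2 - a)) (b + ε * (1 / 2 - b))) (Q a b) (Q a' b')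
        (Q (a' + ε * (1 / 2 - a')) (b' + ε * (1 / 2 - b')))
      nlinarith
    by_contra hlt
    push Not at hlt
    set g := l - dist (Q a b) (Q a' b')
    have hg : 0 < g := by simp only [g]; linarith
    have hgl : g ≤ l := by simp only [g]; linarith [dist_nonneg (x := Q a b) (y := Q a' b')]
    have := step (g / (2 * (l + 2))) ⟨by positivity, by
      rw [div_lt_one (by positivity)]; linarith⟩
    have e : g / (2 * (l + 2)) * (l + 2) = g / 2 := by field_simp
    rw [e] at this
    simp only [g] at this hg
    linarith
  rw [le_antisymm (h.dist_le hK ha hb ha' hb') key, Real.sq_sqrt (by positivity)]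

theorem IsSquare.isSeg (hK : K.IsIntrinsicMetric) (hX : IsCAT0 X) {Q : ℝ → ℝ → X}
    (h : K.IsSquare Q) {t : ℝ} (ht : t ∈ Icc (0 : ℝ) 1) : IsSeg (Q t) := by
  intro s hs s' hs'
  rw [← abs_of_nonneg (dist_nonneg (x := Q t s)), ← sq_eq_sq_iff_abs_eq_abs,
    h.dist_sq hK hX ht hs ht hs']
  ring

theorem IsSquare.dist_fst (hK : K.IsIntrinsicMetric) (hX : IsCAT0 X) {Q : ℝ → ℝ → X}
    (h : K.IsSquare Q) {s t t' : ℝ} (hs : s ∈ Icc (0 : ℝ) 1) (ht : t ∈ Icc (0 : ℝ) 1)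
    (ht' : t' ∈ Icc (0 : ℝ) 1) : dist (Q t s) (Q t' s) = |t - t'| :=
  h.swap.isSeg hK hX hs t ht t' ht'

theorem IsEdge.near (hK : K.IsIntrinsicMetric) {E : ℝ → X} (h : K.IsEdge E) {s : ℝ}
    (hs : s ∈ Ioo (0 : ℝ) 1) {z : X} (hz : dist (E s) z < min s (1 - s)) :
    (∃ s' ∈ Icc (0 : ℝ) 1, E s' = z) ∨
      ∃ Q, K.IsSquare Q ∧ Q 0 = E ∧ ∃ a ∈ Icc (0 : ℝ) 1, ∃ b ∈ Icc (0 : ℝ) 1, Q a b = z := by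
  obtain ⟨c, p, q, hp, hq, -⟩ := (h.hasMargin hs).exists_cell hK hz
  by_cases hc : K.dim c = 2
  · right
    obtain ⟨Q, hQ, hQ0⟩ := h.exists_side hs hc ⟨p, hp⟩
    obtain ⟨a, ha, b, hb, hab⟩ := hQ.surj q
    exact ⟨Q, ⟨c, hQ⟩, hQ0, a, ha, b, hb, hab.trans hq⟩
  · left
    obtain ⟨d, h⟩ := h
    have := K.dim_le_two c
    obtain rfl := h.eq_of_mem hs ⟨p, hp⟩ (by omega)
    obtain ⟨s', hs', h1⟩ := h.surj q
    exact ⟨s', hs', h1.trans hq⟩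

theorem IsSquareOf.near (hK : K.IsIntrinsicMetric) {c : K.Cell} {Q : ℝ → ℝ → X}
    (h : K.IsSquareOf c Q) {a b : ℝ}
    (ha : a ∈ Ioo (0 : ℝ) 1) (hb : b ∈ Ioo (0 : ℝ) 1) {z : X} (hz : dist (Q a b) z < depth a b) :
    ∃ a' ∈ Icc (0 : ℝ) 1, ∃ b' ∈ Icc (0 : ℝ) 1, Q a' b' = z := by
  obtain ⟨d, p, q, hp, hq, -⟩ := (IsSquare.hasMargin ⟨c, h⟩ ha hb).exists_cell hK hz
  obtain rfl := h.eq_of_mem ha hb ⟨p, hp⟩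
  obtain ⟨a', ha', b', hb', h1⟩ := h.surj q
  exact ⟨a', ha', b', hb', h1.trans hq⟩

theorem IsVertex.near (hK : K.IsIntrinsicMetric) {x z : X} (hx : K.IsVertex x) (hne : z ≠ x)
    (hz : dist x z < 1) :
    (∃ E, K.IsEdge E ∧ E 0 = x ∧ ∃ s ∈ Ioc (0 : ℝ) 1, E s = z) ∨
      ∃ Q, K.IsSquare Q ∧ Q 0 0 = x ∧ ∃ a ∈ Icc (0 : ℝ) 1, ∃ b ∈ Ioc (0 : ℝ) 1, Q a b = z := by
  obtain ⟨c, p, q, hp, hq, -⟩ := hx.hasMargin.exists_cell hK hz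
  have h2 := K.dim_le_two c
  obtain h0 | h1 | h2 : K.dim c = 0 ∨ K.dim c = 1 ∨ K.dim c = 2 := by omega
  · exfalso
    apply hne
    rw [← hp, ← hq]
    congr 1
    exact cube_ext fun i => (Fin.cast h0 i).elim0
  · left
    have main : ∀ E, K.IsEdgeOf c E → E 0 = x →
        ∃ E, K.IsEdge E ∧ E 0 = x ∧ ∃ s ∈ Ioc (0 : ℝ) 1, E s = z := by
      intro E hE h0
      obtain ⟨s, hs, hs'⟩ := hE.surj q
      refine ⟨E, ⟨c, hE⟩, h0, s, ⟨lt_of_le_of_ne hs.1 ?_, hs.2⟩, hs'.trans hq⟩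
      rintro rfl
      exact hne (by rw [← hq, ← hs', h0])
    have hE : K.IsEdgeOf c (K.edgeMap c) := ⟨h1, Or.inl rfl⟩
    obtain ⟨P, hP, hE'⟩ := hE.exists_param
    obtain ⟨s, hs, rfl⟩ := hP.surj p
    rcases (hP.end_iff hs).1 (fun i => hx.corner hp i) with rfl | rfl
    · exact main _ hE ((hE' _).trans hp)
    · exact main _ hE.flip (by simpa using (hE' _).trans hp)
  · right
    have main : ∀ Q, K.IsSquareOf c Q → Q 0 0 = x → ∃ Q, K.IsSquare Q ∧ Q 0 0 = x ∧
        ∃ a ∈ Icc (0 : ℝ) 1, ∃ b ∈ Ioc (0 : ℝ) 1, Q a b = z := by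
      intro Q hQ h0
      obtain ⟨a, ha, b, hb, hab⟩ := hQ.surj q
      rcases hb.1.eq_or_lt with rfl | hb0
      · refine ⟨_, ⟨c, hQ.swap⟩, h0, 0, by simp, a, ⟨lt_of_le_of_ne ha.1 ?_, ha.2⟩, hab.trans hq⟩
        rintro rfl
        exact hne (by rw [← hq, ← hab, h0])
      · exact ⟨Q, ⟨c, hQ⟩, h0, a, ha, b, ⟨hb0, hb.2⟩, hab.trans hq⟩
    have hQ : K.IsSquareOf c (K.squareMap c) := .std h2
    obtain ⟨P, hP, hQ'⟩ := hQ.exists_param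
    obtain ⟨a, ha, b, hb, rfl⟩ := hP.surj p
    obtain ⟨rfl | rfl, rfl | rfl⟩ := (hP.corner_iff ha hb).1 (fun i => hx.corner hp i)
    · exact main _ hQ ((hQ' _ _).trans hp)
    · exact main _ hQ.flip_right (by simpa using (hQ' _ _).trans hp)
    · exact main _ hQ.flip (by simpa using (hQ' _ _).trans hp)
    · exact main _ hQ.flip.flip_right (by simpa using (hQ' _ _).trans hp)

/-- Two squares with a common side are equal, or lie on different sides of it: the difference of the
distances to their boundaries is a `1`-Lipschitz function on the complex. -/
theorem IsSquare.eq_or_add_le_dist (hK : K.IsIntrinsicMetric) {Q Q' : ℝ → ℝ → X}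
    (h : K.IsSquare Q) (h' : K.IsSquare Q') (h0 : Q 0 = Q' 0) :
    Q = Q' ∨ ∀ s ∈ Ioo (0 : ℝ) 1, ∀ a ∈ Icc (0 : ℝ) (min s (1 - s)),
      ∀ a' ∈ Icc (0 : ℝ) (min s (1 - s)), a + a' ≤ dist (Q a s) (Q' a' s) := by
  obtain ⟨c, h⟩ := h
  obtain ⟨c', h'⟩ := h'
  by_cases hcc : c = c'
  · subst hcc
    exact Or.inl (h.eq_of_side_eq h' h0)
  right
  intro s hs a ha a' ha'
  have lip : ∀ d p q, (depthFn Q (K.chart d p) - depthFn Q' (K.chart d p)) -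
      (depthFn Q (K.chart d q) - depthFn Q' (K.chart d q)) ≤ dist p q := by
    intro d p q
    by_cases h1 : d = c
    · subst h1
      rw [h'.depthFn_eq_zero hcc p, h'.depthFn_eq_zero hcc q]
      linarith [h.depthFn_sub_le p q]
    by_cases h2 : d = c'
    · subst h2
      rw [h.depthFn_eq_zero (Ne.symm hcc) p, h.depthFn_eq_zero (Ne.symm hcc) q]
      linarith [h'.depthFn_sub_le q p, dist_comm p q]
    rw [h.depthFn_eq_zero h1 p, h.depthFn_eq_zero h1 q, h'.depthFn_eq_zero h2 p,
      h'.depthFn_eq_zero h2 q]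
    simp
  have hd : ∀ a ∈ Icc (0 : ℝ) (min s (1 - s)), a ∈ Icc (0 : ℝ) 1 ∧ depth a s = a := by
    intro a ha
    have h1 := (le_min_iff.1 ha.2).1
    have h2 := (le_min_iff.1 ha.2).2
    refine ⟨⟨ha.1, by linarith [hs.2]⟩, ?_⟩
    rw [depth, min_eq_left (a := a) (by linarith), min_eq_left ha.2]
  have hsm : s ∈ Icc (0 : ℝ) 1 := ⟨hs.1.le, hs.2.le⟩
  obtain ⟨P, -, hP⟩ := h.exists_param
  obtain ⟨P', -, hP'⟩ := h'.exists_param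
  have e1 : depthFn Q (Q a s) = a := by rw [h.depthFn_eq (hd a ha).1 hsm, (hd a ha).2]
  have e2 : depthFn Q' (Q' a' s) = a' := by rw [h'.depthFn_eq (hd a' ha').1 hsm, (hd a' ha').2]
  have e3 : depthFn Q (Q' a' s) = 0 := by rw [hP', h.depthFn_eq_zero (Ne.symm hcc)]
  have e4 : depthFn Q' (Q a s) = 0 := by rw [hP, h'.depthFn_eq_zero hcc]
  have key := (abs_le.1 (hK.abs_sub_le_dist (φ := fun z => depthFn Q z - depthFn Q' z) lip
    (Q a s) (Q' a' s))).2
  simp only [e1, e2, e3, e4] at key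
  linarith

end CellMetric

end SquareComplex

namespace SquareComplex

section Walls

variable {X : Type u} [MetricSpace X] {K : SquareComplex.{u, v} X}

/-! ### Projections to the transversals of a square -/

/-- If the edge `E` is perpendicular at `E s` to the geodesic to `x`, then this geodesic runs along
a square. -/
theorem IsEdge.exists_square_of_isFoot (hK : K.IsIntrinsicMetric) (hX : IsCAT0 X) {E : ℝ → X}
    (hE : K.IsEdge E) {x : X} {s : ℝ} (hs : s ∈ Ioo (0 : ℝ) 1) (h : IsFoot E x s)
    (hne : x ≠ E s) :
    ∃ Q, K.IsSquare Q ∧ Q 0 = E ∧ ∃ a ∈ Ioc (0 : ℝ) (min s (1 - s)),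
      MetricBtw (E s) (Q a s) x := by
  have hρ : 0 < min s (1 - s) := lt_min hs.1 (by linarith [hs.2])
  have hd : 0 < dist (E s) x := dist_pos.2 hne.symm
  obtain ⟨z, hz, hz'⟩ := hX.exists_btw_dist_eq (E s) x (η := min (min s (1 - s) / 2) (dist (E s) x))
    (by positivity) (min_le_right _ _)
  have hη : 0 < min (min s (1 - s) / 2) (dist (E s) x) := lt_min (by linarith) hd
  have hη' : min (min s (1 - s) / 2) (dist (E s) x) < min s (1 - s) :=
    (min_le_left _ _).trans_lt (by linarith)
  rw [← hz'] at hη hη'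
  have hf := h.of_btw hz
  have hS := hE.isSeg hK
  rcases hE.near hK hs hη' with ⟨s', hs', rfl⟩ | ⟨Q, hQ, hQ0, a, ha, b, hb, rfl⟩
  · have : IsFoot E (E s') s' := ⟨hs', fun t _ => by simp⟩
    rw [hf.unique hX hS this, dist_self] at hη
    exact absurd hη (lt_irrefl _)
  · have m0 : (0 : ℝ) ∈ Icc (0 : ℝ) 1 := by simp
    have hsm : s ∈ Icc (0 : ℝ) 1 := ⟨hs.1.le, hs.2.le⟩
    have h1 := hf.2 b hb
    rw [← hQ0] at h1
    have h2 : dist (Q a b) (Q 0 s) ^ 2 ≤ dist (Q a b) (Q 0 b) ^ 2 := by gcongr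
    rw [hQ.dist_sq hK hX ha hb m0 hsm, hQ.dist_sq hK hX ha hb m0 hb] at h2
    have h3 : b = s := by nlinarith
    subst h3
    have h4 : dist (E b) (Q a b) = a := by
      rw [← hQ0, hQ.dist_fst hK hX hb m0 ha, zero_sub, abs_neg, abs_of_nonneg ha.1]
    rw [h4] at hη hη'
    exact ⟨Q, hQ, hQ0, a, ⟨hη, hη'.le⟩, hz⟩

/-- If a transversal of a square is perpendicular at an interior point `Q t s` of the square to the
geodesic to `x`, then this geodesic runs along the square. -/
theorem IsSquare.exists_btw_of_isFoot (hK : K.IsIntrinsicMetric) (hX : IsCAT0 X) {Q : ℝ → ℝ → X}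
    (hQ : K.IsSquare Q) {x : X} {s t : ℝ} (hs : s ∈ Ioo (0 : ℝ) 1) (ht : t ∈ Ioo (0 : ℝ) 1)
    (h : IsFoot (Q t) x s) (hne : x ≠ Q t s) :
    ∃ t' ∈ Icc (0 : ℝ) 1, t' ≠ t ∧ MetricBtw (Q t s) (Q t' s) x := by
  have hρ : 0 < depth t s := depth_pos ht hs
  have hd : 0 < dist (Q t s) x := dist_pos.2 hne.symm
  obtain ⟨z, hz, hz'⟩ := hX.exists_btw_dist_eq (Q t s) x (η := min (depth t s / 2) (dist (Q t s) x))
    (by positivity) (min_le_right _ _)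
  have hη : 0 < min (depth t s / 2) (dist (Q t s) x) := lt_min (by linarith) hd
  have hη' : min (depth t s / 2) (dist (Q t s) x) < depth t s :=
    (min_le_left _ _).trans_lt (by linarith)
  rw [← hz'] at hη hη'
  have hf := h.of_btw hz
  obtain ⟨a, ha, b, hb, rfl⟩ := hQ.choose_spec.near hK ht hs hη'
  have htm : t ∈ Icc (0 : ℝ) 1 := ⟨ht.1.le, ht.2.le⟩
  have hsm : s ∈ Icc (0 : ℝ) 1 := ⟨hs.1.le, hs.2.le⟩
  have h1 := hf.2 b hb
  have h2 : dist (Q a b) (Q t s) ^ 2 ≤ dist (Q a b) (Q t b) ^ 2 := by gcongr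
  rw [hQ.dist_sq hK hX ha hb htm hsm, hQ.dist_sq hK hX ha hb htm hb] at h2
  have h3 : b = s := by nlinarith
  subst h3
  refine ⟨a, ha, ?_, hz⟩
  rintro rfl
  rw [dist_self] at hη
  exact lt_irrefl _ hη

/-- The projection of `x` to a transversal `Q t'` of a square is `Q t' s` if the geodesic from
`Q t' s` to `x` is perpendicular to the transversal. -/
theorem IsSquare.isFoot_of_btw (hK : K.IsIntrinsicMetric) (hX : IsCAT0 X) {Q : ℝ → ℝ → X}
    (hQ : K.IsSquare Q) {x : X} {s t t' : ℝ} (hs : s ∈ Icc (0 : ℝ) 1) (ht : t ∈ Icc (0 : ℝ) 1)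
    (ht' : t' ∈ Icc (0 : ℝ) 1) (hne : t ≠ t') (h : MetricBtw (Q t' s) (Q t s) x) :
    IsFoot (Q t') x s := by
  refine ⟨hs, fun u hu => ?_⟩
  rcases eq_or_ne u s with rfl | hus
  · exact le_rfl
  have e1 := hQ.dist_sq hK hX ht' hs ht hs
  have e2 := hQ.dist_sq hK hX ht' hs ht' hu
  have e3 := hQ.dist_sq hK hX ht hs ht' hu
  have p := hX.pythagoras h (w := Q t' u) (y := Q t' u) (by simp [MetricBtw])
    (by
      intro h0
      rw [h0, dist_self] at e1
      have : (t' - t) ^ 2 = 0 := by nlinarith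
      exact hne (by nlinarith [pow_eq_zero_iff (two_ne_zero) |>.1 this]))
    (by
      intro h0
      rw [h0, dist_self] at e2
      have : (s - u) ^ 2 = 0 := by nlinarith
      exact hus (by nlinarith [pow_eq_zero_iff (two_ne_zero) |>.1 this]))
    (by rw [e1, e2, e3]; nlinarith)
  rw [dist_comm x]
  exact abs_le_of_sq_le_sq' (by nlinarith [sq_nonneg (dist (Q t' s) (Q t' u))]) dist_nonneg |>.2

theorem IsSquare.btw_forward (hK : K.IsIntrinsicMetric) (hX : IsCAT0 X) {Q : ℝ → ℝ → X}
    (hQ : K.IsSquare Q) {x : X} {s t t₁ t' : ℝ} (hs : s ∈ Icc (0 : ℝ) 1) (ht : t ∈ Icc (0 : ℝ) 1)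
    (ht₁ : t₁ ∈ Icc (0 : ℝ) 1) (ht' : t' ∈ Icc (0 : ℝ) 1) (h : MetricBtw (Q t s) (Q t₁ s) x)
    (hb : |t - t'| + |t' - t₁| = |t - t₁|) : MetricBtw (Q t' s) (Q t₁ s) x := by
  unfold MetricBtw at *
  rw [hQ.dist_fst hK hX hs ht ht₁] at h
  have h1 := dist_triangle (Q t s) (Q t' s) x
  have h2 := dist_triangle (Q t' s) (Q t₁ s) x
  rw [hQ.dist_fst hK hX hs ht ht'] at h1
  rw [hQ.dist_fst hK hX hs ht' ht₁] at h2 ⊢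
  linarith

/-- A geodesic that is a continuation of a vertical segment of a square extends this segment. -/
theorem IsSquare.btw_backward (hK : K.IsIntrinsicMetric) (hX : IsCAT0 X) {Q : ℝ → ℝ → X}
    (hQ : K.IsSquare Q) {x z : X} {s t t₁ t' : ℝ} (hs : s ∈ Icc (0 : ℝ) 1) (ht : t ∈ Icc (0 : ℝ) 1)
    (ht₁ : t₁ ∈ Icc (0 : ℝ) 1) (ht' : t' ∈ Icc (0 : ℝ) 1) (h : MetricBtw (Q t s) z x)
    (hz : z ≠ Q t s) (hl : dist (Q t s) z + |t - t₁| ≤ dist z (Q t₁ s))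
    (hside : 0 < (t' - t) * (t₁ - t)) : MetricBtw (Q t' s) (Q t s) x := by
  have hd := fun {a b : ℝ} (ha : a ∈ Icc (0 : ℝ) 1) (hb : b ∈ Icc (0 : ℝ) 1) =>
    hQ.dist_fst hK hX hs ha hb
  have hQne : ∀ a ∈ Icc (0 : ℝ) 1, 0 < (a - t) * (a - t) → Q a s ≠ Q t s := by
    intro a ha h0 h1
    have := hd ha ht
    rw [h1, dist_self] at this
    rw [abs_eq_zero.1 this.symm] at h0
    simp at h0
  have pos1 : 0 < (t' - t) * (t' - t) := by
    have : t' - t ≠ 0 := fun h0 => by rw [h0] at hside; simp at hside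
    exact mul_self_pos.2 this
  have pos2 : 0 < (t₁ - t) * (t₁ - t) := by
    have : t₁ - t ≠ 0 := fun h0 => by rw [h0] at hside; simp at hside
    exact mul_self_pos.2 this
  apply MetricBtw.symm
  rcases le_total |t - t'| |t - t₁| with hle | hle
  · refine hX.btw_of_local h (w := Q t' s) (by simp [MetricBtw]) hz (hQne t' ht' pos1) ?_
    have h1 := dist_triangle z (Q t' s) (Q t₁ s)
    rw [hd ht' ht₁] at h1
    rw [hd ht ht']
    have h2 : |t - t₁| = |t - t'| + |t' - t₁| := by
      rcases pos_and_pos_or_neg_and_neg_of_mul_pos hside with ⟨g1, g2⟩ | ⟨g1, g2⟩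
      · rw [abs_of_neg (by linarith), abs_of_neg (by linarith)] at hle ⊢
        rw [abs_of_nonpos (by linarith)]; ring
      · rw [abs_of_pos (by linarith), abs_of_pos (by linarith)] at hle ⊢
        rw [abs_of_nonneg (by linarith)]; ring
    linarith
  · refine hX.btw_of_local h (w := Q t₁ s) ?_ hz (hQne t₁ ht₁ pos2) ?_
    · unfold MetricBtw
      rw [hd ht ht₁, hd ht₁ ht', hd ht ht']
      rcases pos_and_pos_or_neg_and_neg_of_mul_pos hside with ⟨g1, g2⟩ | ⟨g1, g2⟩
      · rw [abs_of_neg (a := t - t₁) (by linarith), abs_of_neg (a := t - t') (by linarith)] at hle ⊢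
        rw [abs_of_nonpos (by linarith)]; ring
      · rw [abs_of_pos (a := t - t₁) (by linarith), abs_of_pos (a := t - t') (by linarith)] at hle ⊢
        rw [abs_of_nonneg (by linarith)]; ring
    · rwa [hd ht ht₁]

theorem IsSquare.isFoot_self (hK : K.IsIntrinsicMetric) (hX : IsCAT0 X) {Q : ℝ → ℝ → X}
    (hQ : K.IsSquare Q) {s t t' : ℝ} (hs : s ∈ Icc (0 : ℝ) 1) (ht : t ∈ Icc (0 : ℝ) 1)
    (ht' : t' ∈ Icc (0 : ℝ) 1) : IsFoot (Q t') (Q t s) s := by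
  refine ⟨hs, fun u hu => ?_⟩
  refine abs_le_of_sq_le_sq' ?_ dist_nonneg |>.2
  rw [hQ.dist_sq hK hX ht hs ht' hs, hQ.dist_sq hK hX ht hs ht' hu]
  nlinarith [sq_nonneg (s - u)]

theorem IsSquare.isFoot_near_zero (hK : K.IsIntrinsicMetric) (hX : IsCAT0 X) {Q : ℝ → ℝ → X}
    (hQ : K.IsSquare Q) {x : X} {s : ℝ} (hs : s ∈ Ioo (0 : ℝ) 1) (h : IsFoot (Q 0) x s) :
    ∃ ε > 0, ∀ t ∈ Icc (0 : ℝ) 1, t < ε → IsFoot (Q t) x s := by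
  have m0 : (0 : ℝ) ∈ Icc (0 : ℝ) 1 := by simp
  have hsm : s ∈ Icc (0 : ℝ) 1 := ⟨hs.1.le, hs.2.le⟩
  rcases eq_or_ne x (Q 0 s) with rfl | hne
  · exact ⟨1, one_pos, fun t ht _ => hQ.isFoot_self hK hX hsm m0 ht⟩
  obtain ⟨Q', hQ', h0, a, ha, hb⟩ := hQ.isEdge.exists_square_of_isFoot hK hX hs h hne
  have ham : a ∈ Icc (0 : ℝ) 1 :=
    ⟨ha.1.le, ha.2.trans ((min_le_left _ _).trans hs.2.le)⟩
  rcases hQ.eq_or_add_le_dist hK hQ' h0.symm with rfl | hsep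
  · refine ⟨a, ha.1, fun t ht hta => ?_⟩
    refine hQ.isFoot_of_btw hK hX hsm ham ht hta.ne' ?_
    apply hQ.btw_forward hK hX hsm m0 ham ht hb
    have := ha.1
    rw [zero_sub, zero_sub, abs_neg, abs_neg, abs_of_nonneg ht.1, abs_of_pos this,
      abs_of_nonpos (by linarith)]
    ring
  · refine ⟨1, one_pos, fun t ht _ => ?_⟩
    rcases ht.1.eq_or_lt with rfl | htpos
    · exact h
    have hρ : 0 < min s (1 - s) := lt_min hs.1 (by linarith [hs.2])
    have hρ1 : min s (1 - s) ≤ 1 := (min_le_left _ _).trans hs.2.le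
    refine hQ.isFoot_of_btw hK hX hsm m0 ht htpos.ne ?_
    have hda : dist (Q 0 s) (Q' a s) = a := by
      rw [← h0, hQ'.dist_fst hK hX hsm m0 ham, zero_sub, abs_neg, abs_of_pos ha.1]
    refine hQ.btw_backward hK hX hsm m0 (t₁ := min s (1 - s)) ⟨hρ.le, hρ1⟩ ht hb ?_ ?_ ?_
    · intro h1
      rw [h1, dist_self] at hda
      linarith [ha.1]
    · rw [hda, zero_sub, abs_neg, abs_of_pos hρ, dist_comm, add_comm]
      exact hsep s hs _ ⟨hρ.le, le_rfl⟩ a ⟨ha.1.le, ha.2⟩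
    · simp only [sub_zero]; positivity

/-- If `x` projects to an interior point of a transversal of a square, then it projects to points
at the same height of the nearby transversals. -/
theorem IsSquare.isFoot_near (hK : K.IsIntrinsicMetric) (hX : IsCAT0 X) {Q : ℝ → ℝ → X}
    (hQ : K.IsSquare Q) {x : X} {s t : ℝ} (hs : s ∈ Ioo (0 : ℝ) 1) (ht : t ∈ Icc (0 : ℝ) 1)
    (h : IsFoot (Q t) x s) :
    ∃ ε > 0, ∀ t' ∈ Icc (0 : ℝ) 1, |t' - t| < ε → IsFoot (Q t') x s := by
  have hsm : s ∈ Icc (0 : ℝ) 1 := ⟨hs.1.le, hs.2.le⟩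
  rcases ht.1.eq_or_lt with rfl | h0
  · obtain ⟨ε, hε, h1⟩ := hQ.isFoot_near_zero hK hX hs h
    exact ⟨ε, hε, fun t' ht' hlt => h1 t' ht' (by rwa [sub_zero, abs_of_nonneg ht'.1] at hlt)⟩
  rcases ht.2.eq_or_lt with rfl | h1
  · obtain ⟨ε, hε, h1⟩ := hQ.flip.isFoot_near_zero hK hX hs (x := x) (by simpa using h)
    refine ⟨ε, hε, fun t' ht' hlt => ?_⟩
    have := h1 (1 - t') (one_sub_mem ht')
      (by rwa [abs_sub_comm, abs_of_nonneg (by linarith [ht'.2])] at hlt)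
    simpa using this
  rcases eq_or_ne x (Q t s) with rfl | hne
  · exact ⟨1, one_pos, fun t' ht' _ => hQ.isFoot_self hK hX hsm ht ht'⟩
  obtain ⟨t₂, ht₂, hne₂, hb⟩ := hQ.exists_btw_of_isFoot hK hX hs ⟨h0, h1⟩ h hne
  have hz : Q t₂ s ≠ Q t s := by
    intro h2
    have := hQ.dist_fst hK hX hsm ht₂ ht
    rw [h2, dist_self] at this
    exact hne₂ (sub_eq_zero.1 (abs_eq_zero.1 this.symm))
  refine ⟨|t₂ - t|, abs_pos.2 (sub_ne_zero.2 hne₂), fun t' ht' hlt => ?_⟩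
  rcases eq_or_ne t' t with rfl | htt
  · exact h
  rcases lt_or_gt_of_ne (mul_ne_zero (sub_ne_zero.2 htt) (sub_ne_zero.2 hne₂)) with hneg | hpos
  · -- `t'` lies on the other side of `t`
    refine hQ.isFoot_of_btw hK hX hsm ht ht' (Ne.symm htt) ?_
    rcases mul_neg_iff.1 hneg with ⟨g1, g2⟩ | ⟨g1, g2⟩
    · refine hQ.btw_backward hK hX hsm ht (t₁ := 1) (by simp) ht' hb hz ?_
        (mul_pos g1 (by linarith))
      rw [hQ.dist_fst hK hX hsm ht ht₂, hQ.dist_fst hK hX hsm ht₂ (by simp),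
        abs_of_pos (by linarith), abs_of_neg (by linarith), abs_of_nonpos (by linarith)]
      linarith
    · refine hQ.btw_backward hK hX hsm ht (t₁ := 0) (by simp) ht' hb hz ?_
        (mul_pos_of_neg_of_neg g1 (by linarith))
      rw [hQ.dist_fst hK hX hsm ht ht₂, hQ.dist_fst hK hX hsm ht₂ (by simp),
        abs_of_neg (by linarith), abs_of_pos (by linarith), abs_of_nonneg (by linarith [ht₂.1])]
      linarith
  · have hbt : |t - t'| + |t' - t₂| = |t - t₂| ∧ t₂ ≠ t' := by
      rcases pos_and_pos_or_neg_and_neg_of_mul_pos hpos with ⟨g1, g2⟩ | ⟨g1, g2⟩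
      · rw [abs_of_pos g1, abs_of_pos g2] at hlt
        refine ⟨?_, by intro h; linarith⟩
        rw [abs_of_neg (by linarith), abs_of_neg (by linarith), abs_of_neg (by linarith)]; ring
      · rw [abs_of_neg g1, abs_of_neg g2] at hlt
        refine ⟨?_, by intro h; linarith⟩
        rw [abs_of_pos (by linarith), abs_of_pos (by linarith), abs_of_pos (by linarith)]; ring
    exact hQ.isFoot_of_btw hK hX hsm ht₂ ht' hbt.2
      (hQ.btw_forward hK hX hsm ht ht₂ ht' hb hbt.1)

theorem IsSquare.isClosed_isFoot (hK : K.IsIntrinsicMetric) (hX : IsCAT0 X) {Q : ℝ → ℝ → X}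
    (hQ : K.IsSquare Q) (x : X) {s : ℝ} (hs : s ∈ Icc (0 : ℝ) 1) :
    IsClosed {t : Icc (0 : ℝ) 1 | IsFoot (Q t) x s} := by
  have hc : ∀ u ∈ Icc (0 : ℝ) 1, Continuous fun t : Icc (0 : ℝ) 1 => Q t u := fun u hu =>
    continuousOn_iff_continuous_domRestrict.1 (hQ.swap.isSeg hK hX hu).continuousOn
  have : {t : Icc (0 : ℝ) 1 | IsFoot (Q t) x s} =
      ⋂ u ∈ Icc (0 : ℝ) 1, {t : Icc (0 : ℝ) 1 | dist x (Q t s) ≤ dist x (Q t u)} := by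
    ext t
    simp [IsFoot, hs.1, hs.2]
  rw [this]
  refine isClosed_biInter fun u hu => isClosed_le ?_ ?_
  · exact continuous_const.dist (hc s hs)
  · exact continuous_const.dist (hc u hu)

/-- The set of the transversals on which the projection of `x` has a given height in the interior is
open and closed. -/
theorem IsSquare.isFoot_const (hK : K.IsIntrinsicMetric) (hX : IsCAT0 X) {Q : ℝ → ℝ → X}
    (hQ : K.IsSquare Q) {x : X} {s t t' : ℝ} (hs : s ∈ Ioo (0 : ℝ) 1) (ht : t ∈ Icc (0 : ℝ) 1)
    (ht' : t' ∈ Icc (0 : ℝ) 1) (h : IsFoot (Q t) x s) : IsFoot (Q t') x s := by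
  have hopen : IsOpen {t : Icc (0 : ℝ) 1 | IsFoot (Q t) x s} := by
    rw [Metric.isOpen_iff]
    intro t ht
    obtain ⟨ε, hε, h1⟩ := hQ.isFoot_near hK hX hs t.2 ht
    refine ⟨ε, hε, fun t' ht' => h1 t' t'.2 ?_⟩
    rwa [Metric.mem_ball, Subtype.dist_eq, Real.dist_eq] at ht'
  have hcl : IsClopen {t : Icc (0 : ℝ) 1 | IsFoot (Q t) x s} :=
    ⟨hQ.isClosed_isFoot hK hX x ⟨hs.1.le, hs.2.le⟩, hopen⟩
  have hu := hcl.eq_univ ⟨⟨t, ht⟩, h⟩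
  have : (⟨t', ht'⟩ : Icc (0 : ℝ) 1) ∈ {t : Icc (0 : ℝ) 1 | IsFoot (Q t) x s} := by
    rw [hu]; trivial
  exact this

/-- The projections of a point to all transversals of a square have the same height. -/
theorem IsSquare.coord_eq (hK : K.IsIntrinsicMetric) (hX : IsCAT0 X) {Q : ℝ → ℝ → X}
    (hQ : K.IsSquare Q) {t : ℝ} (ht : t ∈ Icc (0 : ℝ) 1) : coord (Q t) = coord (Q 0) := by
  funext x
  have hS := fun {t : ℝ} (ht : t ∈ Icc (0 : ℝ) 1) => hQ.isSeg hK hX ht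
  have m0 : (0 : ℝ) ∈ Icc (0 : ℝ) 1 := by simp
  by_cases hint : ∃ t ∈ Icc (0 : ℝ) 1, coord (Q t) x ∈ Ioo (0 : ℝ) 1
  · obtain ⟨t₀, ht₀, hs⟩ := hint
    have h := (hS ht₀).isFoot_coord x
    rw [(hQ.isFoot_const hK hX hs ht₀ ht h).coord_eq hX (hS ht),
      (hQ.isFoot_const hK hX hs ht₀ m0 h).coord_eq hX (hS m0)]
  · push Not at hint
    have dich : ∀ t : Icc (0 : ℝ) 1, IsFoot (Q t) x 0 ∨ IsFoot (Q t) x 1 := by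
      intro t
      have h := (hS t.2).isFoot_coord x
      have h1 := hint t t.2
      have h2 := h.1
      rcases h2.1.eq_or_lt with h3 | h3
      · left; rwa [← h3] at h
      rcases h2.2.eq_or_lt with h4 | h4
      · right; rwa [h4] at h
      exact absurd ⟨h3, h4⟩ h1
    have excl : ∀ t : Icc (0 : ℝ) 1, IsFoot (Q t) x 0 → ¬ IsFoot (Q t) x 1 := fun t h h' =>
      zero_ne_one (h.unique hX (hS t.2) h')
    have c0 := hQ.isClosed_isFoot hK hX x (s := 0) (by simp)
    have c1 := hQ.isClosed_isFoot hK hX x (s := 1) (by simp)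
    have hcompl : {t : Icc (0 : ℝ) 1 | IsFoot (Q t) x 0}ᶜ =
        {t : Icc (0 : ℝ) 1 | IsFoot (Q t) x 1} := by
      ext t
      constructor
      · intro h; exact (dich t).resolve_left h
      · intro h h'; exact excl t h' h
    have hcl : IsClopen {t : Icc (0 : ℝ) 1 | IsFoot (Q t) x 0} :=
      ⟨c0, by rw [← isClosed_compl_iff, hcompl]; exact c1⟩
    rcases isClopen_iff.1 hcl with he | hu
    · have h1 : ∀ t : Icc (0 : ℝ) 1, IsFoot (Q t) x 1 := fun t => by
        refine (dich t).resolve_left fun h => ?_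
        have : t ∈ {t : Icc (0 : ℝ) 1 | IsFoot (Q t) x 0} := h
        rw [he] at this
        exact this
      rw [(h1 ⟨t, ht⟩).coord_eq hX (hS ht), (h1 ⟨0, m0⟩).coord_eq hX (hS m0)]
    · have h1 : ∀ t : Icc (0 : ℝ) 1, IsFoot (Q t) x 0 := fun t => by
        have : t ∈ {t : Icc (0 : ℝ) 1 | IsFoot (Q t) x 0} := by rw [hu]; trivial
        exact this
      rw [(h1 ⟨t, ht⟩).coord_eq hX (hS ht), (h1 ⟨0, m0⟩).coord_eq hX (hS m0)]

/-! ### Walls -/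

/-- The points that project to an interior point of the edge `E` lie on the edges and squares that
are parallel to `E`: the geodesic to `x` traverses squares, from side to side, and crossing a square
diminishes the distance to `x` by `1`. -/
theorem IsEdge.exists_parallel (hK : K.IsIntrinsicMetric) (hX : IsCAT0 X) {E : ℝ → X}
    (hE : K.IsEdge E) {x : X} {s : ℝ} (hs : s ∈ Ioo (0 : ℝ) 1) (h : IsFoot E x s) :
    (∃ E', K.IsEdge E' ∧ E' s = x ∧ coord E' = coord E) ∨
      ∃ Q, K.IsSquare Q ∧ ∃ t ∈ Ioo (0 : ℝ) 1, Q t s = x ∧ coord (Q 0) = coord E := by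
  have hsm : s ∈ Icc (0 : ℝ) 1 := ⟨hs.1.le, hs.2.le⟩
  have m0 : (0 : ℝ) ∈ Icc (0 : ℝ) 1 := by simp
  have m1 : (1 : ℝ) ∈ Icc (0 : ℝ) 1 := by simp
  obtain ⟨n, hn⟩ := exists_nat_ge (dist x (E s))
  induction n generalizing E with
  | zero =>
    left
    refine ⟨E, hE, ?_, rfl⟩
    rw [eq_comm, ← dist_le_zero]
    simpa using hn
  | succ n ih =>
    rcases eq_or_ne x (E s) with rfl | hne
    · exact Or.inl ⟨E, hE, rfl, rfl⟩
    obtain ⟨Q, hQ, rfl, a, ha, hb⟩ := hE.exists_square_of_isFoot hK hX hs h hne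
    have ham : a ∈ Icc (0 : ℝ) 1 :=
      ⟨ha.1.le, ha.2.trans ((min_le_left _ _).trans hs.2.le)⟩
    have hQ1 : K.IsEdge (Q 1) := by simpa using hQ.flip.isEdge
    -- if `x` lies on this square at height `s`, there is nothing more to show
    by_cases hx : ∃ t ∈ Icc (0 : ℝ) 1, Q t s = x
    · obtain ⟨t, ht, rfl⟩ := hx
      rcases ht.1.eq_or_lt with rfl | h0
      · exact Or.inl ⟨_, hE, rfl, rfl⟩
      rcases ht.2.eq_or_lt with rfl | h1
      · exact Or.inl ⟨_, hQ1, rfl, hQ.coord_eq hK hX m1⟩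
      exact Or.inr ⟨Q, hQ, t, ⟨h0, h1⟩, rfl, rfl⟩
    have hfoot : ∀ t ∈ Icc (0 : ℝ) 1, IsFoot (Q t) x s := fun t ht =>
      hQ.isFoot_const hK hX hs m0 ht h
    -- otherwise the geodesic to `x` traverses the whole square
    obtain ⟨t₀, ht₀, hmin⟩ := (hQ.swap.isSeg hK hX hsm).exists_isFoot x
    have hdec : ∀ t ∈ Icc (0 : ℝ) 1, ∀ t' ∈ Icc (0 : ℝ) 1, t ≠ t' →
        MetricBtw (Q t s) (Q t' s) x → dist x (Q t' s) < dist x (Q t s) := by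
      intro t ht t' ht' hne h
      unfold MetricBtw at h
      rw [hQ.dist_fst hK hX hsm ht ht'] at h
      rw [dist_comm x, dist_comm x]
      have := abs_pos.2 (sub_ne_zero.2 hne)
      linarith
    have ht1 : t₀ = 1 := by
      by_contra h1
      have h1 := lt_of_le_of_ne ht₀.2 h1
      rcases ht₀.1.eq_or_lt with rfl | h0
      · have := hdec 0 m0 a ham ha.1.ne hb
        linarith [hmin a ham]
      · obtain ⟨t', ht', hne', hb'⟩ := hQ.exists_btw_of_isFoot hK hX hs ⟨h0, h1⟩ (hfoot t₀ ht₀)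
          (fun h => hx ⟨t₀, ht₀, h.symm⟩)
        have := hdec t₀ ht₀ t' ht' hne'.symm hb'
        linarith [hmin t' ht']
    subst ht1
    obtain ⟨Q', hQ', h0', a', ha', hb'⟩ := hQ1.exists_square_of_isFoot hK hX hs (hfoot 1 m1)
      (fun h => hx ⟨1, m1, h.symm⟩)
    have ham' : a' ∈ Icc (0 : ℝ) 1 :=
      ⟨ha'.1.le, ha'.2.trans ((min_le_left _ _).trans hs.2.le)⟩
    have hdist : dist (Q 1 s) (Q' a' s) = a' := by
      rw [← h0', hQ'.dist_fst hK hX hsm m0 ham', zero_sub, abs_neg, abs_of_pos ha'.1]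
    rcases hQ.flip.eq_or_add_le_dist hK hQ' (by simpa using h0'.symm) with heq | hsep
    · exfalso
      have : Q' a' s = Q (1 - a') s := by rw [← heq]
      rw [this] at hb'
      have := hdec 1 m1 (1 - a') (one_sub_mem ham') (by linarith [ha'.1]) hb'
      linarith [hmin _ (one_sub_mem ham')]
    · have hρ : 0 < min s (1 - s) := lt_min hs.1 (by linarith [hs.2])
      have hρ1 : min s (1 - s) ≤ 1 := (min_le_left _ _).trans hs.2.le
      have key : MetricBtw (Q 0 s) (Q 1 s) x := by
        refine hQ.btw_backward hK hX hsm m1 (t₁ := 1 - min s (1 - s))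
          (one_sub_mem ⟨hρ.le, hρ1⟩) m0 hb' ?_ ?_ ?_
        · intro h1
          rw [h1, dist_self] at hdist
          linarith [ha'.1]
        · rw [hdist, sub_sub_cancel, abs_of_pos hρ, dist_comm, add_comm]
          exact hsep s hs _ ⟨hρ.le, le_rfl⟩ a' ⟨ha'.1.le, ha'.2⟩
        · nlinarith
      have hlen : dist x (Q 1 s) ≤ n := by
        unfold MetricBtw at key
        rw [hQ.dist_fst hK hX hsm m0 m1, dist_comm _ x, dist_comm _ x] at key
        push_cast at hn
        norm_num at key
        linarith
      have := ih hQ1 (hfoot 1 m1) hlen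
      rwa [hQ.coord_eq hK hX m1] at this

end Walls

end SquareComplex

namespace SquareComplex

/-! ### Families of functions -/

theorem sum_abs_sub_le_of_card {Y : Type*} {T C : Finset (Y → ℝ)} (hC : C.card ≤ 4) {x y : Y}
    {d : ℝ} (hd : 0 ≤ d) (h1 : ∀ f ∈ T, |f x - f y| ≤ d) (h2 : ∀ f ∈ T, f ∉ C → f x = f y) :
    ∑ f ∈ T, |f x - f y| ≤ 4 * d := by
  classical
  have e1 : ∑ f ∈ T, |f x - f y| = ∑ f ∈ T.filter (· ∈ C), |f x - f y| := by
    symm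
    apply Finset.sum_subset (Finset.filter_subset _ _)
    intro f hf hf'
    rw [Finset.mem_filter, not_and] at hf'
    rw [h2 f hf (hf' hf), sub_self, abs_zero]
  have e2 : (T.filter (· ∈ C)).card ≤ 4 :=
    (Finset.card_le_card fun f hf => (Finset.mem_filter.1 hf).2).trans hC
  rw [e1]
  refine (Finset.sum_le_card_nsmul _ _ d fun f hf => h1 f (Finset.mem_filter.1 hf).1).trans ?_
  rw [nsmul_eq_mul]
  have : ((T.filter (· ∈ C)).card : ℝ) ≤ 4 := by exact_mod_cast e2
  gcongr

/-- `WallLT f h` says that the halfspace `h > 0` is contained in the halfspace `f = 1`: on the way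
from the side `0` to the side `1`, the wall `f` comes before `h`. -/
def WallLT {Y : Type*} (f h : Y → ℝ) : Prop := ∀ z, h z = 0 ∨ f z = 1

/-- Two walls cross if the interiors of their carriers meet. -/
def Cross {Y : Type*} (f h : Y → ℝ) : Prop := ∃ z, f z ∈ Ioo (0 : ℝ) 1 ∧ h z ∈ Ioo (0 : ℝ) 1

theorem WallLT.trans {Y : Type*} {f k h : Y → ℝ} (h1 : WallLT f k) (h2 : WallLT k h) :
    WallLT f h := by
  intro z
  rcases h2 z with h | h
  · exact Or.inl h
  · rcases h1 z with h' | h'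
    · rw [h'] at h; norm_num at h
    · exact Or.inr h'

section WallTheory

variable {X : Type u} [MetricSpace X] {K : SquareComplex.{u, v} X}

/-- The walls of the complex, that is, its hyperplanes with a choice of side, encoded as functions
`X → [0, 1]`: the wall that is dual to the oriented edge `E` is the projection to `E`. Its two
halfspaces are the sets on which the function is `0` and `1`. -/
def IsWall (K : SquareComplex.{u, v} X) (f : X → ℝ) : Prop := ∃ E, K.IsEdge E ∧ f = coord E

theorem IsEdge.isWall {E : ℝ → X} (hE : K.IsEdge E) : K.IsWall (coord E) := ⟨E, hE, rfl⟩

theorem IsEdge.coord_flip (hK : K.IsIntrinsicMetric) (hX : IsCAT0 X) {E : ℝ → X}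
    (hE : K.IsEdge E) : coord (fun s => E (1 - s)) = fun x => 1 - coord E x :=
  funext fun x => (hE.isSeg hK).coord_flip hX x

theorem IsWall.flip (hK : K.IsIntrinsicMetric) (hX : IsCAT0 X) {f : X → ℝ} (hf : K.IsWall f) :
    K.IsWall fun x => 1 - f x := by
  obtain ⟨E, hE, rfl⟩ := hf
  exact ⟨_, hE.flip, (hE.coord_flip hK hX).symm⟩

theorem IsWall.mem_Icc (hK : K.IsIntrinsicMetric) {f : X → ℝ} (hf : K.IsWall f) (x : X) :
    f x ∈ Icc (0 : ℝ) 1 := by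
  obtain ⟨E, hE, rfl⟩ := hf
  exact (hE.isSeg hK).coord_mem x

theorem IsWall.abs_sub_le (hK : K.IsIntrinsicMetric) (hX : IsCAT0 X) {f : X → ℝ}
    (hf : K.IsWall f) (x y : X) : |f x - f y| ≤ dist x y := by
  obtain ⟨E, hE, rfl⟩ := hf
  exact (hE.isSeg hK).abs_coord_sub_le hX x y

theorem IsWall.continuous (hK : K.IsIntrinsicMetric) (hX : IsCAT0 X) {f : X → ℝ}
    (hf : K.IsWall f) : Continuous f := by
  obtain ⟨E, hE, rfl⟩ := hf
  exact (hE.isSeg hK).continuous_coord hX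

theorem IsWall.exists_eq_half (hK : K.IsIntrinsicMetric) (hX : IsCAT0 X) {f : X → ℝ}
    (hf : K.IsWall f) : ∃ x, f x = 1 / 2 := by
  obtain ⟨E, hE, rfl⟩ := hf
  exact ⟨E (1 / 2), (hE.isSeg hK).coord_self hX (by norm_num)⟩

theorem IsWall.exists_parallel (hK : K.IsIntrinsicMetric) (hX : IsCAT0 X) {f : X → ℝ}
    (hf : K.IsWall f) {x : X} (hs : f x ∈ Ioo (0 : ℝ) 1) :
    (∃ E, K.IsEdge E ∧ E (f x) = x ∧ f = coord E) ∨
      ∃ Q, K.IsSquare Q ∧ ∃ t ∈ Ioo (0 : ℝ) 1, Q t (f x) = x ∧ f = coord (Q 0) := by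
  obtain ⟨E, hE, rfl⟩ := hf
  rcases hE.exists_parallel hK hX hs ((hE.isSeg hK).isFoot_coord x) with
    ⟨E', h1, h2, h3⟩ | ⟨Q, h1, t, ht, h2, h3⟩
  · exact Or.inl ⟨E', h1, h2, h3.symm⟩
  · exact Or.inr ⟨Q, h1, t, ht, h2, h3.symm⟩

theorem IsSquare.coord_apply (hK : K.IsIntrinsicMetric) (hX : IsCAT0 X) {Q : ℝ → ℝ → X}
    (hQ : K.IsSquare Q) {a b : ℝ} (ha : a ∈ Icc (0 : ℝ) 1) (hb : b ∈ Icc (0 : ℝ) 1) :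
    coord (Q 0) (Q a b) = b := by
  rw [← hQ.coord_eq hK hX ha]
  exact (hQ.isSeg hK hX ha).coord_self hX hb

/-- Continuous functions have the intermediate value property along geodesics. -/
theorem exists_btw_eq (hX : IsCAT0 X) {f : X → ℝ} (hf : Continuous f) {x y : X} {v : ℝ}
    (h1 : f x ≤ v) (h2 : v ≤ f y) : ∃ z, MetricBtw x z y ∧ f z = v := by
  obtain ⟨γ, hγ⟩ := hX.1 x y
  have hc : ContinuousOn γ (Icc 0 1) := by
    have : LipschitzOnWith ⟨dist x y, dist_nonneg⟩ γ (Icc 0 1) :=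
      LipschitzOnWith.of_dist_le_mul fun s hs t ht => by
        rw [hγ.2.2 s hs t ht, mul_comm]; rfl
    exact this.continuousOn
  have := intermediate_value_Icc (zero_le_one' ℝ) (hf.comp_continuousOn hc)
  simp only [Function.comp, hγ.1, hγ.2.1] at this
  obtain ⟨t, ht, h⟩ := this ⟨h1, h2⟩
  refine ⟨γ t, ?_, h⟩
  unfold MetricBtw
  rw [hγ.dist_left ht, hγ.dist_right ht]
  ring

/-- The level sets of a wall are convex. -/
theorem IsWall.level_convex (hK : K.IsIntrinsicMetric) (hX : IsCAT0 X) {f : X → ℝ}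
    (hf : K.IsWall f) {p q m : X} {s : ℝ} (hs : s ∈ Ioo (0 : ℝ) 1) (hp : f p = s) (hq : f q = s)
    (hm : MetricBtw p m q) : f m = s := by
  have main : ∀ γ : ℝ → X, IsSeg γ → γ s = p → f = coord γ → f m = s := by
    intro γ hγ h1 h2
    have h3 := hγ.isFoot_coord q
    rw [← h2, hq] at h3
    rw [h2]
    exact (h3.of_btw (h1 ▸ hm)).coord_eq hX hγ
  subst hp
  rcases hf.exists_parallel hK hX hs with ⟨E, hE, h1, h2⟩ | ⟨Q, hQ, t, ht, h1, h2⟩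
  · exact main E (hE.isSeg hK) h1 h2
  · have htm : t ∈ Icc (0 : ℝ) 1 := ⟨ht.1.le, ht.2.le⟩
    exact main (Q t) (hQ.isSeg hK hX htm) h1 (by rw [h2, hQ.coord_eq hK hX htm])

/-- The halfspaces are convex: a wall is monotone along geodesics. -/
theorem IsWall.le_max (hK : K.IsIntrinsicMetric) (hX : IsCAT0 X) {f : X → ℝ}
    (hf : K.IsWall f) {x y z : X} (h : MetricBtw x z y) : f z ≤ max (f x) (f y) := by
  by_contra hlt
  push Not at hlt
  obtain ⟨s, hs1, hs2⟩ := exists_between hlt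
  obtain ⟨hx, hy⟩ := max_lt_iff.1 hs1
  have hs : s ∈ Ioo (0 : ℝ) 1 :=
    ⟨(hf.mem_Icc hK x).1.trans_lt hx, hs2.trans_le (hf.mem_Icc hK z).2⟩
  obtain ⟨p, hp, hps⟩ := exists_btw_eq hX (hf.continuous hK hX) hx.le hs2.le
  obtain ⟨q, hq, hqs⟩ := exists_btw_eq hX (hf.continuous hK hX) hy.le hs2.le
  have : MetricBtw p z q := by
    have h1 := dist_triangle p q y
    have h2 := dist_triangle x p y
    have h3 := dist_triangle p z q
    unfold MetricBtw at *
    rw [dist_comm y q, dist_comm q z, dist_comm y z] at hq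
    linarith
  have := hf.level_convex hK hX hs hps hqs this
  linarith

theorem IsWall.min_le (hK : K.IsIntrinsicMetric) (hX : IsCAT0 X) {f : X → ℝ}
    (hf : K.IsWall f) {x y z : X} (h : MetricBtw x z y) : min (f x) (f y) ≤ f z := by
  have := (hf.flip hK hX).le_max hK hX h
  rcases min_cases (f x) (f y) with h1 | h1 <;>
    rcases max_cases (1 - f x) (1 - f y) with h2 | h2 <;>
    linarith [h1.1, h1.2, h2.1, h2.2]

/-! ### Walls and cells -/

/-- The walls that are dual to the sides of the square `Q`. -/
def squareWalls (Q : ℝ → ℝ → X) : Set (X → ℝ) :=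
  {coord (Q 0), fun x => 1 - coord (Q 0) x, coord (fun a => Q a 0),
    fun x => 1 - coord (fun a => Q a 0) x}

theorem IsSquareOf.squareWalls_eq (hK : K.IsIntrinsicMetric) (hX : IsCAT0 X) {c : K.Cell}
    {Q : ℝ → ℝ → X} (hQ : K.IsSquareOf c Q) : squareWalls Q = squareWalls (K.squareMap c) := by
  induction hQ with
  | std _ => rfl
  | swap Q hQ ih =>
    rw [← ih]
    have : (fun b => Q 0 b) = Q 0 := rfl
    ext f
    simp only [squareWalls, mem_insert_iff, mem_singleton_iff, this]
    tauto
  | flip Q hQ ih =>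
    rw [← ih]
    have h1 : coord ((fun a b => Q (1 - a) b) 0) = coord (Q 0) := by
      simpa using IsSquare.coord_eq hK hX ⟨c, hQ⟩ (t := 1) (by simp)
    have h2 := IsEdge.coord_flip hK hX (IsSquare.isEdge ⟨c, hQ.swap⟩)
    have h3 : (fun x => 1 - (1 - coord (fun a => Q a 0) x)) = coord fun a => Q a 0 := by
      funext x; ring
    ext f
    simp only [squareWalls, mem_insert_iff, mem_singleton_iff, h1, h2, h3]
    tauto

/-- A wall that has only the values `0` and `1` on a segment is constant on it. -/
theorem IsWall.eq_of_isSeg (hK : K.IsIntrinsicMetric) (hX : IsCAT0 X) {f : X → ℝ}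
    (hf : K.IsWall f) {γ : ℝ → X} (hγ : IsSeg γ)
    (hd : ∀ s ∈ Icc (0 : ℝ) 1, f (γ s) = 0 ∨ f (γ s) = 1) {s : ℝ} (hs : s ∈ Icc (0 : ℝ) 1) :
    f (γ s) = f (γ 0) := by
  have hc : ContinuousOn (fun s => f (γ s)) (Icc 0 1) :=
    (hf.continuous hK hX).comp_continuousOn hγ.continuousOn
  by_contra hne
  have hsub : uIcc (f (γ s)) (f (γ 0)) ⊆ (fun s => f (γ s)) '' Icc 0 1 :=
    (isPreconnected_Icc.image _ hc).ordConnected.uIcc_subset ⟨s, hs, rfl⟩ ⟨0, by simp, rfl⟩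
  have : (1 / 2 : ℝ) ∈ uIcc (f (γ s)) (f (γ 0)) := by
    rw [mem_uIcc]
    rcases hd s hs with h1 | h1 <;> rcases hd 0 (by simp) with h2 | h2
    · exact absurd (h1.trans h2.symm) hne
    · rw [h1, h2]; norm_num
    · rw [h1, h2]; norm_num
    · exact absurd (h1.trans h2.symm) hne
  obtain ⟨u, hu, h⟩ := hsub this
  rcases hd u hu with h1 | h1 <;> simp only [h1] at h <;> norm_num at h

theorem IsWall.const_or_edge (hK : K.IsIntrinsicMetric) (hX : IsCAT0 X) {f : X → ℝ}
    (hf : K.IsWall f) {E : ℝ → X} (hE : K.IsEdge E) :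
    (∃ v, (v = 0 ∨ v = 1) ∧ ∀ s ∈ Icc (0 : ℝ) 1, f (E s) = v) ∨ f = coord E ∨
      f = fun x => 1 - coord E x := by
  by_cases hint : ∃ s ∈ Icc (0 : ℝ) 1, f (E s) ∈ Ioo (0 : ℝ) 1
  · right
    obtain ⟨s, hs, h⟩ := hint
    obtain ⟨c, hEc⟩ := hE
    obtain ⟨P, -, hP⟩ := hEc.exists_param
    rcases hf.exists_parallel hK hX h with ⟨E', ⟨d, hE'⟩, h1, rfl⟩ | ⟨Q, ⟨d, hQ⟩, t, ht, h1, -⟩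
    · obtain rfl := hE'.eq_of_mem h (d := c) (by rw [h1, hP]; exact mem_range_self _) hEc.1.le
      rcases hEc.eq_or_eq_flip hE' with rfl | rfl
      · exact Or.inl rfl
      · exact Or.inr (IsEdge.coord_flip hK hX ⟨_, hEc⟩)
    · obtain rfl := hQ.eq_of_mem ht h (d := c) (by rw [h1, hP]; exact mem_range_self _)
      have := hQ.dim_eq
      rw [hEc.1] at this
      norm_num at this
  · left
    push Not at hint
    have dich : ∀ s ∈ Icc (0 : ℝ) 1, f (E s) = 0 ∨ f (E s) = 1 := by
      intro s hs
      have h1 := hf.mem_Icc hK (E s)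
      by_contra hcon
      push Not at hcon
      exact hint s hs ⟨lt_of_le_of_ne h1.1 (Ne.symm hcon.1), lt_of_le_of_ne h1.2 hcon.2⟩
    exact ⟨f (E 0), dich 0 (by simp), fun s hs => hf.eq_of_isSeg hK hX (hE.isSeg hK) dich hs⟩

/-- On a square, a wall is constant, with value `0` or `1`, unless it is dual to a side. -/
theorem IsWall.const_or_square (hK : K.IsIntrinsicMetric) (hX : IsCAT0 X) {f : X → ℝ}
    (hf : K.IsWall f) {c : K.Cell} {Q : ℝ → ℝ → X} (hQ : K.IsSquareOf c Q) :
    (∃ v, (v = 0 ∨ v = 1) ∧ ∀ a ∈ Icc (0 : ℝ) 1, ∀ b ∈ Icc (0 : ℝ) 1, f (Q a b) = v) ∨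
      f ∈ squareWalls Q := by
  by_cases hint : ∃ a ∈ Icc (0 : ℝ) 1, ∃ b ∈ Icc (0 : ℝ) 1, f (Q a b) ∈ Ioo (0 : ℝ) 1
  · right
    obtain ⟨a, ha, b, hb, h⟩ := hint
    obtain ⟨P, -, hP⟩ := hQ.exists_param
    rw [hQ.squareWalls_eq hK hX]
    rcases hf.exists_parallel hK hX h with ⟨E, hE, h1, rfl⟩ | ⟨Q', ⟨d, hQ'⟩, t, ht, h1, rfl⟩
    · obtain ⟨Q', hQ', h0⟩ := hE.exists_side h hQ.dim_eq (by rw [h1, hP]; exact mem_range_self _)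
      rw [← hQ'.squareWalls_eq hK hX, ← h0]
      exact Or.inl rfl
    · obtain rfl := hQ'.eq_of_mem ht h (d := c) (by rw [h1, hP]; exact mem_range_self _)
      rw [← hQ'.squareWalls_eq hK hX]
      exact Or.inl rfl
  · left
    push Not at hint
    have dich : ∀ a ∈ Icc (0 : ℝ) 1, ∀ b ∈ Icc (0 : ℝ) 1, f (Q a b) = 0 ∨ f (Q a b) = 1 := by
      intro a ha b hb
      have h1 := hf.mem_Icc hK (Q a b)
      by_contra hcon
      push Not at hcon
      exact hint a ha b hb ⟨lt_of_le_of_ne h1.1 (Ne.symm hcon.1), lt_of_le_of_ne h1.2 hcon.2⟩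
    have m0 : (0 : ℝ) ∈ Icc (0 : ℝ) 1 := by simp
    have hQ' : K.IsSquare Q := ⟨c, hQ⟩
    refine ⟨f (Q 0 0), dich 0 m0 0 m0, fun a ha b hb => ?_⟩
    rw [hf.eq_of_isSeg hK hX (hQ'.isSeg hK hX ha) (dich a ha) hb]
    exact hf.eq_of_isSeg hK hX (hQ'.swap.isSeg hK hX m0) (fun a ha => dich a ha 0 m0) ha

theorem IsWall.eq_of_isVertex (hK : K.IsIntrinsicMetric) (hX : IsCAT0 X) {f : X → ℝ}
    (hf : K.IsWall f) {x : X} (hx : K.IsVertex x) : f x = 0 ∨ f x = 1 := by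
  have h1 := hf.mem_Icc hK x
  by_contra hcon
  push Not at hcon
  have hs : f x ∈ Ioo (0 : ℝ) 1 :=
    ⟨lt_of_le_of_ne h1.1 (Ne.symm hcon.1), lt_of_le_of_ne h1.2 hcon.2⟩
  rcases hf.exists_parallel hK hX hs with ⟨E, ⟨c, hE⟩, h1, -⟩ | ⟨Q, ⟨c, hQ⟩, t, ht, h1, -⟩
  · obtain ⟨P, hP, hE'⟩ := hE.exists_param
    rw [hE'] at h1
    rcases (hP.end_iff ⟨hs.1.le, hs.2.le⟩).1 (fun i => hx.corner h1 i) with h | h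
    exacts [hcon.1 h, hcon.2 h]
  · obtain ⟨P, hP, hQ'⟩ := hQ.exists_param
    rw [hQ'] at h1
    rcases ((hP.corner_iff ⟨ht.1.le, ht.2.le⟩ ⟨hs.1.le, hs.2.le⟩).1
      (fun i => hx.corner h1 i)).2 with h | h
    exacts [hcon.1 h, hcon.2 h]

/-- The number of walls that separate two points is at most a multiple of their distance: at most
two hyperplanes, that is, four walls, meet the interior of a given cell. -/
theorem IsIntrinsicMetric.sum_abs_sub_le (hK : K.IsIntrinsicMetric) (hX : IsCAT0 X)
    {T : Finset (X → ℝ)} (hT : ∀ f ∈ T, K.IsWall f) (x y : X) :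
    ∑ f ∈ T, |f x - f y| ≤ 4 * dist x y := by
  classical
  refine hK.le_mul_dist (Φ := fun x y => ∑ f ∈ T, |f x - f y|) (by norm_num) (by simp) ?_ ?_ x y
  · intro x y z
    rw [← Finset.sum_add_distrib]
    exact Finset.sum_le_sum fun f _ => abs_sub_le _ _ _
  · intro c p q
    have hlip : ∀ f ∈ T, |f (K.chart c p) - f (K.chart c q)| ≤ dist p q := fun f hf =>
      ((hT f hf).abs_sub_le hK hX _ _).trans (hK.dist_chart_le c p q)
    have h2 := K.dim_le_two c
    obtain h0 | h1 | h2 : K.dim c = 0 ∨ K.dim c = 1 ∨ K.dim c = 2 := by omega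
    · obtain rfl : p = q := cube_ext fun i => (Fin.cast h0 i).elim0
      simp
    · have hE : K.IsEdgeOf c (K.edgeMap c) := ⟨h1, Or.inl rfl⟩
      refine sum_abs_sub_le_of_card
        (C := {coord (K.edgeMap c), fun x => 1 - coord (K.edgeMap c) x})
        (Finset.card_le_two.trans (by norm_num)) dist_nonneg hlip fun f hf hfC => ?_
      obtain ⟨s, hs, hp⟩ := hE.surj p
      obtain ⟨t, ht, hq⟩ := hE.surj q
      rw [← hp, ← hq]
      rcases (hT f hf).const_or_edge hK hX ⟨c, hE⟩ with ⟨v, -, h⟩ | h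
      · rw [h s hs, h t ht]
      · exact absurd (by simpa using h) hfC
    · have hQ : K.IsSquareOf c (K.squareMap c) := .std h2
      refine sum_abs_sub_le_of_card (C := {coord (K.squareMap c 0),
        fun x => 1 - coord (K.squareMap c 0) x, coord (fun a => K.squareMap c a 0),
        fun x => 1 - coord (fun a => K.squareMap c a 0) x})
        Finset.card_le_four dist_nonneg hlip fun f hf hfC => ?_
      obtain ⟨a, ha, b, hb, hp⟩ := hQ.surj p
      obtain ⟨a', ha', b', hb', hq⟩ := hQ.surj q
      rw [← hp, ← hq]
      rcases (hT f hf).const_or_square hK hX hQ with ⟨v, -, h⟩ | h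
      · rw [h a ha b hb, h a' ha' b' hb']
      · exact absurd (by simpa [squareWalls] using h) hfC

/-! ### Crossing and nested walls -/

theorem IsWall.not_wallLT_self (hK : K.IsIntrinsicMetric) (hX : IsCAT0 X) {f : X → ℝ}
    (hf : K.IsWall f) : ¬ WallLT f f := by
  intro h
  obtain ⟨x, hx⟩ := hf.exists_eq_half hK hX
  rcases h x with h | h <;> rw [hx] at h <;> norm_num at h

/-- If the interiors of the carriers of two walls meet, then the walls are equal up to orientation,
or they are dual to two adjacent sides of a square. -/
theorem IsWall.exists_square_of_mem (hK : K.IsIntrinsicMetric) (hX : IsCAT0 X) {f h : X → ℝ}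
    (hf : K.IsWall f) (hh : K.IsWall h) {z : X} (h1 : f z ∈ Ioo (0 : ℝ) 1)
    (h2 : h z ∈ Ioo (0 : ℝ) 1) :
    h = f ∨ (h = fun x => 1 - f x) ∨
      ∃ Q, K.IsSquare Q ∧ f = coord (Q 0) ∧ h = coord fun a => Q a 0 := by
  have ne : ∀ v : ℝ, v = 0 ∨ v = 1 → h z ≠ v := by
    rintro v (rfl | rfl) h0 <;> rw [h0] at h2 <;> simp at h2
  have m1 : f z ∈ Icc (0 : ℝ) 1 := ⟨h1.1.le, h1.2.le⟩
  rcases hf.exists_parallel hK hX h1 with ⟨E, hE, e1, rfl⟩ | ⟨Q, hQ, t, ht, e1, rfl⟩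
  · rcases hh.const_or_edge hK hX hE with ⟨v, hv, hc⟩ | rfl | rfl
    · exact absurd (by rw [← hc _ m1, e1]) (ne v hv)
    · exact Or.inl rfl
    · exact Or.inr (Or.inl rfl)
  · obtain ⟨c, hQc⟩ := id hQ
    rcases hh.const_or_square hK hX hQc with ⟨v, hv, hc⟩ | hmem
    · exact absurd (by rw [← hc t ⟨ht.1.le, ht.2.le⟩ _ m1, e1]) (ne v hv)
    · rcases hmem with rfl | rfl | rfl | hmem
      · exact Or.inl rfl
      · exact Or.inr (Or.inl rfl)
      · exact Or.inr (Or.inr ⟨Q, hQ, rfl, rfl⟩)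
      · right; right
        refine ⟨_, hQ.flip, ?_, ?_⟩
        · simpa using (hQ.coord_eq hK hX (t := 1) (by simp)).symm
        · rw [hmem]
          exact (hQ.swap.isEdge.coord_flip hK hX).symm

/-- Two walls that separate `x` from `y` are nested or cross. -/
theorem IsWall.trichotomy (hK : K.IsIntrinsicMetric) (hX : IsCAT0 X) {f h : X → ℝ}
    (hf : K.IsWall f) (hh : K.IsWall h) {x y : X} (hfx : f x = 0) (hfy : f y = 1)
    (hhx : h x = 0) (hhy : h y = 1) : WallLT f h ∨ WallLT h f ∨ Cross f h := by
  by_cases hc : Cross f h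
  · exact Or.inr (Or.inr hc)
  -- `h` is constant on the carrier of `f`, which is convex
  have dich : ∀ z, f z ∈ Ioo (0 : ℝ) 1 → h z = 0 ∨ h z = 1 := by
    intro z hz
    have h1 := hh.mem_Icc hK z
    by_contra hcon
    push Not at hcon
    exact hc ⟨z, hz, lt_of_le_of_ne h1.1 (Ne.symm hcon.1), lt_of_le_of_ne h1.2 hcon.2⟩
  have conv : ∀ p q z, f p ∈ Ioo (0 : ℝ) 1 → f q ∈ Ioo (0 : ℝ) 1 → MetricBtw p z q →
      f z ∈ Ioo (0 : ℝ) 1 := by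
    intro p q z hp hq hz
    exact ⟨(lt_min hp.1 hq.1).trans_le (hf.min_le hK hX hz),
      (hf.le_max hK hX hz).trans_lt (max_lt hp.2 hq.2)⟩
  have const : ∀ p q, f p ∈ Ioo (0 : ℝ) 1 → f q ∈ Ioo (0 : ℝ) 1 → h p = 0 → h q = 1 → False := by
    intro p q hp hq h0 h1
    obtain ⟨z, hz, hz'⟩ := exists_btw_eq hX (hh.continuous hK hX) (x := p) (y := q) (v := 1 / 2)
      (by rw [h0]; norm_num) (by rw [h1]; norm_num)
    rcases dich z (conv p q z hp hq hz) with h | h <;> rw [hz'] at h <;> norm_num at h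
  obtain ⟨m, hm⟩ := hf.exists_eq_half hK hX
  have hm' : f m ∈ Ioo (0 : ℝ) 1 := by rw [hm]; norm_num
  rcases dich m hm' with h0 | h1
  · left
    have hzero : ∀ z, f z ∈ Ioo (0 : ℝ) 1 → h z = 0 := fun z hz =>
      (dich z hz).resolve_right fun h1 => const m z hm' hz h0 h1
    intro z
    by_contra hcon
    push Not at hcon
    have hz0 : f z = 0 := by
      have h1 := hf.mem_Icc hK z
      by_contra h2
      exact hcon.1 (hzero z ⟨lt_of_le_of_ne h1.1 (Ne.symm h2), lt_of_le_of_ne h1.2 hcon.2⟩)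
    obtain ⟨w, hw, hw'⟩ := exists_btw_eq hX (hf.continuous hK hX) (x := z) (y := y) (v := 1 / 2)
      (by rw [hz0]; norm_num) (by rw [hfy]; norm_num)
    have h3 := hh.min_le hK hX hw
    rw [hhy, min_eq_left (hh.mem_Icc hK z).2, hzero w (by rw [hw']; norm_num)] at h3
    exact hcon.1 (le_antisymm h3 (hh.mem_Icc hK z).1)
  · right; left
    have hone : ∀ z, f z ∈ Ioo (0 : ℝ) 1 → h z = 1 := fun z hz =>
      (dich z hz).resolve_left fun h0 => const z m hz hm' h0 h1
    intro z
    by_contra hcon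
    push Not at hcon
    have hz1 : f z = 1 := by
      have h1 := hf.mem_Icc hK z
      by_contra h2
      exact hcon.2 (hone z ⟨lt_of_le_of_ne h1.1 (Ne.symm hcon.1), lt_of_le_of_ne h1.2 h2⟩)
    obtain ⟨w, hw, hw'⟩ := exists_btw_eq hX (hf.continuous hK hX) (x := x) (y := z) (v := 1 / 2)
      (by rw [hfx]; norm_num) (by rw [hz1]; norm_num)
    have h3 := hh.le_max hK hX hw
    rw [hhx, max_eq_right (hh.mem_Icc hK z).1, hone w (by rw [hw']; norm_num)] at h3
    exact hcon.2 (le_antisymm (hh.mem_Icc hK z).2 h3)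

/-- Hyperplanes cross at a right angle. -/
theorem IsSquare.pythagoras_center (hK : K.IsIntrinsicMetric) (hX : IsCAT0 X) {Q : ℝ → ℝ → X}
    (hQ : K.IsSquare Q) {p q : X} (hp : coord (Q 0) p = 1 / 2)
    (hq : coord (fun a => Q a 0) q = 1 / 2) :
    dist (Q (1 / 2) (1 / 2)) p ^ 2 + dist (Q (1 / 2) (1 / 2)) q ^ 2 ≤ dist p q ^ 2 := by
  have m : (1 / 2 : ℝ) ∈ Ioo (0 : ℝ) 1 := by norm_num
  have m' : (1 / 2 : ℝ) ∈ Icc (0 : ℝ) 1 := by norm_num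
  have h1 : IsFoot (Q (1 / 2)) p (1 / 2) := by
    have := (hQ.isSeg hK hX m').isFoot_coord p
    rwa [hQ.coord_eq hK hX m', hp] at this
  have h2 : IsFoot (fun a => Q a (1 / 2)) q (1 / 2) := by
    have := (hQ.swap.isSeg hK hX m').isFoot_coord q
    rwa [hQ.swap.coord_eq hK hX m', hq] at this
  rcases eq_or_ne p (Q (1 / 2) (1 / 2)) with rfl | hpne
  · simp
  rcases eq_or_ne q (Q (1 / 2) (1 / 2)) with rfl | hqne
  · simp [dist_comm]
  obtain ⟨a, ha, hane, hab⟩ := hQ.exists_btw_of_isFoot hK hX m m h1 hpne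
  obtain ⟨b, hb, hbne, hbb⟩ := hQ.swap.exists_btw_of_isFoot hK hX m m h2 hqne
  have e1 := hQ.dist_sq hK hX m' m' ha m'
  have e2 := hQ.dist_sq hK hX m' m' m' hb
  have e3 := hQ.dist_sq hK hX ha m' m' hb
  refine hX.pythagoras hab hbb ?_ ?_ ?_
  · intro h
    rw [h, dist_self] at e1
    have : (1 / 2 - a) ^ 2 = 0 := by linarith
    exact hane (by linarith [pow_eq_zero_iff (two_ne_zero) |>.1 this])
  · intro h
    rw [show Q (1 / 2) b = Q (1 / 2) (1 / 2) from h, dist_self] at e2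
    have : (1 / 2 - b) ^ 2 = 0 := by linarith
    exact hbne (by linarith [pow_eq_zero_iff (two_ne_zero) |>.1 this])
  · rw [e1, e2, e3]
    apply le_of_eq
    ring

/-- The walls that separate `x` from `y`, oriented from `x` to `y`. -/
def Between (K : SquareComplex.{u, v} X) (x y : X) : Set (X → ℝ) :=
  {f | K.IsWall f ∧ f x = 0 ∧ f y = 1}

theorem exists_square_of_cross (hK : K.IsIntrinsicMetric) (hX : IsCAT0 X) {x y : X} {f h : X → ℝ}
    (hf : f ∈ K.Between x y) (hh : h ∈ K.Between x y) (hne : f ≠ h) (hc : Cross f h) :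
    ∃ Q, K.IsSquare Q ∧ f = coord (Q 0) ∧ h = coord fun a => Q a 0 := by
  obtain ⟨z, h1, h2⟩ := hc
  rcases hf.1.exists_square_of_mem hK hX hh.1 h1 h2 with h | h | h
  · exact absurd h.symm hne
  · have h3 := hh.2.1
    simp only [h, hf.2.1] at h3
    norm_num at h3
  · exact h

/-- As the complex has dimension `2`, there are no three hyperplanes that pairwise cross: they would
form a triangle with three right angles. -/
theorem not_cross_cross_cross (hK : K.IsIntrinsicMetric) (hX : IsCAT0 X) {x y : X}
    {f₁ f₂ f₃ : X → ℝ} (h₁ : f₁ ∈ K.Between x y) (h₂ : f₂ ∈ K.Between x y)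
    (h₃ : f₃ ∈ K.Between x y) (n12 : f₁ ≠ f₂) (n13 : f₁ ≠ f₃) (n23 : f₂ ≠ f₃)
    (c12 : Cross f₁ f₂) (c13 : Cross f₁ f₃) (c23 : Cross f₂ f₃) : False := by
  obtain ⟨Q, hQ, rfl, rfl⟩ := exists_square_of_cross hK hX h₁ h₂ n12 c12
  obtain ⟨Q', hQ', e1, rfl⟩ := exists_square_of_cross hK hX h₁ h₃ n13 c13
  obtain ⟨Q'', hQ'', e2, e3⟩ := exists_square_of_cross hK hX h₂ h₃ n23 c23
  have m : (1 / 2 : ℝ) ∈ Icc (0 : ℝ) 1 := by norm_num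
  have v := fun {Q : ℝ → ℝ → X} (hQ : K.IsSquare Q) => hQ.coord_apply hK hX m m
  have v' := fun {Q : ℝ → ℝ → X} (hQ : K.IsSquare Q) => hQ.swap.coord_apply hK hX m m
  set p12 := Q (1 / 2) (1 / 2)
  set p13 := Q' (1 / 2) (1 / 2)
  set p23 := Q'' (1 / 2) (1 / 2)
  have i1 : dist p12 p13 ^ 2 + dist p12 p23 ^ 2 ≤ dist p13 p23 ^ 2 :=
    hQ.pythagoras_center hK hX (by rw [e1]; exact v hQ') (by rw [e2]; exact v hQ'')
  have i2 : dist p13 p12 ^ 2 + dist p13 p23 ^ 2 ≤ dist p12 p23 ^ 2 :=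
    hQ'.pythagoras_center hK hX (by rw [← e1]; exact v hQ) (by rw [e3]; exact v' hQ'')
  rw [dist_comm p13 p12] at i2
  have i3 : dist p12 p13 ^ 2 = 0 := by nlinarith [sq_nonneg (dist p12 p13)]
  have i4 : p12 = p13 := dist_eq_zero.1 (pow_eq_zero_iff two_ne_zero |>.1 i3)
  have v3 : coord (fun a => Q' a 0) p12 = 1 / 2 := by rw [i4]; exact v' hQ'
  obtain ⟨c, hQc⟩ := id hQ
  have key : ∀ f ∈ K.Between x y, coord (fun a => Q' a 0) ≠ fun x => 1 - f x := by
    intro f hf h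
    have h4 := h₃.2.1
    simp only [h, hf.2.1] at h4
    norm_num at h4
  rcases h₃.1.const_or_square hK hX hQc with ⟨w, hw, hc⟩ | hmem
  · have := hc _ m _ m
    rw [show Q (1 / 2) (1 / 2) = p12 from rfl, v3] at this
    rcases hw with rfl | rfl <;> norm_num at this
  · rcases hmem with h | h | h | h
    · exact n13 h.symm
    · exact key _ h₁ h
    · exact n23 h.symm
    · exact key _ h₂ h

/-! ### Counting the walls between two vertices -/

theorem Between.card_le (hK : K.IsIntrinsicMetric) (hX : IsCAT0 X) {x y : X}
    {T : Finset (X → ℝ)} (hT : ↑T ⊆ K.Between x y) : (T.card : ℝ) ≤ 4 * dist x y := by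
  have h1 := hK.sum_abs_sub_le hX (T := T) (fun f hf => (hT hf).1) x y
  have h2 : ∑ f ∈ T, |f x - f y| = ∑ _f ∈ T, (1 : ℝ) := by
    refine Finset.sum_congr rfl fun f hf => ?_
    rw [(hT hf).2.1, (hT hf).2.2]
    norm_num
  rw [h2] at h1
  simpa using h1

theorem Between.finite (hK : K.IsIntrinsicMetric) (hX : IsCAT0 X) (x y : X) :
    (K.Between x y).Finite := by
  by_contra hinf
  obtain ⟨n, hn⟩ := exists_nat_gt (4 * dist x y)
  obtain ⟨T, hT, hc⟩ := Set.Infinite.exists_subset_card_eq hinf n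
  have := Between.card_le hK hX hT
  rw [hc] at this
  linarith

/-- Two distinct vertices `x` and `y` are separated by the hyperplane dual to an edge at `x`. -/
theorem IsVertex.exists_edge (hK : K.IsIntrinsicMetric) (hX : IsCAT0 X) {x y : X}
    (hx : K.IsVertex x) (hy : K.IsVertex y) (hne : x ≠ y) :
    ∃ E, K.IsEdge E ∧ E 0 = x ∧ coord E y = 1 := by
  have hd : 0 < dist x y := dist_pos.2 hne
  obtain ⟨z, hz, hz'⟩ := hX.exists_btw_dist_eq x y (η := min (1 / 2) (dist x y)) (by positivity)
    (min_le_right _ _)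
  have hpos : 0 < dist x z := by rw [hz']; positivity
  have hlt : dist x z < 1 := by rw [hz']; exact (min_le_left _ _).trans_lt (by norm_num)
  have main : ∀ E, K.IsEdge E → E 0 = x → 0 < coord E z → coord E y = 1 := by
    intro E hE h0 hpos
    refine (hE.isWall.eq_of_isVertex hK hX hy).resolve_left fun h1 => ?_
    have := hE.isWall.le_max hK hX hz
    rw [h1, ← h0, (hE.isSeg hK).coord_self hX (by simp), max_self] at this
    linarith
  rcases hx.near hK (dist_pos.1 hpos).symm hlt with
    ⟨E, hE, h0, s, hs, rfl⟩ | ⟨Q, hQ, h0, a, ha, b, hb, rfl⟩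
  · exact ⟨E, hE, h0, main E hE h0
      (by rw [(hE.isSeg hK).coord_self hX ⟨hs.1.le, hs.2⟩]; exact hs.1)⟩
  · exact ⟨Q 0, hQ.isEdge, h0, main _ hQ.isEdge h0
      (by rw [hQ.coord_apply hK hX ha ⟨hb.1.le, hb.2⟩]; exact hb.1)⟩

/-- The distance between two vertices is at most the number of walls that separate them. Indeed,
moving from `x` to its neighbour along a suitable edge removes exactly one of these walls. -/
theorem IsVertex.dist_le_ncard (hK : K.IsIntrinsicMetric) (hX : IsCAT0 X) {x y : X}
    (hx : K.IsVertex x) (hy : K.IsVertex y) : dist x y ≤ (K.Between x y).ncard := by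
  obtain ⟨n, hn⟩ : ∃ n, (K.Between x y).ncard = n := ⟨_, rfl⟩
  induction n generalizing x with
  | zero =>
    rcases eq_or_ne x y with rfl | hne
    · simp
    obtain ⟨E, hE, h0, h1⟩ := hx.exists_edge hK hX hy hne
    rw [Set.ncard_eq_zero (Between.finite hK hX x y)] at hn
    have : coord E ∈ K.Between x y :=
      ⟨hE.isWall, by rw [← h0]; exact (hE.isSeg hK).coord_self hX (by simp), h1⟩
    rw [hn] at this
    exact this.elim
  | succ n ih =>
    rcases eq_or_ne x y with rfl | hne
    · simp
    obtain ⟨E, hE, rfl, h1⟩ := hx.exists_edge hK hX hy hne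
    have m0 : (0 : ℝ) ∈ Icc (0 : ℝ) 1 := by simp
    have m1 : (1 : ℝ) ∈ Icc (0 : ℝ) 1 := by simp
    have e0 := (hE.isSeg hK).coord_self hX m0
    have e1 := (hE.isSeg hK).coord_self hX m1
    have hsub : K.Between (E 1) y = K.Between (E 0) y \ {coord E} := by
      ext f
      constructor
      · rintro ⟨hf, f1, fy⟩
        have hfne : f ≠ coord E := by rintro rfl; rw [e1] at f1; norm_num at f1
        refine ⟨⟨hf, ?_, fy⟩, hfne⟩
        rcases hf.const_or_edge hK hX hE with ⟨v, -, hc⟩ | h | h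
        · rw [hc 0 m0, ← hc 1 m1, f1]
        · exact absurd h hfne
        · rw [h] at fy
          simp only [h1] at fy
          norm_num at fy
      · rintro ⟨⟨hf, f0, fy⟩, hfne⟩
        refine ⟨hf, ?_, fy⟩
        rcases hf.const_or_edge hK hX hE with ⟨v, -, hc⟩ | h | h
        · rw [hc 1 m1, ← hc 0 m0, f0]
        · exact absurd h hfne
        · rw [h] at f0
          simp only [e0] at f0
          norm_num at f0
    have hcard : (K.Between (E 1) y).ncard = n := by
      have hmem : coord E ∈ K.Between (E 0) y := ⟨hE.isWall, e0, h1⟩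
      rw [hsub, Set.ncard_sdiff_singleton_of_mem hmem, hn]
      rfl
    have hv : K.IsVertex (E 1) := by simpa using hE.flip.isVertex
    have h2 := ih hv hcard
    have h3 := dist_triangle (E 0) (E 1) y
    rw [hE.isSeg hK 0 m0 1 m1] at h3
    rw [hcard] at h2
    rw [hn]
    push_cast
    norm_num at h3
    linarith

theorem exists_isVertex_dist_le (hK : K.IsIntrinsicMetric) (x : X) :
    ∃ y, K.IsVertex y ∧ dist x y ≤ 2 := by
  rcases K.exists_vertex_or_edge_or_square x with
    h | ⟨E, hE, s, hs, rfl⟩ | ⟨Q, hQ, a, ha, b, hb, rfl⟩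
  · exact ⟨x, h, by simp⟩
  · refine ⟨E 0, hE.isVertex, ?_⟩
    rw [hE.isSeg hK s ⟨hs.1.le, hs.2.le⟩ 0 (by simp), sub_zero, abs_of_pos hs.1]
    linarith [hs.2]
  · refine ⟨Q 0 0, hQ.isEdge.isVertex, ?_⟩
    refine (hQ.dist_le hK ⟨ha.1.le, ha.2.le⟩ ⟨hb.1.le, hb.2.le⟩ (by simp) (by simp)).trans ?_
    refine (sqrt_sq_add_sq_le _ _).trans ?_
    rw [sub_zero, sub_zero, abs_of_pos ha.1, abs_of_pos hb.1]
    linarith [ha.2, hb.2]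

end WallTheory

end SquareComplex

/-! ### Approximate circumcentres and bounded projections -/

section Coarse

variable {X : Type u} [MetricSpace X]

/-- If a set of isometries preserves a nonempty set of diameter at most `M`, then there are points
that are almost fixed: the points for which the circumradius is almost attained. The image of such a
point `z` under such an isometry is a point `z'` as in the second conjunct. -/
theorem IsCAT0.exists_almost_fixed (hX : IsCAT0 X) {B : Set X} (hB : B.Nonempty) {M : ℝ}
    (hM : ∀ b ∈ B, ∀ b' ∈ B, dist b b' ≤ M) {ε : ℝ} (hε : 0 < ε) :
    ∃ z, (∀ b ∈ B, dist z b ≤ M + 1) ∧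
      ∀ z', (∀ R : ℝ, (∀ b ∈ B, dist z b ^ 2 ≤ R) → ∀ b ∈ B, dist z' b ^ 2 ≤ R) →
        dist z z' < ε := by
  obtain ⟨b₀, hb₀⟩ := hB
  have hM0 : 0 ≤ M := dist_nonneg.trans (hM b₀ hb₀ b₀ hb₀)
  set S : Set ℝ := {R | 0 ≤ R ∧ ∃ z, ∀ b ∈ B, dist z b ^ 2 ≤ R} with hS
  have hbdd : BddBelow S := ⟨0, fun R hR => hR.1⟩
  have hMS : M ^ 2 ∈ S := ⟨by positivity, b₀, fun b hb => by gcongr; exact hM b₀ hb₀ b hb⟩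
  have hle : sInf S ≤ M ^ 2 := csInf_le hbdd hMS
  set ε' := min 1 (ε ^ 2 / 8) with hε'
  have hpos : 0 < ε' := by positivity
  obtain ⟨R, ⟨hR0, z, hz⟩, hR⟩ := exists_lt_of_csInf_lt ⟨_, hMS⟩ (lt_add_of_pos_right (sInf S) hpos)
  refine ⟨z, fun b hb => ?_, fun z' hz' => ?_⟩
  · refine abs_le_of_sq_le_sq' ?_ (by linarith) |>.2
    have := hz b hb
    have : ε' ≤ 1 := min_le_left _ _
    nlinarith
  · have hz2 := hz' R hz
    obtain ⟨m, h1, h2⟩ := hX.exists_point z z' (t := 1 / 2) (by norm_num)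
    have hm : ∀ b ∈ B, dist m b ^ 2 ≤ R - dist z z' ^ 2 / 4 := by
      intro b hb
      have := hX.cn b (by norm_num) h1 h2
      have e1 := hz b hb
      have e2 := hz2 b hb
      rw [dist_comm b m, dist_comm b z, dist_comm b z'] at this
      linarith
    have : sInf S ≤ R - dist z z' ^ 2 / 4 :=
      csInf_le hbdd ⟨(sq_nonneg _).trans (hm b₀ hb₀), m, hm⟩
    have h3 : ε' ≤ ε ^ 2 / 8 := min_le_right _ _
    refine abs_lt_of_sq_lt_sq' ?_ hε.le |>.2
    nlinarith [sq_pos_of_pos hε]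

/-- Two convex sets at distance more than `2 δ` in a hyperbolic space are close only in bounded
regions. -/
theorem dist_le_of_hyperbolic (hX : IsCAT0 X) {δ : ℝ}
    (hδ : ∀ (x y z : X) (α β γ : ℝ → X),
      IsGeodesicFrom α x y → IsGeodesicFrom β y z → IsGeodesicFrom γ x z →
        ∀ s ∈ Icc (0 : ℝ) 1, ∃ t ∈ Icc (0 : ℝ) 1,
          dist (α s) (β t) ≤ δ ∨ dist (α s) (γ t) ≤ δ)
    {A C : Set X} (hA : ∀ p ∈ A, ∀ q ∈ A, ∀ m, MetricBtw p m q → m ∈ A)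
    (hC : ∀ p ∈ C, ∀ q ∈ C, ∀ m, MetricBtw p m q → m ∈ C) {D : ℝ}
    (hD : ∀ a ∈ A, ∀ c ∈ C, D ≤ dist a c) (hlt : 2 * δ < D) {p q p' q' : X} (hp : p ∈ A)
    (hq : q ∈ A) (hp' : p' ∈ C) (hq' : q' ∈ C) (hpp : dist p p' ≤ D + 1)
    (hqq : dist q q' ≤ D + 1) (hδ0 : 0 ≤ δ) : dist p q ≤ 8 * δ + 2 := by
  have thin : ∀ (x y z m : X), MetricBtw x m y →
      ∃ w, dist m w ≤ δ ∧ (MetricBtw y w z ∨ MetricBtw x w z) := by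
    intro x y z m hm
    obtain ⟨α, hα⟩ := hX.1 x y
    obtain ⟨β, hβ⟩ := hX.1 y z
    obtain ⟨γ, hγ⟩ := hX.1 x z
    have hon : ∀ {σ : ℝ → X} {a b : X} {t : ℝ}, IsGeodesicFrom σ a b → t ∈ Icc (0 : ℝ) 1 →
        MetricBtw a (σ t) b := by
      intro σ a b t hσ ht
      unfold MetricBtw
      rw [hσ.dist_left ht, hσ.dist_right ht]
      ring
    obtain ⟨s, hs, hsm⟩ : ∃ s ∈ Icc (0 : ℝ) 1, α s = m := by
      rcases eq_or_ne m x with rfl | hne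
      · exact ⟨0, by simp, hα.1⟩
      · obtain ⟨s, h1, h2, h3, h4⟩ := hm.exists_param hne
        exact ⟨s, ⟨h1.le, h2⟩, hX.eq_of_dist_eq hα ⟨h1.le, h2⟩ h3 h4⟩
    obtain ⟨t, ht, h⟩ := hδ x y z α β γ hα hβ hγ s hs
    rw [hsm] at h
    rcases h with h | h
    · exact ⟨_, h, Or.inl (hon hβ ht)⟩
    · exact ⟨_, h, Or.inr (hon hγ ht)⟩
  obtain ⟨m, h1, h2⟩ := hX.exists_point p q (t := 1 / 2) (by norm_num)
  have hm : MetricBtw p m q := by unfold MetricBtw; rw [h1, h2]; ring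
  have hmA := hA p hp q hq m hm
  -- a point of `[a, a']` that is close to `m` is close to `a`
  have close : ∀ a ∈ A, ∀ a' ∈ C, dist a a' ≤ D + 1 → ∀ w, MetricBtw a w a' →
      dist m w ≤ 2 * δ → dist a m ≤ 4 * δ + 1 := by
    intro a _ a' ha' haa w hw hmw
    have e1 := hD m hmA a' ha'
    have e2 := dist_triangle m w a'
    have e3 := dist_triangle a w m
    unfold MetricBtw at hw
    rw [dist_comm w m] at e3
    linarith
  obtain ⟨w, hw, hw' | hw'⟩ := thin p q q' m hm
  · have := close q hq q' hq' hqq w hw' (by linarith)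
    rw [dist_comm q m] at this
    linarith
  · obtain ⟨w', hw1, hw2 | hw2⟩ := thin p q' p' w hw'
    · have e1 := hD m hmA w' (hC q' hq' p' hp' w' hw2)
      have e2 := dist_triangle m w w'
      linarith
    · have := close p hp p' hp' hpp w' hw2 (by linarith [dist_triangle m w w'])
      linarith

end Coarse

/-! ### Finite posets of width at most two -/

section Poset

variable {α : Type*} {r : α → α → Prop} {W : Finset α}

open Classical in
/-- The number of elements of `W` below `a`. -/
noncomputable def rankIn (r : α → α → Prop) (W : Finset α) (a : α) : ℕ :=
  (W.filter fun b => r b a).card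

theorem rankIn_lt (htr : ∀ a b c, r a b → r b c → r a c) (hirr : ∀ a ∈ W, ¬ r a a) {a b : α}
    (ha : a ∈ W) (h : r a b) : rankIn r W a < rankIn r W b := by
  classical
  apply Finset.card_lt_card
  rw [Finset.ssubset_iff_of_subset]
  · exact ⟨a, by simp [ha, h], by simp [hirr a ha]⟩
  · intro c hc
    simp only [Finset.mem_filter] at hc ⊢
    exact ⟨hc.1, htr _ _ _ hc.2 h⟩

open Classical in
/-- In a poset without antichains of three elements, a rank occurs at most twice. -/
theorem card_rankIn_mem_le (htr : ∀ a b c, r a b → r b c → r a c) (hirr : ∀ a ∈ W, ¬ r a a)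
    (hwidth : ∀ a ∈ W, ∀ b ∈ W, ∀ c ∈ W, a ≠ b → a ≠ c → b ≠ c →
      r a b ∨ r b a ∨ r a c ∨ r c a ∨ r b c ∨ r c b) (I : Finset ℕ) :
    (W.filter fun a => rankIn r W a ∈ I).card ≤ 2 * I.card := by
  refine Finset.card_le_mul_card_image_of_maps_to (f := rankIn r W)
    (fun a ha => (Finset.mem_filter.1 ha).2) 2 fun k _ => ?_
  by_contra hlt
  push Not at hlt
  obtain ⟨a, b, c, ha, hb, hc, hab, hac, hbc⟩ := Finset.two_lt_card_iff.1 hlt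
  simp only [Finset.mem_filter] at ha hb hc
  have lt := fun {a b : α} (ha : a ∈ W) (h : r a b) => rankIn_lt htr hirr ha h
  rcases hwidth a ha.1.1 b hb.1.1 c hc.1.1 hab hac hbc with h | h | h | h | h | h
  · have := lt ha.1.1 h; omega
  · have := lt hb.1.1 h; omega
  · have := lt ha.1.1 h; omega
  · have := lt hc.1.1 h; omega
  · have := lt hb.1.1 h; omega
  · have := lt hc.1.1 h; omega

/-- A rank that is sufficient for the existence of a chain of length `i` of elements of rank greater
than `R`. -/
def chainBound (R : ℕ) : ℕ → ℕ
  | 0 => R + 1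
  | i + 1 => 2 * chainBound R i + 1

theorem lt_chainBound (R i : ℕ) : R < chainBound R i := by
  induction i with
  | zero => simp [chainBound]
  | succ i ih => simp only [chainBound]; omega

/-- In a poset without antichains of three elements, an element `h` of large rank is the top of a
long chain that stays above some `f` whose rank is still large. The corank of `f` is not smaller
than that of `h`. -/
theorem exists_chain (htr : ∀ a b c, r a b → r b c → r a c) (hirr : ∀ a ∈ W, ¬ r a a)
    (hwidth : ∀ a ∈ W, ∀ b ∈ W, ∀ c ∈ W, a ≠ b → a ≠ c → b ≠ c →
      r a b ∨ r b a ∨ r a c ∨ r c a ∨ r b c ∨ r c b) (R i : ℕ) {h : α} (hh : h ∈ W)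
    (hrank : chainBound R i ≤ rankIn r W h) :
    ∃ f ∈ W, R < rankIn r W f ∧ rankIn (flip r) W h ≤ rankIn (flip r) W f ∧ (f = h ∨ r f h) ∧
      ∃ T ⊆ W, T.card = i ∧ ∀ k ∈ T, r f k ∧ (k = h ∨ r k h) := by
  classical
  induction i generalizing h with
  | zero =>
    exact ⟨h, hh, by simpa [chainBound] using hrank, le_rfl, Or.inl rfl, ∅, by simp, rfl, by simp⟩
  | succ i ih =>
    obtain ⟨h', hh', hr, hrank'⟩ : ∃ h' ∈ W, r h' h ∧ chainBound R i ≤ rankIn r W h' := by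
      by_contra hcon
      push Not at hcon
      have hsub : (W.filter fun b => r b h) ⊆
          W.filter fun a => rankIn r W a ∈ Finset.range (chainBound R i) := by
        intro b hb
        simp only [Finset.mem_filter, Finset.mem_range] at hb ⊢
        exact ⟨hb.1, hcon b hb.1 hb.2⟩
      have h1 := (Finset.card_le_card hsub).trans (card_rankIn_mem_le htr hirr hwidth _)
      rw [Finset.card_range] at h1
      have h2 : 2 * chainBound R i + 1 ≤ (W.filter fun b => r b h).card := hrank
      omega
    obtain ⟨f, hf, hfR, hfco, hfh, T, hT, hTc, hTk⟩ := ih hh' hrank'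
    have hfh' : r f h := by
      rcases hfh with rfl | h1
      exacts [hr, htr _ _ _ h1 hr]
    have hTh : ∀ k ∈ T, r k h := fun k hk => by
      rcases (hTk k hk).2 with rfl | h1
      exacts [hr, htr _ _ _ h1 hr]
    refine ⟨f, hf, hfR, le_trans ?_ hfco, Or.inr hfh', insert h T, ?_, ?_, ?_⟩
    · apply Finset.card_le_card
      intro c hc
      exact Finset.mem_filter.2
        ⟨(Finset.mem_filter.1 hc).1, htr _ _ _ hr (Finset.mem_filter.1 hc).2⟩
    · exact Finset.insert_subset hh hT
    · rw [Finset.card_insert_of_notMem fun hmem => hirr h hh (hTh h hmem), hTc]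
    · intro k hk
      rcases Finset.mem_insert.1 hk with rfl | hk
      · exact ⟨hfh', Or.inl rfl⟩
      · exact ⟨(hTk k hk).1, Or.inr (hTh k hk)⟩

end Poset

/-- A set that is covered by the fibres over a finite set has at most as many elements as the bounds
for the fibres allow. -/
theorem encard_le_mul_of_fibers {α β : Type*} {S : Set α} (φ : α → β) {t : Finset β} {N : ℕ}
    (h1 : ∀ a ∈ S, φ a ∈ t) (h2 : ∀ b ∈ t, {a ∈ S | φ a = b}.encard ≤ N) :
    S.encard ≤ (t.card * N : ℕ) := by
  classical
  have key : ∀ t' : Finset β, t' ⊆ t → {a ∈ S | φ a ∈ t'}.encard ≤ (t'.card * N : ℕ) := by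
    intro t'
    induction t' using Finset.induction_on with
    | empty => intro _; simp
    | insert b t' hb ih =>
      intro hsub
      have e : {a ∈ S | φ a ∈ insert b t'} ⊆ {a ∈ S | φ a = b} ∪ {a ∈ S | φ a ∈ t'} := by
        rintro a ⟨ha, hab⟩
        rcases Finset.mem_insert.1 hab with h | h
        exacts [Or.inl ⟨ha, h⟩, Or.inr ⟨ha, h⟩]
      refine (Set.encard_le_encard e).trans ((Set.encard_union_le _ _).trans ?_)
      rw [Finset.card_insert_of_notMem hb, add_mul, one_mul, add_comm, Nat.cast_add]
      exact add_le_add (ih fun x hx => hsub (Finset.mem_insert_of_mem hx))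
        (h2 b (hsub (Finset.mem_insert_self _ _)))
  refine (Set.encard_le_encard fun a ha => ?_).trans (key t subset_rfl)
  exact ⟨ha, h1 a ha⟩

/-! ### Cellular actions -/

namespace SquareComplex

section Action

variable {X : Type u} {K : SquareComplex.{u, v} X} {G : Type w} [Group G] [MulAction G X]

theorem IsCellularAction.hasString (hact : K.IsCellularAction G) (g : G) {x y : X} {l : ℝ}
    (h : K.HasString x y l) : K.HasString (g • x) (g • y) l := by
  induction h with
  | nil x => exact .nil _
  | cons c p q y l _ ih =>
    obtain ⟨d, φ, hφ⟩ := hact g c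
    rw [hφ] at ih ⊢
    rw [← φ.dist_eq]
    exact .cons d _ _ _ _ ih

theorem IsEdge.smul (hact : K.IsCellularAction G) (g : G) {E : ℝ → X} (hE : K.IsEdge E) :
    K.IsEdge fun s => g • E s := by
  obtain ⟨c, hE⟩ := hE
  obtain ⟨P, hP, hE'⟩ := hE.exists_param
  obtain ⟨d, φ, hφ⟩ := hact g c
  refine isEdge_of_isometric (d := d) (γ := fun s => φ (P s)) ?_ ?_ ?_ ?_
  · intro s hs t ht
    rw [φ.dist_eq, hP.dist_eq s hs t ht]
  · intro p
    obtain ⟨s, hs, h⟩ := hP.surj (φ.symm p)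
    exact ⟨s, hs, by rw [h, φ.apply_symm_apply]⟩
  · intro s
    rw [hE', hE', hP.clamp]
  · intro s _
    rw [hE', hφ]

theorem IsVertex.smul (hact : K.IsCellularAction G) (g : G) {x : X} (hx : K.IsVertex x) :
    K.IsVertex (g • x) := by
  obtain ⟨c, hc, p, rfl⟩ := hx
  obtain ⟨d, φ, hφ⟩ := hact g c
  exact ⟨d, by rw [← dim_eq_of_isometryEquiv φ, hc], φ p, (hφ p).symm⟩

/-- The action on functions. -/
def gact (g : G) (f : X → ℝ) : X → ℝ := fun x => f (g⁻¹ • x)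

theorem gact_smul (g : G) (f : X → ℝ) (x : X) : gact g f (g • x) = f x := by
  rw [gact, inv_smul_smul]

theorem gact_mul (g h : G) (f : X → ℝ) : gact (g * h) f = gact g (gact h f) := by
  funext x
  rw [gact, gact, gact, mul_inv_rev, mul_smul]

theorem gact_inv_gact (g : G) (f : X → ℝ) : gact g⁻¹ (gact g f) = f := by
  funext x
  rw [gact, gact, inv_inv, inv_smul_smul]

theorem gact_injective (g : G) : Function.Injective (gact g : (X → ℝ) → X → ℝ) :=
  Function.LeftInverse.injective (gact_inv_gact g)

theorem WallLT.gact (g : G) {f h : X → ℝ} (H : WallLT f h) :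
    WallLT (SquareComplex.gact g f) (SquareComplex.gact g h) := fun z => H (g⁻¹ • z)

variable [MetricSpace X]

theorem IsCellularAction.dist_smul (hact : K.IsCellularAction G) (hK : K.IsIntrinsicMetric)
    (g : G) (x y : X) : dist (g • x) (g • y) = dist x y := by
  have key : ∀ (g : G) (x y : X), dist (g • x) (g • y) ≤ dist x y := fun g x y =>
    (hK x y).2 fun l hl => (hK _ _).1 (hact.hasString g hl)
  refine le_antisymm (key g x y) ?_
  have := key g⁻¹ (g • x) (g • y)
  rwa [inv_smul_smul, inv_smul_smul] at this

theorem IsWall.gact (hact : K.IsCellularAction G) (hK : K.IsIntrinsicMetric) (hX : IsCAT0 X)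
    (g : G) {f : X → ℝ} (hf : K.IsWall f) : K.IsWall (SquareComplex.gact g f) := by
  obtain ⟨E, hE, rfl⟩ := hf
  refine ⟨_, hE.smul hact g, funext fun x => ?_⟩
  have h := (hE.isSeg hK).isFoot_coord (g⁻¹ • x)
  refine (IsFoot.coord_eq hX ((hE.smul hact g).isSeg hK) ⟨h.1, fun t ht => ?_⟩).symm
  have e : ∀ s, dist x (g • E s) = dist (g⁻¹ • x) (E s) := fun s => by
    rw [← hact.dist_smul hK g⁻¹ x, inv_smul_smul]
  rw [e, e]
  exact h.2 t ht

/-- Automorphisms that move a point very little have a common fixed point nearby: a vertex, or the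
centre of an edge or of a square. -/
theorem IsCellularAction.exists_fixed_of_almost_fixed (hact : K.IsCellularAction G)
    (hK : K.IsIntrinsicMetric) (hX : IsCAT0 X) {H : Set G} {z : X}
    (hz : ∀ h ∈ H, dist z (h • z) < 1 / 24) : ∃ p, dist z p ≤ 2 ∧ ∀ h ∈ H, h • p = p := by
  -- points close to `z` are moved by less than the distance `1` between distinct vertices, and
  -- points close to `z` in the interior of an edge or a square do not leave it
  have move : ∀ h ∈ H, ∀ p, dist p (h • p) ≤ 2 * dist z p + dist z (h • z) := by
    intro h _ p
    have h1 := dist_triangle4 p z (h • z) (h • p)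
    rw [hact.dist_smul hK, dist_comm p z] at h1
    linarith
  by_cases hv : ∃ x, K.IsVertex x ∧ dist z x < 1 / 3
  · obtain ⟨x, hx, hzx⟩ := hv
    refine ⟨x, by linarith, fun h hh => ?_⟩
    by_contra hne
    have h1 := hx.one_le_dist hK (hx.smul hact h) (Ne.symm hne)
    linarith [move h hh x, hz h hh]
  push Not at hv
  by_cases he : ∃ E, K.IsEdge E ∧ ∃ s ∈ Icc (0 : ℝ) 1, dist z (E s) < 1 / 12
  · obtain ⟨E, hE, s, hs, hzs⟩ := he
    have m0 : (0 : ℝ) ∈ Icc (0 : ℝ) 1 := by simp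
    have m1 : (1 : ℝ) ∈ Icc (0 : ℝ) 1 := by simp
    have hs0 : 1 / 4 < s := by
      have h1 := hv _ hE.isVertex
      have h2 := dist_triangle z (E s) (E 0)
      rw [hE.isSeg hK s hs 0 m0, sub_zero, abs_of_nonneg hs.1] at h2
      linarith
    have hs1 : s < 3 / 4 := by
      have h1 := hv (E 1) (by simpa using hE.flip.isVertex)
      have h2 := dist_triangle z (E s) (E 1)
      rw [hE.isSeg hK s hs 1 m1, abs_sub_comm, abs_of_nonneg (by linarith [hs.2])] at h2
      linarith
    have hsI : s ∈ Ioo (0 : ℝ) 1 := ⟨by linarith, by linarith⟩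
    have hhalf : E (1 - 1 / 2) = E (1 / 2) := by norm_num
    refine ⟨E (1 / 2), ?_, fun h hh => ?_⟩
    · have h2 := dist_triangle z (E s) (E (1 / 2))
      rw [hE.isSeg hK s hs (1 / 2) (by norm_num)] at h2
      have h3 : |s - 1 / 2| ≤ 1 := by rw [abs_le]; constructor <;> linarith
      linarith
    · have hmv : dist (E s) (h • E s) < 5 / 24 := by linarith [move h hh (E s), hz h hh]
      obtain ⟨c, hEc⟩ := id hE
      obtain ⟨c', hE'⟩ := hE.smul hact h
      obtain ⟨P', hP', hEP'⟩ := hE'.exists_param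
      -- it suffices to find `h • E s` in the interior of `E`
      have fin : ∀ b ∈ Icc (0 : ℝ) 1, E b = h • E s → h • E (1 / 2) = E (1 / 2) := by
        intro b hb hEb
        have hd := hE.isSeg hK s hs b hb
        rw [hEb] at hd
        rw [hd, abs_lt] at hmv
        obtain rfl := hEc.eq_of_mem (s := b) (d := c')
          ⟨by linarith [hmv.1, hmv.2], by linarith [hmv.1, hmv.2]⟩
          (by rw [hEb, hEP']; exact mem_range_self _)
          hE'.1.le
        rcases hEc.eq_or_eq_flip hE' with h1 | h1
        · exact congrFun h1 (1 / 2)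
        · rw [show h • E (1 / 2) = (fun s => h • E s) (1 / 2) from rfl, h1]
          exact hhalf
      have hlt : dist (E s) (h • E s) < min s (1 - s) :=
        hmv.trans (lt_min (by linarith) (by linarith))
      rcases hE.near hK hsI hlt with ⟨b, hb, h1⟩ | ⟨Q, ⟨d, hQ⟩, rfl, a, ha, b, hb, h1⟩
      · exact fin b hb h1
      · have hd := IsSquare.dist_sq hK hX ⟨d, hQ⟩ m0 hs ha hb
        rw [h1] at hd
        have hsq : dist (Q 0 s) (h • Q 0 s) ^ 2 < (5 / 24) ^ 2 := by gcongr
        rw [hd] at hsq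
        have hb' : |s - b| < 5 / 24 := abs_lt_of_sq_lt_sq (by nlinarith) (by norm_num)
        have ha' : |0 - a| < 5 / 24 := abs_lt_of_sq_lt_sq (by nlinarith) (by norm_num)
        rw [abs_lt] at hb' ha'
        rcases ha.1.eq_or_lt with rfl | hpos
        · exact fin b hb h1
        · exfalso
          obtain rfl := hQ.eq_of_mem (a := a) (b := b) (d := c') ⟨hpos, by linarith [ha'.1]⟩
            ⟨by linarith [hb'.1, hb'.2], by linarith [hb'.1, hb'.2]⟩
            (by rw [h1, hEP']; exact mem_range_self _)
          have := hQ.dim_eq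
          rw [hE'.1] at this
          norm_num at this
  push Not at he
  rcases K.exists_vertex_or_edge_or_square z with
    h | ⟨E, hE, s, hs, rfl⟩ | ⟨Q, ⟨c, hQ⟩, a, ha, b, hb, rfl⟩
  · have := hv z h
    rw [dist_self] at this
    norm_num at this
  · have := he E hE s ⟨hs.1.le, hs.2.le⟩
    rw [dist_self] at this
    norm_num at this
  · have ham : a ∈ Icc (0 : ℝ) 1 := ⟨ha.1.le, ha.2.le⟩
    have hbm : b ∈ Icc (0 : ℝ) 1 := ⟨hb.1.le, hb.2.le⟩
    -- `z` is far from the sides of the square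
    have side : ∀ Q : ℝ → ℝ → X, K.IsSquare Q → ∀ x ∈ Icc (0 : ℝ) 1, ∀ y ∈ Icc (0 : ℝ) 1,
        (∀ E, K.IsEdge E → ∀ s ∈ Icc (0 : ℝ) 1, 1 / 12 ≤ dist (Q x y) (E s)) → 1 / 12 ≤ x := by
      intro Q hQ x hx y hy h
      have := h _ hQ.isEdge y hy
      rwa [hQ.dist_fst hK hX hy hx (by simp), sub_zero, abs_of_nonneg hx.1] at this
    have ha0 := side Q ⟨c, hQ⟩ a ham b hbm he
    have ha1 := side _ ⟨c, hQ.flip⟩ (1 - a) (one_sub_mem ham) b hbm (by simpa using he)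
    have hb0 := side _ ⟨c, hQ.swap⟩ b hbm a ham he
    have hb1 := side _ ⟨c, hQ.swap.flip⟩ (1 - b) (one_sub_mem hbm) a ham (by simpa using he)
    have hdep : 1 / 12 ≤ depth a b := le_min (le_min ha0 ha1) (le_min hb0 hb1)
    refine ⟨K.chart c (cubeCenter _), ?_, fun h hh => ?_⟩
    · obtain ⟨x, hx, y, hy, h1⟩ := hQ.surj (cubeCenter _)
      rw [← h1]
      refine (IsSquare.dist_le hK ⟨c, hQ⟩ ham hbm hx hy).trans ((sqrt_sq_add_sq_le _ _).trans ?_)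
      have e1 : |a - x| ≤ 1 := by rw [abs_le]; constructor <;> linarith [ha.1, ha.2, hx.1, hx.2]
      have e2 : |b - y| ≤ 1 := by rw [abs_le]; constructor <;> linarith [hb.1, hb.2, hy.1, hy.2]
      linarith
    · have hmv := hz h hh
      obtain ⟨a', ha', b', hb', h1⟩ := hQ.near hK ha hb (by linarith : _ < depth a b)
      have hd := IsSquare.dist_sq hK hX ⟨c, hQ⟩ ham hbm ha' hb'
      rw [h1] at hd
      have hsq : dist (Q a b) (h • Q a b) ^ 2 < (1 / 24) ^ 2 := by gcongr
      rw [hd] at hsq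
      have e1 : |a - a'| < 1 / 24 := abs_lt_of_sq_lt_sq (by nlinarith) (by norm_num)
      have e2 : |b - b'| < 1 / 24 := abs_lt_of_sq_lt_sq (by nlinarith) (by norm_num)
      rw [abs_lt] at e1 e2
      obtain ⟨d, φ, hφ⟩ := hact h c
      obtain ⟨P, -, hP⟩ := hQ.exists_param
      obtain rfl := hQ.eq_of_mem (a := a') (b := b') (d := d)
        ⟨by linarith [e1.1, e1.2], by linarith [e1.1, e1.2]⟩
        ⟨by linarith [e2.1, e2.2], by linarith [e2.1, e2.2]⟩
        (by rw [h1, hP, hφ]; exact mem_range_self _)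
      rw [hφ, isometryEquiv_cubeCenter]

end Action

end SquareComplex

/-! ### Common stabilisers of two distant walls -/

namespace SquareComplex

section Acylindrical

variable {X : Type u} [MetricSpace X] {K : SquareComplex.{u, v} X} {G : Type w} [Group G]
  [MulAction G X]

/-- In a hyperbolic complex, the common stabiliser of two distant walls fixes a point near the
first one: the part of the first hyperplane that is closest to the second one is bounded and
invariant. -/
theorem IsCellularAction.exists_fixed_near_wall (hact : K.IsCellularAction G)
    (hK : K.IsIntrinsicMetric) (hX : IsCAT0 X) {δ : ℝ} (hδ0 : 0 ≤ δ)
    (hδ : ∀ (x y z : X) (α β γ : ℝ → X),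
      IsGeodesicFrom α x y → IsGeodesicFrom β y z → IsGeodesicFrom γ x z →
        ∀ s ∈ Icc (0 : ℝ) 1, ∃ t ∈ Icc (0 : ℝ) 1,
          dist (α s) (β t) ≤ δ ∨ dist (α s) (γ t) ≤ δ)
    {f h : X → ℝ} (hf : K.IsWall f) (hh : K.IsWall h) {D₀ : ℝ} (hlt : 2 * δ < D₀)
    (hfar : ∀ a c, f a = 1 / 2 → h c = 1 / 2 → D₀ ≤ dist a c) :
    ∃ a p, f a = 1 / 2 ∧ dist a p ≤ 8 * δ + 5 ∧
      ∀ g : G, gact g f = f → gact g h = h → g • p = p := by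
  have half : (1 / 2 : ℝ) ∈ Ioo (0 : ℝ) 1 := by norm_num
  obtain ⟨a₀, ha₀⟩ := hf.exists_eq_half hK hX
  obtain ⟨c₀, hc₀⟩ := hh.exists_eq_half hK hX
  set S : Set ℝ := {l | ∃ a c, f a = 1 / 2 ∧ h c = 1 / 2 ∧ dist a c = l} with hS
  have hS0 : S.Nonempty := ⟨_, a₀, c₀, ha₀, hc₀, rfl⟩
  have hlow : ∀ l ∈ S, D₀ ≤ l := by
    rintro l ⟨a, c, ha, hc, rfl⟩
    exact hfar a c ha hc
  have hD : D₀ ≤ sInf S := le_csInf hS0 hlow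
  obtain ⟨l, ⟨a₁, c₁, ha₁, hc₁, rfl⟩, hl⟩ :=
    exists_lt_of_csInf_lt hS0 (lt_add_of_pos_right (sInf S) one_pos)
  set B : Set X := {a | f a = 1 / 2 ∧ ∃ c, h c = 1 / 2 ∧ dist a c ≤ sInf S + 1} with hB
  have hBdiam : ∀ b ∈ B, ∀ b' ∈ B, dist b b' ≤ 8 * δ + 2 := by
    rintro b ⟨hb, c, hc, hbc⟩ b' ⟨hb', c', hc', hbc'⟩
    exact dist_le_of_hyperbolic hX hδ (A := {a | f a = 1 / 2}) (C := {c | h c = 1 / 2})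
      (fun p hp q hq m hm => hf.level_convex hK hX half hp hq hm)
      (fun p hp q hq m hm => hh.level_convex hK hX half hp hq hm)
      (fun a ha c hc => csInf_le ⟨D₀, hlow⟩ ⟨a, c, ha, hc, rfl⟩) (by linarith) hb hb' hc hc'
      hbc hbc' hδ0
  have hBinv : ∀ g : G, gact g f = f → gact g h = h → ∀ b ∈ B, g⁻¹ • b ∈ B := by
    rintro g hgf hgh b ⟨hb, c, hc, hbc⟩
    refine ⟨?_, g⁻¹ • c, ?_, ?_⟩
    · rw [← hb]; exact congrFun hgf b
    · rw [← hc]; exact congrFun hgh c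
    · rwa [hact.dist_smul hK]
  have hB1 : a₁ ∈ B := ⟨ha₁, c₁, hc₁, hl.le⟩
  obtain ⟨z, hz, hz'⟩ := hX.exists_almost_fixed ⟨_, hB1⟩ hBdiam (ε := 1 / 24) (by norm_num)
  obtain ⟨p, hp, hfix⟩ := hact.exists_fixed_of_almost_fixed hK hX
    (H := {g : G | gact g f = f ∧ gact g h = h}) (z := z) (by
      rintro g ⟨hgf, hgh⟩
      refine hz' _ fun R hR b hb => ?_
      have e : dist (g • z) b = dist z (g⁻¹ • b) := by
        rw [← hact.dist_smul hK g z, smul_inv_smul]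
      rw [e]
      exact hR _ (hBinv g hgf hgh b hb))
  refine ⟨a₁, p, ha₁, ?_, fun g hgf hgh => hfix g ⟨hgf, hgh⟩⟩
  have h1 := hz a₁ hB1
  have h2 := dist_triangle_left a₁ p z
  linarith

/-- The common stabiliser of two distant walls is finite, with a uniform bound. -/
theorem IsCellularAction.encard_stabilizer_le (hact : K.IsCellularAction G)
    (hK : K.IsIntrinsicMetric) (hX : IsCAT0 X) {δ : ℝ} (hδ0 : 0 ≤ δ)
    (hδ : ∀ (x y z : X) (α β γ : ℝ → X),
      IsGeodesicFrom α x y → IsGeodesicFrom β y z → IsGeodesicFrom γ x z →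
        ∀ s ∈ Icc (0 : ℝ) 1, ∃ t ∈ Icc (0 : ℝ) 1,
          dist (α s) (β t) ≤ δ ∨ dist (α s) (γ t) ≤ δ)
    {L : ℝ} {N : ℕ} (hN : ∀ x y : X, L ≤ dist x y → {g : G | g • x = x ∧ g • y = y}.encard ≤ N)
    {f h : X → ℝ} (hf : K.IsWall f) (hh : K.IsWall h) {D₀ : ℝ} (hlt : 2 * δ < D₀)
    (hL : L + 2 * (8 * δ + 5) ≤ D₀)
    (hfar : ∀ a c, f a = 1 / 2 → h c = 1 / 2 → D₀ ≤ dist a c) :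
    {g : G | gact g f = f ∧ gact g h = h}.encard ≤ N := by
  obtain ⟨a, p, ha, hap, hp⟩ := hact.exists_fixed_near_wall hK hX hδ0 hδ hf hh hlt hfar
  obtain ⟨c, q, hc, hcq, hq⟩ := hact.exists_fixed_near_wall hK hX hδ0 hδ hh hf hlt
    fun a c ha hc => by rw [dist_comm]; exact hfar c a hc ha
  have hsub : {g : G | gact g f = f ∧ gact g h = h} ⊆ {g : G | g • p = p ∧ g • q = q} :=
    fun g hg => ⟨hp g hg.1 hg.2, hq g hg.2 hg.1⟩
  refine (Set.encard_le_encard hsub).trans (hN p q ?_)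
  have h1 := hfar a c ha hc
  have h2 := dist_triangle4 a p q c
  rw [dist_comm q c] at h2
  linarith

/-! ### Walls between two vertices that are moved a little -/

/-- If an automorphism moves the vertex `x` a little, then it does not decrease the ranks of walls
by much: the image of a wall below `f` is below the image of `f`, and starts at `x`, unless it is
one of the few walls between `g • x` and `x`. -/
theorem rankIn_le_rankIn_gact (hact : K.IsCellularAction G) (hK : K.IsIntrinsicMetric)
    (hX : IsCAT0 X) {x y : X} (hx : K.IsVertex x) {W : Finset (X → ℝ)}
    (hW : ∀ k, k ∈ W ↔ k ∈ K.Between x y) {g : G} {R : ℕ} (hR : 4 * dist x (g • x) ≤ R)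
    {f : X → ℝ} (hgf : gact g f ∈ W) :
    rankIn WallLT W f ≤ rankIn WallLT W (gact g f) + R := by
  classical
  set B := (Between.finite hK hX (g • x) x).toFinset
  have hB : B.card ≤ R := by
    have := Between.card_le hK hX (K := K) (x := g • x) (y := x) (T := B) (by simp [B])
    rw [dist_comm] at this
    exact_mod_cast this.trans hR
  have hsub : (W.filter fun k => WallLT k f).image (gact g) ⊆
      (W.filter fun k => WallLT k (gact g f)) ∪ B := by
    intro k' hk'
    obtain ⟨k, hk, rfl⟩ := Finset.mem_image.1 hk'
    obtain ⟨hkW, hkf⟩ := Finset.mem_filter.1 hk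
    have hkB := (hW k).1 hkW
    have hwall := hkB.1.gact hact hK hX g
    have hlt := hkf.gact g
    rcases hwall.eq_of_isVertex hK hX hx with h0 | h1
    · refine Finset.mem_union_left _ (Finset.mem_filter.2 ⟨(hW _).2 ⟨hwall, h0, ?_⟩, hlt⟩)
      rcases hlt y with h | h
      · rw [((hW _).1 hgf).2.2] at h
        norm_num at h
      · exact h
    · refine Finset.mem_union_right _ ((Set.Finite.mem_toFinset _).2 ⟨hwall, ?_, h1⟩)
      rw [gact_smul, hkB.2.1]
  have h1 := Finset.card_le_card hsub
  rw [Finset.card_image_of_injective _ (gact_injective g)] at h1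
  have h2 := Finset.card_union_le (W.filter fun k => WallLT k (gact g f)) B
  have e1 : rankIn WallLT W f = (W.filter fun k => WallLT k f).card := by
    unfold rankIn; congr
  have e2 : rankIn WallLT W (gact g f) = (W.filter fun k => WallLT k (gact g f)).card := by
    unfold rankIn; congr
  omega

/-- If an automorphism moves the vertices `x` and `y` a little, then it sends a wall deep between
`x` and `y` to a wall between `x` and `y`: otherwise it would move the whole collection of walls
on one side of it across `x` or `y`. -/
theorem gact_mem_between (hact : K.IsCellularAction G) (hK : K.IsIntrinsicMetric)
    (hX : IsCAT0 X) {x y : X} (hx : K.IsVertex x) (hy : K.IsVertex y) {W : Finset (X → ℝ)}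
    (hW : ∀ k, k ∈ W ↔ k ∈ K.Between x y) {g : G} {R : ℕ} (hRx : 4 * dist x (g • x) ≤ R)
    (hRy : 4 * dist y (g • y) ≤ R) {f : X → ℝ} (hf : f ∈ W) (hlow : R < rankIn WallLT W f)
    (hup : R < rankIn (flip WallLT) W f) : gact g f ∈ W := by
  classical
  have hfB := (hW f).1 hf
  have hwall := hfB.1.gact hact hK hX g
  have big : ∀ (T : Finset (X → ℝ)) (p q : X), 4 * dist p q ≤ R →
      (∀ k ∈ T, gact g k ∈ K.Between p q) → T.card ≤ R := by
    intro T p q hpq hT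
    have h1 : (↑(T.image (gact g)) : Set (X → ℝ)) ⊆ K.Between p q := by
      intro k hk
      obtain ⟨k', hk', rfl⟩ := Finset.mem_image.1 (Finset.mem_coe.1 hk)
      exact hT k' hk'
    have h2 := Between.card_le hK hX h1
    rw [Finset.card_image_of_injective _ (gact_injective g)] at h2
    exact_mod_cast h2.trans hpq
  refine (hW _).2 ⟨hwall, ?_, ?_⟩
  · refine (hwall.eq_of_isVertex hK hX hx).resolve_right fun h1 => hlow.not_ge ?_
    refine big _ (g • x) x (by rwa [dist_comm]) fun k hk => ?_
    obtain ⟨hkW, hkf⟩ := Finset.mem_filter.1 hk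
    have hkB := (hW k).1 hkW
    refine ⟨hkB.1.gact hact hK hX g, by rw [gact_smul, hkB.2.1], ?_⟩
    rcases hkf.gact g x with h | h
    · rw [h1] at h
      norm_num at h
    · exact h
  · refine (hwall.eq_of_isVertex hK hX hy).resolve_left fun h0 => hup.not_ge ?_
    refine big _ y (g • y) hRy fun k hk => ?_
    obtain ⟨hkW, hkf⟩ := Finset.mem_filter.1 hk
    have hkB := (hW k).1 hkW
    refine ⟨hkB.1.gact hact hK hX g, ?_, by rw [gact_smul, hkB.2.2]⟩
    rcases WallLT.gact g hkf y with h | h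
    · exact h
    · rw [h0] at h
      norm_num at h

open Classical in
/-- The walls of `W` whose rank differs from the rank of `f` by at most `R`. -/
noncomputable def rankNhd (W : Finset (X → ℝ)) (R : ℕ) (f : X → ℝ) : Finset (X → ℝ) :=
  W.filter fun k => rankIn WallLT W k ∈
    Finset.Icc (rankIn WallLT W f - R) (rankIn WallLT W f + R)

theorem gact_mem_rankNhd (hact : K.IsCellularAction G) (hK : K.IsIntrinsicMetric)
    (hX : IsCAT0 X) {x y : X} (hx : K.IsVertex x) (hy : K.IsVertex y) {W : Finset (X → ℝ)}
    (hW : ∀ k, k ∈ W ↔ k ∈ K.Between x y) {g : G} {R : ℕ} (hRx : 4 * dist x (g • x) ≤ R)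
    (hRy : 4 * dist y (g • y) ≤ R) {f : X → ℝ} (hf : f ∈ W) (hlow : R < rankIn WallLT W f)
    (hup : R < rankIn (flip WallLT) W f) : gact g f ∈ rankNhd W R f := by
  have hgf := gact_mem_between hact hK hX hx hy hW hRx hRy hf hlow hup
  have h1 := rankIn_le_rankIn_gact hact hK hX hx hW hRx hgf
  have e : dist x (g⁻¹ • x) = dist x (g • x) := by
    rw [← hact.dist_smul hK g, smul_inv_smul, dist_comm]
  have h2 := rankIn_le_rankIn_gact hact hK hX hx hW (g := g⁻¹) (R := R) (f := gact g f)
    (by rwa [e]) (by rwa [gact_inv_gact])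
  rw [gact_inv_gact] at h2
  exact Finset.mem_filter.2 ⟨hgf, Finset.mem_Icc.2 ⟨by omega, h2⟩⟩

theorem Between.width_le_two (hK : K.IsIntrinsicMetric) (hX : IsCAT0 X) {x y : X}
    {f₁ f₂ f₃ : X → ℝ} (h₁ : f₁ ∈ K.Between x y) (h₂ : f₂ ∈ K.Between x y)
    (h₃ : f₃ ∈ K.Between x y) (n12 : f₁ ≠ f₂) (n13 : f₁ ≠ f₃) (n23 : f₂ ≠ f₃) :
    WallLT f₁ f₂ ∨ WallLT f₂ f₁ ∨ WallLT f₁ f₃ ∨ WallLT f₃ f₁ ∨ WallLT f₂ f₃ ∨ WallLT f₃ f₂ := by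
  have tri : ∀ {f h : X → ℝ}, f ∈ K.Between x y → h ∈ K.Between x y →
      WallLT f h ∨ WallLT h f ∨ Cross f h := fun hf hh =>
    hf.1.trichotomy hK hX hh.1 hf.2.1 hf.2.2 hh.2.1 hh.2.2
  have := not_cross_cross_cross hK hX h₁ h₂ h₃ n12 n13 n23
  rcases tri h₁ h₂ with h | h | h
  · tauto
  · tauto
  rcases tri h₁ h₃ with h' | h' | h'
  · tauto
  · tauto
  rcases tri h₂ h₃ with h'' | h'' | h''
  · tauto
  · tauto
  exact (this h h' h'').elim

/-- Two walls with a long chain of walls between them are far apart. -/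
theorem le_dist_of_chain (hK : K.IsIntrinsicMetric) (hX : IsCAT0 X) {f h : X → ℝ}
    {T : Finset (X → ℝ)} (hT : ∀ k ∈ T, K.IsWall k) (hfT : ∀ k ∈ T, WallLT f k)
    (hTh : ∀ k ∈ T, k = h ∨ WallLT k h) {a c : X} (ha : f a = 1 / 2) (hc : h c = 1 / 2) :
    (T.card : ℝ) ≤ 8 * dist a c := by
  have h1 := hK.sum_abs_sub_le hX hT a c
  have h2 : ∑ _k ∈ T, (1 / 2 : ℝ) ≤ ∑ k ∈ T, |k a - k c| := by
    refine Finset.sum_le_sum fun k hk => ?_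
    have e1 : k a = 0 := (hfT k hk a).resolve_right (by rw [ha]; norm_num)
    have e2 : 1 / 2 ≤ k c := by
      rcases hTh k hk with rfl | h
      · exact hc.ge
      · rw [(h c).resolve_left (by rw [hc]; norm_num)]
        norm_num
    rw [e1, zero_sub, abs_neg]
    exact e2.trans (le_abs_self _)
  rw [Finset.sum_const, nsmul_eq_mul] at h2
  linarith

/-- If there are many walls between two vertices, then there are two of them with many walls on
either side, and with a long chain of walls between them. -/
theorem Between.exists_deep_pair (hK : K.IsIntrinsicMetric) (hX : IsCAT0 X) {x y : X}
    {W : Finset (X → ℝ)} (hW : ∀ k, k ∈ W ↔ k ∈ K.Between x y) {R i : ℕ}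
    (hcard : 2 * (R + 1) + 2 * chainBound R i < W.card) :
    ∃ f ∈ W, ∃ h ∈ W, (R < rankIn WallLT W f ∧ R < rankIn (flip WallLT) W f) ∧
      (R < rankIn WallLT W h ∧ R < rankIn (flip WallLT) W h) ∧
      ∃ T ⊆ W, T.card = i ∧ ∀ k ∈ T, WallLT f k ∧ (k = h ∨ WallLT k h) := by
  classical
  have htr : ∀ a b c : X → ℝ, WallLT a b → WallLT b c → WallLT a c := fun _ _ _ => WallLT.trans
  have hirr : ∀ a ∈ W, ¬ WallLT a a := fun a ha => ((hW a).1 ha).1.not_wallLT_self hK hX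
  have hwidth : ∀ a ∈ W, ∀ b ∈ W, ∀ c ∈ W, a ≠ b → a ≠ c → b ≠ c →
      WallLT a b ∨ WallLT b a ∨ WallLT a c ∨ WallLT c a ∨ WallLT b c ∨ WallLT c b :=
    fun a ha b hb c hc => Between.width_le_two hK hX ((hW a).1 ha) ((hW b).1 hb) ((hW c).1 hc)
  have c1 := card_rankIn_mem_le htr hirr hwidth (Finset.range (chainBound R i))
  have c2 := card_rankIn_mem_le (r := flip WallLT) (fun a b c h1 h2 => htr c b a h2 h1) hirr
    (fun a ha b hb c hc n1 n2 n3 => by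
      have := hwidth a ha b hb c hc n1 n2 n3
      unfold flip
      tauto) (Finset.range (R + 1))
  rw [Finset.card_range] at c1 c2
  obtain ⟨h, hh, hlow, hup⟩ : ∃ h ∈ W, chainBound R i ≤ rankIn WallLT W h ∧
      R < rankIn (flip WallLT) W h := by
    by_contra hcon
    push Not at hcon
    have hsub : W ⊆ (W.filter fun a => rankIn WallLT W a ∈ Finset.range (chainBound R i)) ∪
        W.filter fun a => rankIn (flip WallLT) W a ∈ Finset.range (R + 1) := by
      intro k hk
      rw [Finset.mem_union, Finset.mem_filter, Finset.mem_filter, Finset.mem_range,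
        Finset.mem_range]
      by_cases hlt : rankIn WallLT W k < chainBound R i
      · exact Or.inl ⟨hk, hlt⟩
      · exact Or.inr ⟨hk, Nat.lt_succ_of_le (hcon k hk (not_lt.1 hlt))⟩
    have := (Finset.card_le_card hsub).trans (Finset.card_union_le _ _)
    omega
  obtain ⟨f, hf, hfR, hfco, -, T, hT, hTc, hTk⟩ := exists_chain htr hirr hwidth R i hh hlow
  exact ⟨f, hf, h, hh, ⟨hfR, hup.trans_le hfco⟩, ⟨(lt_chainBound R i).trans_le hlow, hup⟩, T, hT,
    hTc, hTk⟩

theorem Between.card_rankNhd_le (hK : K.IsIntrinsicMetric) (hX : IsCAT0 X) {x y : X}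
    {W : Finset (X → ℝ)} (hW : ∀ k, k ∈ W ↔ k ∈ K.Between x y) (R : ℕ) (f : X → ℝ) :
    (rankNhd W R f).card ≤ 2 * (2 * R + 1) := by
  have htr : ∀ a b c : X → ℝ, WallLT a b → WallLT b c → WallLT a c := fun _ _ _ => WallLT.trans
  have h1 := card_rankIn_mem_le htr (fun a ha => ((hW a).1 ha).1.not_wallLT_self hK hX)
    (fun a ha b hb c hc => Between.width_le_two hK hX ((hW a).1 ha) ((hW b).1 hb) ((hW c).1 hc))
    (Finset.Icc (rankIn WallLT W f - R) (rankIn WallLT W f + R))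
  rw [Nat.card_Icc] at h1
  exact h1.trans (by omega)

end Acylindrical

end SquareComplex

open SquareComplex

theorem theoremA {X : Type u} [MetricSpace X] (K : SquareComplex.{u, v} X)
    (hK : K.IsIntrinsicMetric) (hcat : IsCAT0 X) (hhyp : IsHyperbolicSpace X)
    {G : Type w} [Group G] [MulAction G X] (hact : K.IsCellularAction G)
    (hweak : IsWeaklyAcylindrical G X) :
    IsAcylindrical G X := by
  intro r hr
  obtain ⟨-, δ, hδ0, hδ⟩ := hhyp
  obtain ⟨L, N, hL0, hN⟩ := hweak
  -- `x` and `y` will be replaced by vertices at distance at most `2`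
  obtain ⟨R, hR⟩ := exists_nat_ge (4 * (r + 4))
  set D₀ := max (2 * δ + 1) (L + 2 * (8 * δ + 5))
  obtain ⟨i, hi⟩ := exists_nat_ge (8 * D₀)
  set M := 2 * (R + 1) + 2 * chainBound R i
  refine ⟨M + 5, 2 * (2 * R + 1) * (2 * (2 * R + 1)) * N, by positivity, fun x y hxy => ?_⟩
  obtain ⟨x₀, hx₀, hxx⟩ := exists_isVertex_dist_le hK x
  obtain ⟨y₀, hy₀, hyy⟩ := exists_isVertex_dist_le hK y
  set W := (Between.finite hK hcat x₀ y₀).toFinset with hWdef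
  have hW : ∀ k, k ∈ W ↔ k ∈ K.Between x₀ y₀ := fun k => Set.Finite.mem_toFinset _
  have hcard : M < W.card := by
    have h1 := hx₀.dist_le_ncard hK hcat hy₀
    rw [Set.ncard_eq_toFinset_card _ (Between.finite hK hcat x₀ y₀)] at h1
    have h2 := dist_triangle4 x x₀ y₀ y
    rw [dist_comm y₀ y] at h2
    have h3 : (M : ℝ) < W.card := by linarith
    exact_mod_cast h3
  obtain ⟨f, hf, h, hh, hfd, hhd, T, hT, hTc, hTk⟩ :=
    Between.exists_deep_pair hK hcat hW hcard
  have hfar : ∀ a c, f a = 1 / 2 → h c = 1 / 2 → D₀ ≤ dist a c := by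
    intro a c ha hc
    have := le_dist_of_chain hK hcat (fun k hk => ((hW k).1 (hT hk)).1) (fun k hk => (hTk k hk).1)
      (fun k hk => (hTk k hk).2) ha hc
    rw [hTc] at this
    linarith
  have hstab : {g : G | gact g f = f ∧ gact g h = h}.encard ≤ N :=
    hact.encard_stabilizer_le hK hcat hδ0 hδ hN ((hW f).1 hf).1 ((hW h).1 hh).1
      (lt_of_lt_of_le (by linarith) (le_max_left _ _)) (le_max_right _ _) hfar
  have hmove : ∀ (g : G) (p p₀ : X), dist p p₀ ≤ 2 → dist p (g • p) ≤ r →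
      4 * dist p₀ (g • p₀) ≤ R := by
    intro g p p₀ h1 h2
    have h3 := dist_triangle4 p₀ p (g • p) (g • p₀)
    rw [hact.dist_smul hK, dist_comm p₀ p] at h3
    linarith
  refine (encard_le_mul_of_fibers (fun g => (gact g f, gact g h)) (N := N)
    (t := rankNhd W R f ×ˢ rankNhd W R h) ?_ ?_).trans ?_
  · rintro g ⟨hgx, hgy⟩
    have h1 := hmove g x x₀ hxx hgx
    have h2 := hmove g y y₀ hyy hgy
    exact Finset.mem_product.2
      ⟨gact_mem_rankNhd hact hK hcat hx₀ hy₀ hW h1 h2 hf hfd.1 hfd.2,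
        gact_mem_rankNhd hact hK hcat hx₀ hy₀ hW h1 h2 hh hhd.1 hhd.2⟩
  · rintro ⟨f', h'⟩ -
    -- a nonempty fibre is contained in a coset of the common stabiliser of `f` and `h`
    refine le_trans ?_ hstab
    rcases Set.eq_empty_or_nonempty
      {g : G | g ∈ {g : G | dist x (g • x) ≤ r ∧ dist y (g • y) ≤ r} ∧
        (gact g f, gact g h) = (f', h')} with he | ⟨g₀, -, hg₀⟩
    · rw [he]
      simp
    · refine Set.encard_le_encard_of_injOn (f := fun g => g₀⁻¹ * g) ?_
        (mul_right_injective g₀⁻¹).injOn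
      rintro g ⟨-, hg⟩
      rw [← hg₀, Prod.mk.injEq] at hg
      refine ⟨?_, ?_⟩
      · rw [gact_mul, hg.1, gact_inv_gact]
      · rw [gact_mul, hg.2, gact_inv_gact]
  · rw [Finset.card_product]
    have h1 := Between.card_rankNhd_le hK hcat hW R f
    have h2 := Between.card_rankNhd_le hK hcat hW R h
    exact_mod_cast Nat.mul_le_mul_right N (Nat.mul_le_mul h1 h2)
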